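/- **Setting.** Let $\Omega\subseteq\mathbb C^n$ be a bounded connected Reinhardt domain (open, non-empty, and $\lambda z\in\Omega$ for $z\in\Omega$, $\lambda\in\mathbb T^n=\{\lambda\in\mathbb C^n:|\lambda_j|=1\}$; products and conjugates of vectors are taken coordinatewise). Let $\omega:\Omega\to[0,\infty]$ be a multi-radial weight, i.e. $\omega$ is measurable, positive almost everywhere and $\omega(z)$ depends only on $(|z_1|,\dots,|z_n|)$. Let $A^2(\Omega,\omega)$ be the space of holomorphic functions in $L^2(\Omega,\omega\,dV)$, and let $\omega$ be admissible: for each compact $K\subset\Omega$ there is $C_K>0$ with $\sup_K|f|\le C_K\|f\|$ for all $f\in A^2(\Omega,\omega)$. For $\alpha\in\mathbb Z^n$ let $e_\alpha(z)=z^\alpha$, let $\Lambda=\{\alpha\in\mathbb Z^n: e_\alpha\in A^2(\Omega,\omega)\}$, and let $\|c_\alpha\|$ be the norm of the functional $c_\alpha$ on $A^2(\Omega,\omega)$ that sends $f$ to its $\alpha$-th Laurent coefficient. Put $\widetilde\Omega=\{z\bar w:z,w\in\Omega\}$ and $|\Omega|=\{(|z_1|,\dots,|z_n|):z\in\Omega\}$.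 Assume that $\Omega$ is feasible with respect to $\omega$: the series $\sum_{\alpha\in\Lambda}\|c_\alpha\|^2z^\alpha$ converges on $\Omega$ to an analytic function, which has an analytic extension to $\widetilde\Omega$. For $r\in|\Omega|$ let $K_r$ be the periodic distribution given by the weak-* sum $\sum_{\alpha\in\Lambda}\|c_\alpha\|^2r^\alpha e^{i\alpha\cdot\theta}$. A function $g$ on $\Omega$ is *induced by* a periodic distribution $u\in\mathcal D'(\mathbb T^n)$ if, for every $r\in|\Omega|$ and all $\theta$, $g(r_1e^{i\theta_1},\dots,r_ne^{i\theta_n})$ is the sum of the Fourier series of $K_r*u$ at $\theta$. For $g$ analytic on $\Omega$ with an analytic extension to $\widetilde\Omega$ (given by the same Laurent series as $g$, and also denoted by $g$) let $$R_gf(z)=\int_\Omega f(w)\,g(z\bar w)\,\omega(w)\,dV(w),\qquad f\in A^2(\Omega,\omega),\ z\in\Omega .$$ A bounded operator on $A^2(\Omega,\omega)$ is *radial* if every $V_\lambda f=f(\lambda\,\cdot)$, $\lambda\in\mathbb T^n$, is bounded on $A^2(\Omega,\omega)$ and commutes with it. **Theorem 4.5.** Let $S$ be the set of all analytic functions $g$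 on $\Omega$ that are induced by some $u\in\mathcal D'(\mathbb T^n)$, have an analytic extension to $\widetilde\Omega$ as above, and for which $R_g$ is a well-defined (with absolutely convergent integrals), bounded and radial operator on $A^2(\Omega,\omega)$. Equip $S$ with pointwise addition and scalar multiplication (if $u_1,u_2$ induce $g_1,g_2$, then $u_1+u_2$ induces $g_1+g_2$ and $cu_1$ induces $cg_1$), with the product $g_1\times g_2$ induced by the convolution $u_1*u_2$ of distributions inducing $g_1$ and $g_2$, with the involution $g^*(z)=\overline{g(\bar z)}$, and with the norm $\|g\|_S=\|R_g\|$. These operations are well defined on $S$, and $S$ is a von Neumann algebra (a unital $C^*$-algebra with a Banach space predual) of analytic functions on $\Omega$. The map $g\mapsto(\hat u(\alpha))_{\alpha\in\Lambda}$, where $u$ is any distribution inducing $g$, is a well-defined $*$-isometric isomorphism of $S$ onto $\ell^\infty(\Lambda)$. -/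

import Mathlib

open MeasureTheory Set
open scoped ENNReal

noncomputable section

namespace RadialAlgebra

/-! ### Periodic test functions and periodic distributions -/

/-- `C^∞(𝕋ⁿ)`: smooth complex functions on `ℝⁿ` that are `1`-periodic in each variable. -/
def TestFunction (n : ℕ) : Submodule ℂ ((Fin n → ℝ) → ℂ) where
  carrier := {φ | ContDiff ℝ ((⊤ : ℕ∞) : WithTop ℕ∞) φ ∧ ∀ (x : Fin n → ℝ) (k : Fin n → ℤ), φ (fun j => x j + k j) = φ x}
  add_mem' := by
    rintro φ ψ ⟨hφ, pφ⟩ ⟨hψ, pψ⟩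
    exact ⟨hφ.add hψ, fun x k => by simp [pφ x k, pψ x k]⟩
  zero_mem' := ⟨contDiff_const, fun _ _ => rfl⟩
  smul_mem' := by
    rintro c φ ⟨hφ, pφ⟩
    exact ⟨contDiff_const.smul hφ, fun x k => by simp [pφ x k]⟩

/-- `𝒟'(𝕋ⁿ)`: linear functionals on `C^∞(𝕋ⁿ)` that are continuous for the topology of uniform
convergence of all derivatives, i.e. bounded by the derivatives up to some finite order. -/
def PeriodicDistribution (n : ℕ) : Submodule ℂ (Module.Dual ℂ (TestFunction n)) where
  carrier := {u | ∃ (C : ℝ) (m : ℕ), ∀ (φ : TestFunction n) (B : ℝ),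
    (∀ k ≤ m, ∀ x, ‖iteratedFDeriv ℝ k (φ : (Fin n → ℝ) → ℂ) x‖ ≤ B) → ‖u φ‖ ≤ C * B}
  add_mem' := by
    rintro u v ⟨C, m, hu⟩ ⟨D, l, hv⟩
    refine ⟨C + D, max m l, fun φ B h => ?_⟩
    have h₁ := hu φ B fun k hk => h k (hk.trans (le_max_left _ _))
    have h₂ := hv φ B fun k hk => h k (hk.trans (le_max_right _ _))
    calc ‖(u + v) φ‖ ≤ ‖u φ‖ + ‖v φ‖ := norm_add_le _ _
      _ ≤ (C + D) * B := by linarith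
  zero_mem' := ⟨0, 0, fun φ B _ => by simp⟩
  smul_mem' := by
    rintro c u ⟨C, m, hu⟩
    refine ⟨‖c‖ * C, m, fun φ B h => ?_⟩
    calc ‖(c • u) φ‖ = ‖c‖ * ‖u φ‖ := norm_mul c (u φ)
      _ ≤ ‖c‖ * (C * B) := mul_le_mul_of_nonneg_left (hu φ B h) (norm_nonneg _)
      _ = ‖c‖ * C * B := by ring

/-- The character `x ↦ e^{2πi α·x}` of `𝕋ⁿ = ℝⁿ / ℤⁿ`. -/
def char {n : ℕ} (α : Fin n → ℤ) : TestFunction n :=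
  ⟨fun x => Complex.exp (2 * Real.pi * Complex.I * ((∑ j, (α j : ℝ) * x j : ℝ) : ℂ)), by
    refine ⟨?_, fun x k => ?_⟩
    · refine Complex.contDiff_exp.comp (contDiff_const.mul (Complex.ofRealCLM.contDiff.comp ?_))
      exact ContDiff.sum (s := Finset.univ) fun j _ => contDiff_const.mul (contDiff_apply ℝ ℝ j)
    · rw [Complex.exp_eq_exp_iff_exists_int]
      refine ⟨∑ j, α j * k j, ?_⟩
      push_cast
      simp only [mul_add, Finset.sum_add_distrib]
      ring⟩

/-- The translate `y ↦ φ (x + y)` of a test function. -/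
def translate {n : ℕ} (x : Fin n → ℝ) (φ : TestFunction n) : TestFunction n :=
  ⟨fun y => (φ : (Fin n → ℝ) → ℂ) (x + y), φ.2.1.comp (contDiff_const.add contDiff_id), by
    intro y k
    refine (congrArg (φ : (Fin n → ℝ) → ℂ) ?_).trans (φ.2.2 (x + y) k)
    funext j
    simp [add_assoc]⟩

/-- The Fourier coefficient `û(α) = ⟨u, e^{-2πi α·x}⟩` of a periodic distribution. -/
def distFourierCoeff {n : ℕ} (u : PeriodicDistribution n) (α : Fin n → ℤ) : ℂ := u.1 (char (-α))

/-- `w = u * v`, that is, `⟨w, φ⟩ = ⟨u, (ι∘v) * φ⟩` for every test function `φ`, where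
`((ι∘v) * φ)(x) = ⟨v, φ(x + ·)⟩`. -/
def IsConvolution {n : ℕ} (u v w : PeriodicDistribution n) : Prop :=
  ∀ φ : TestFunction n, ∃ ψ : TestFunction n,
    (∀ x, (ψ : (Fin n → ℝ) → ℂ) x = v.1 (translate x φ)) ∧ w.1 φ = u.1 ψ

/-! ### Reinhardt domains and weights -/

/-- Invariance under coordinatewise multiplication by the unit torus. -/
def IsReinhardt {n : ℕ} (Ω : Set (Fin n → ℂ)) : Prop :=
  ∀ z ∈ Ω, ∀ l : Fin n → ℂ, (∀ j, ‖l j‖ = 1) → l * z ∈ Ω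

/-- The Reinhardt shadow `|Ω|`. -/
def shadow {n : ℕ} (Ω : Set (Fin n → ℂ)) : Set (Fin n → ℝ) := (fun z j => ‖z j‖) '' Ω

/-- `Ω̃ = {z w̄ : z, w ∈ Ω}` (coordinatewise product and conjugate). -/
def tildeSet {n : ℕ} (Ω : Set (Fin n → ℂ)) : Set (Fin n → ℂ) :=
  image2 (fun z w => z * star w) Ω Ω

/-- The Laurent monomial `e_α(z) = z₁^{α₁} ⋯ zₙ^{αₙ}`. -/
def mono {n : ℕ} (α : Fin n → ℤ) (z : Fin n → ℂ) : ℂ := ∏ j, z j ^ α j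

/-- `f(z) = ∑ c_α z^α` for all `z ∈ Ω`. -/
def HasLaurentSeries {n : ℕ} (Ω : Set (Fin n → ℂ)) (f : (Fin n → ℂ) → ℂ)
    (c : (Fin n → ℤ) → ℂ) : Prop :=
  ∀ z ∈ Ω, HasSum (fun α => c α * mono α z) (f z)

/-- Multi-radial weights on `Ω`; values of `ω` outside `Ω` are irrelevant. -/
structure IsMultiRadialWeight {n : ℕ} (Ω : Set (Fin n → ℂ)) (ω : (Fin n → ℂ) → ℝ≥0∞) : Prop where
  aemeasurable : AEMeasurable ω (volume.restrict Ω)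
  pos : ∀ᵐ z ∂(volume.restrict Ω), 0 < ω z
  radial : ∃ a : (Fin n → ℝ) → ℝ≥0∞, ∀ z ∈ Ω, ω z = a (fun j => ‖z j‖)

/-- The measure `ω dV` on `Ω`. -/
def wMeasure {n : ℕ} (Ω : Set (Fin n → ℂ)) (ω : (Fin n → ℂ) → ℝ≥0∞) : Measure (Fin n → ℂ) :=
  (volume.restrict Ω).withDensity ω

/-- The weighted Bergman space `A²(Ω, ω)`: the classes in `L²(Ω, ω dV)` of functions that are
holomorphic on `Ω`. -/
def A2 {n : ℕ} (Ω : Set (Fin n → ℂ)) (ω : (Fin n → ℂ) → ℝ≥0∞) :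
    Submodule ℂ (Lp ℂ 2 (wMeasure Ω ω)) where
  carrier := {F | ∃ f : (Fin n → ℂ) → ℂ, DifferentiableOn ℂ f Ω ∧ F =ᵐ[wMeasure Ω ω] f}
  add_mem' := by
    rintro F H ⟨f, df, hf⟩ ⟨h, dh, hh⟩
    exact ⟨f + h, df.add dh, (Lp.coeFn_add F H).trans (hf.add hh)⟩
  zero_mem' := ⟨0, differentiableOn_const 0, Lp.coeFn_zero _ _ _⟩
  smul_mem' := by
    rintro c F ⟨f, df, hf⟩
    exact ⟨c • f, df.const_smul c, (Lp.coeFn_smul c F).trans (hf.const_smul c)⟩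

/-- `f` is a holomorphic representative on `Ω` of the element `F` of `A²(Ω, ω)`. -/
def Represents {n : ℕ} (Ω : Set (Fin n → ℂ)) (ω : (Fin n → ℂ) → ℝ≥0∞)
    (f : (Fin n → ℂ) → ℂ) (F : A2 Ω ω) : Prop :=
  DifferentiableOn ℂ f Ω ∧ (F : Lp ℂ 2 (wMeasure Ω ω)) =ᵐ[wMeasure Ω ω] f

/-- Admissibility (for exponent `2`): point evaluations are bounded on `A²(Ω, ω)`, uniformly on
compact subsets of `Ω`. -/
def IsAdmissible {n : ℕ} (Ω : Set (Fin n → ℂ)) (ω : (Fin n → ℂ) → ℝ≥0∞) : Prop :=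
  ∀ K ⊆ Ω, IsCompact K → ∃ C > (0 : ℝ), ∀ (F : A2 Ω ω) (f : (Fin n → ℂ) → ℂ),
    Represents Ω ω f F → ∀ z ∈ K, ‖f z‖ ≤ C * ‖F‖

/-- `Λ`: the multi-indices `α` with `e_α ∈ A²(Ω, ω)`. -/
def allowable {n : ℕ} (Ω : Set (Fin n → ℂ)) (ω : (Fin n → ℂ) → ℝ≥0∞) : Set (Fin n → ℤ) :=
  {α | DifferentiableOn ℂ (mono α) Ω ∧ MemLp (mono α) 2 (wMeasure Ω ω)}

/-- The norm of the `α`-th Laurent coefficient functional `c_α` on `A²(Ω, ω)`. -/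
def coordNorm {n : ℕ} (Ω : Set (Fin n → ℂ)) (ω : (Fin n → ℂ) → ℝ≥0∞) (α : Fin n → ℤ) : ℝ :=
  sInf {C | 0 ≤ C ∧ ∀ (F : A2 Ω ω) (f : (Fin n → ℂ) → ℂ) (c : (Fin n → ℤ) → ℂ),
    Represents Ω ω f F → HasLaurentSeries Ω f c → ‖c α‖ ≤ C * ‖F‖}

/-- The function `∑_{α ∈ Λ} ‖c_α‖² z^α`. -/
def kernelSum {n : ℕ} (Ω : Set (Fin n → ℂ)) (ω : (Fin n → ℂ) → ℝ≥0∞) (z : Fin n → ℂ) : ℂ :=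
  ∑' α : allowable Ω ω, (coordNorm Ω ω α : ℂ) ^ 2 * mono α z

/-- `Ω` is feasible with respect to `ω`. -/
structure IsFeasible {n : ℕ} (Ω : Set (Fin n → ℂ)) (ω : (Fin n → ℂ) → ℝ≥0∞) : Prop where
  summable : ∀ z ∈ Ω, Summable fun α : allowable Ω ω => (coordNorm Ω ω α : ℂ) ^ 2 * mono α z
  analytic : DifferentiableOn ℂ (kernelSum Ω ω) Ω
  extension : ∃ G : (Fin n → ℂ) → ℂ, DifferentiableOn ℂ G (tildeSet Ω) ∧
    EqOn G (kernelSum Ω ω) (Ω ∩ tildeSet Ω)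

/-! ### Functions induced by distributions -/

/-- `K = K_r`: the weak-* sum of `∑_{α ∈ Λ} ‖c_α‖² r^α e^{2πi α·x}`. -/
def IsKernelDistrib {n : ℕ} (Ω : Set (Fin n → ℂ)) (ω : (Fin n → ℂ) → ℝ≥0∞)
    (r : Fin n → ℝ) (K : PeriodicDistribution n) : Prop :=
  ∀ φ : TestFunction n, HasSum
    (fun α : allowable Ω ω => (coordNorm Ω ω α : ℂ) ^ 2 * mono α (fun j => (r j : ℂ)) *
      ∫ x in Icc (0 : Fin n → ℝ) 1,
        (char (α : Fin n → ℤ) : (Fin n → ℝ) → ℂ) x * (φ : (Fin n → ℝ) → ℂ) x)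
    (K.1 φ)

/-- `g` is induced by `u`: for each `r ∈ |Ω|` the function `g_r(x) = g(r e^{2πix})` on the torus is
the sum of the Fourier series of `K_r * u`. -/
def InducedBy {n : ℕ} (Ω : Set (Fin n → ℂ)) (ω : (Fin n → ℂ) → ℝ≥0∞)
    (g : (Fin n → ℂ) → ℂ) (u : PeriodicDistribution n) : Prop :=
  ∀ r ∈ shadow Ω, ∃ K L : PeriodicDistribution n, IsKernelDistrib Ω ω r K ∧ IsConvolution K u L ∧
    ∀ x : Fin n → ℝ, HasSum
      (fun α : Fin n → ℤ => distFourierCoeff L α * (char α : (Fin n → ℝ) → ℂ) x)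
      (g fun j => (r j : ℂ) * Complex.exp (2 * Real.pi * Complex.I * (x j : ℂ)))

/-! ### The operators `R_g` -/

/-- `G` is the analytic extension of `g` from `Ω` to `Ω̃`, i.e. the holomorphic function on `Ω̃` with
the same Laurent series as `g`. (This is the unique analytic function on `Ω̃` agreeing with `g` on
`Ω ∩ Ω̃` if that intersection is nonempty, and it is determined by `g` in every case.) -/
def IsExtension {n : ℕ} (Ω : Set (Fin n → ℂ)) (g G : (Fin n → ℂ) → ℂ) : Prop :=
  DifferentiableOn ℂ G (tildeSet Ω) ∧
    ∃ c, HasLaurentSeries Ω g c ∧ HasLaurentSeries (tildeSet Ω) G c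

/-- `R` is the bounded operator `f ↦ ∫_Ω f(w) G(z w̄) ω(w) dV(w)` on `A²(Ω, ω)`, the integrals
being absolutely convergent. -/
def IsIntegralOperator {n : ℕ} (Ω : Set (Fin n → ℂ)) (ω : (Fin n → ℂ) → ℝ≥0∞)
    (G : (Fin n → ℂ) → ℂ) (R : A2 Ω ω →L[ℂ] A2 Ω ω) : Prop :=
  ∀ (F : A2 Ω ω) (f : (Fin n → ℂ) → ℂ), Represents Ω ω f F →
    (∀ z ∈ Ω, Integrable (fun w => f w * G (z * star w)) (wMeasure Ω ω)) ∧
    Represents Ω ω (fun z => ∫ w, f w * G (z * star w) ∂(wMeasure Ω ω)) (R F)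

/-- `R = R_g`, a bounded operator on `A²(Ω, ω)`. -/
def IsOperatorOf {n : ℕ} (Ω : Set (Fin n → ℂ)) (ω : (Fin n → ℂ) → ℝ≥0∞)
    (g : (Fin n → ℂ) → ℂ) (R : A2 Ω ω →L[ℂ] A2 Ω ω) : Prop :=
  ∃ G, IsExtension Ω g G ∧ IsIntegralOperator Ω ω G R

/-- `R` is radial: each `V_λ f = f(λ ·)`, `λ ∈ 𝕋ⁿ`, is bounded on `A²(Ω, ω)` and commutes
with `R`. -/
def IsRadial {n : ℕ} (Ω : Set (Fin n → ℂ)) (ω : (Fin n → ℂ) → ℝ≥0∞)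
    (R : A2 Ω ω →L[ℂ] A2 Ω ω) : Prop :=
  ∀ l : Fin n → ℂ, (∀ j, ‖l j‖ = 1) → ∃ V : A2 Ω ω →L[ℂ] A2 Ω ω,
    (∀ (F : A2 Ω ω) (f : (Fin n → ℂ) → ℂ), Represents Ω ω f F →
      Represents Ω ω (fun z => f (l * z)) (V F)) ∧
    R.comp V = V.comp R

/-- The set `S` of analytic functions `g` on `Ω`, induced by a periodic distribution, for which
`R_g` is bounded and radial. A function on `Ω` is represented by its extension by `0` to `ℂⁿ`, so
that equality in `S` is equality of functions on `Ω`. -/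
structure SymbolAlgebra {n : ℕ} (Ω : Set (Fin n → ℂ)) (ω : (Fin n → ℂ) → ℝ≥0∞) where
  toFun : (Fin n → ℂ) → ℂ
  eq_zero_outside : ∀ z ∉ Ω, toFun z = 0
  analytic : DifferentiableOn ℂ toFun Ω
  induced : ∃ u : PeriodicDistribution n, InducedBy Ω ω toFun u
  bounded_radial : ∃ R : A2 Ω ω →L[ℂ] A2 Ω ω, IsOperatorOf Ω ω toFun R ∧ IsRadial Ω ω R

end RadialAlgebra

end

open RadialAlgebra

/-!
The monomials `e_α`, `α ∈ Λ`, form an orthogonal basis of `A²(Ω, ω)`, and everything in sight is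
diagonal in it.

*The basis.* Averaging over the torus shows that `⟨e_α, f⟩` depends only on the homogeneous
component of `f` of degree `α`, and by the identity theorem that component is a multiple of `e_α`
(`exists_homPart_eq`). A function orthogonal to every `e_α` therefore has no homogeneous
components, and so it vanishes. Hence `‖c_α‖ = ‖e_α‖⁻¹` (`coordNorm_eq`), and the functions
`‖c_α‖ e_α` form a Hilbert basis (`basis`). In particular the reproducing kernel is
`K(z, w) = ∑ ‖c_α‖² (z w̄)^α`. Expanding it by Parseval's identity shows that for bounded `m` the
symbol `∑ ‖c_α‖² m_α z^α` converges on `Ω̃`; on `Ω` it converges by feasibility.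

*Operators.* If `G` has the Laurent coefficients `a_α` on `Ω̃`, integration against `G(z w̄)` maps
`e_α` to `a_α ‖e_α‖² e_α` (`operator_monoA2`). So `R_g` is the multiplier with eigenvalues
`m_α = a_α ‖c_α‖⁻²`, and its norm is `sup |m_α|`, whence `m ∈ ℓ^∞(Λ)` (`exists_multiplier`).
Conversely, for every `m ∈ ℓ^∞(Λ)` the multiplier is the integral operator of its symbol
(`isIntegralOperator_symbolSum`), and it commutes with the rotations because these are multipliers
as well.

*Distributions.* Convolution multiplies Fourier coefficients, so `u` induces `g` if and only if `g`
is the sum of the Laurent series with coefficients `‖c_α‖² û(α)` (`inducedBy_iff`). By uniqueness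
of Laurent coefficients, `û(α) = m_α` for `α ∈ Λ`. Conversely, bounded sequences are Fourier
coefficients of distributions (`exists_distribution`).

Together these facts say that `g ↦ (û(α))_α` is a bijection of `S` onto `ℓ^∞(Λ)` (`symbolEquiv`),
and that it carries the prescribed operations and norm to those of `ℓ^∞(Λ)`. The structure of `S` is
transported along it, and the predual is `ℓ¹(Λ)`.

The points where coordinates vanish need care. A Laurent monomial with a negative exponent in the
`j`-th variable still has a value where `z_j = 0`, by the convention `0⁻¹ = 0`, but it is not
holomorphic there. Exponents in `Λ` are nonnegative in each variable that vanishes somewhere on `Ω`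
(`regular_of_differentiableOn_mono`), and identities between homogeneous components are stated with
cleared denominators.
-/

noncomputable section

namespace RadialAlgebra

/-! ### Fourier series on the unit cube -/

/-- The point `(e^{2πi x₁}, …, e^{2πi xₙ})` of the torus. -/
def torusPt {n : ℕ} (x : Fin n → ℝ) : Fin n → ℂ :=
  fun j => Complex.exp (2 * Real.pi * Complex.I * (x j : ℂ))

theorem norm_torusPt {n : ℕ} (x : Fin n → ℝ) (j : Fin n) : ‖torusPt x j‖ = 1 := by
  have : 2 * (Real.pi : ℂ) * Complex.I * (x j : ℂ) = ((2 * Real.pi * x j : ℝ) : ℂ) * Complex.I := by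
    push_cast; ring
  rw [torusPt, this, Complex.norm_exp_ofReal_mul_I]

theorem torusPt_ne_zero {n : ℕ} (x : Fin n → ℝ) (j : Fin n) : torusPt x j ≠ 0 :=
  Complex.exp_ne_zero _

theorem continuous_torusPt {n : ℕ} : Continuous (torusPt (n := n)) := by
  unfold torusPt; fun_prop

theorem torusPt_add {n : ℕ} (x y : Fin n → ℝ) : torusPt (x + y) = torusPt x * torusPt y := by
  funext j; simp [torusPt, mul_add, Complex.exp_add]

theorem mono_mul {n : ℕ} (α : Fin n → ℤ) (z w : Fin n → ℂ) :
    mono α (z * w) = mono α z * mono α w := by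
  simp [mono, mul_zpow, Finset.prod_mul_distrib]

theorem char_eq_mono {n : ℕ} (α : Fin n → ℤ) (x : Fin n → ℝ) :
    (char α : (Fin n → ℝ) → ℂ) x = mono α (torusPt x) := by
  simp only [char, mono, torusPt, ← Complex.exp_int_mul, ← Complex.exp_sum]
  congr 1
  push_cast
  rw [Finset.mul_sum]
  exact Finset.sum_congr rfl fun j _ => by ring

theorem norm_char {n : ℕ} (α : Fin n → ℤ) (x : Fin n → ℝ) :
    ‖(char α : (Fin n → ℝ) → ℂ) x‖ = 1 := by
  simp [char_eq_mono, mono, norm_torusPt]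

theorem char_zero {n : ℕ} (x : Fin n → ℝ) : (char (0 : Fin n → ℤ) : (Fin n → ℝ) → ℂ) x = 1 := by
  simp [char_eq_mono, mono]

theorem char_add {n : ℕ} (α β : Fin n → ℤ) (x : Fin n → ℝ) :
    (char (α + β) : (Fin n → ℝ) → ℂ) x
      = (char α : (Fin n → ℝ) → ℂ) x * (char β : (Fin n → ℝ) → ℂ) x := by
  simp [char_eq_mono, mono, zpow_add₀ (torusPt_ne_zero _ _), Finset.prod_mul_distrib]

theorem char_apply_add {n : ℕ} (α : Fin n → ℤ) (x y : Fin n → ℝ) :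
    (char α : (Fin n → ℝ) → ℂ) (x + y)
      = (char α : (Fin n → ℝ) → ℂ) x * (char α : (Fin n → ℝ) → ℂ) y := by
  rw [char_eq_mono, char_eq_mono, char_eq_mono, torusPt_add, mono_mul]

theorem char_neg {n : ℕ} (α : Fin n → ℤ) (x : Fin n → ℝ) :
    (char (-α) : (Fin n → ℝ) → ℂ) x = star ((char α : (Fin n → ℝ) → ℂ) x) := by
  have h := char_add (-α) α x
  rw [neg_add_cancel, char_zero] at h
  have h2 : star ((char α : (Fin n → ℝ) → ℂ) x) * (char α : (Fin n → ℝ) → ℂ) x = 1 := by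
    rw [Complex.star_def, Complex.conj_mul', norm_char]; simp
  have h0 : (char α : (Fin n → ℝ) → ℂ) x ≠ 0 := by
    rw [← norm_ne_zero_iff, norm_char]; exact one_ne_zero
  exact mul_right_cancel₀ h0 (h.symm.trans h2.symm)

theorem continuous_char {n : ℕ} (α : Fin n → ℤ) : Continuous (char α : (Fin n → ℝ) → ℂ) :=
  (char α).2.1.continuous

/-- Invariance under translations by `ℤⁿ`. -/
def IsPeriodic {n : ℕ} (F : (Fin n → ℝ) → ℂ) : Prop :=
  ∀ (x : Fin n → ℝ) (k : Fin n → ℤ), F (fun j => x j + k j) = F x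

/-- A periodic function descends to the torus `(ℝ/ℤ)ⁿ` of Mathlib. -/
theorem exists_torus_lift {n : ℕ} {F : (Fin n → ℝ) → ℂ} (hF : IsPeriodic F) :
    ∃ f : UnitAddTorus (Fin n) → ℂ, ∀ x : Fin n → ℝ, f (fun i => (x i : UnitAddCircle)) = F x := by
  refine ⟨fun t => F fun i => Quotient.out (t i), fun x => ?_⟩
  have h : ∀ i, ∃ k : ℤ, Quotient.out ((x i : ℝ) : UnitAddCircle) = x i + k := by
    intro i
    have h1 : ((Quotient.out ((x i : ℝ) : UnitAddCircle) : ℝ) : UnitAddCircle) = (x i : ℝ) :=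
      Quotient.out_eq _
    rw [← sub_eq_zero, ← AddCircle.coe_sub, AddCircle.coe_eq_zero_iff] at h1
    obtain ⟨k, hk⟩ := h1
    exact ⟨k, by simp at hk; linarith⟩
  choose k hk using h
  simp only [hk]
  exact hF x k

theorem exists_continuous_torus_lift {n : ℕ} {F : (Fin n → ℝ) → ℂ} (hF : IsPeriodic F)
    (hc : Continuous F) :
    ∃ f : C(UnitAddTorus (Fin n), ℂ),
      ∀ x : Fin n → ℝ, f (fun i => (x i : UnitAddCircle)) = F x := by
  obtain ⟨f, hf⟩ := exists_torus_lift hF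
  have hq : IsOpenQuotientMap
      (Pi.map (fun (_ : Fin n) (x : ℝ) => (x : UnitAddCircle))) :=
    IsOpenQuotientMap.piMap fun _ => QuotientAddGroup.isOpenQuotientMap_mk
  refine ⟨⟨f, hq.isQuotientMap.continuous_iff.2 ?_⟩, hf⟩
  have : f ∘ (Pi.map (fun (_ : Fin n) (x : ℝ) => (x : UnitAddCircle))) = F := funext hf
  rwa [this]

/-- The closed and the half-open unit cube differ by a null set; the latter is the fundamental
domain used for `UnitAddTorus`. -/
theorem setIntegral_cube_eq_Ioc {n : ℕ} (F : (Fin n → ℝ) → ℂ) :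
    ∫ x in Icc (0 : Fin n → ℝ) 1, F x
      = ∫ x in {x : Fin n → ℝ | ∀ i, x i ∈ Ioc ((0 : Fin n → ℝ) i) ((0 : Fin n → ℝ) i + 1)},
          F x := by
  refine setIntegral_congr_set ?_
  have h := Measure.univ_pi_Ioc_ae_eq_Icc (μ := fun _ : Fin n => (volume : Measure ℝ))
    (f := (0 : Fin n → ℝ)) (g := 1)
  refine h.symm.trans (Filter.EventuallyEq.of_eq (Set.ext fun x => ?_))
  simp

theorem setIntegral_cube_translate {n : ℕ} {F : (Fin n → ℝ) → ℂ} (hF : IsPeriodic F)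
    (h : Fin n → ℝ) :
    ∫ x in Icc (0 : Fin n → ℝ) 1, F (h + x) = ∫ x in Icc (0 : Fin n → ℝ) 1, F x := by
  obtain ⟨f, hf⟩ := exists_torus_lift hF
  have h0 := UnitAddTorus.integral_preimage f 0
  have h1 := UnitAddTorus.integral_preimage f h
  rw [setIntegral_cube_eq_Ioc, setIntegral_cube_eq_Ioc]
  simp only [hf] at h0 h1
  have mp := measurePreserving_add_left (volume : Measure (Fin n → ℝ)) h
  rw [← h0, h1, ← mp.setIntegral_preimage_emb (measurableEmbedding_addLeft h) F]
  congr 2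
  ext x
  simp

/-- The Fourier coefficient `∫_{[0,1]ⁿ} e^{-2πi α·x} F(x) dx` of a function. -/
def cubeCoeff {n : ℕ} (F : (Fin n → ℝ) → ℂ) (α : Fin n → ℤ) : ℂ :=
  ∫ x in Icc (0 : Fin n → ℝ) 1, (char (-α) : (Fin n → ℝ) → ℂ) x * F x

instance isProbabilityMeasure_cube {n : ℕ} :
    IsProbabilityMeasure (volume.restrict (Icc (0 : Fin n → ℝ) 1)) :=
  ⟨by simp [Real.volume_Icc_pi]⟩

theorem norm_cubeCoeff_le {n : ℕ} {F : (Fin n → ℝ) → ℂ} {B : ℝ} (hB : ∀ x, ‖F x‖ ≤ B)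
    (α : Fin n → ℤ) : ‖cubeCoeff F α‖ ≤ B := by
  have := norm_integral_le_of_norm_le_const
    (μ := volume.restrict (Icc (0 : Fin n → ℝ) 1))
    (f := fun x => (char (-α) : (Fin n → ℝ) → ℂ) x * F x) (C := B)
    (Filter.Eventually.of_forall fun x => by rw [norm_mul, norm_char, one_mul]; exact hB x)
  simpa [cubeCoeff] using this

theorem isPeriodic_char {n : ℕ} (α : Fin n → ℤ) : IsPeriodic (char α : (Fin n → ℝ) → ℂ) :=
  (char α).2.2

theorem cubeCoeff_comp_add {n : ℕ} {F : (Fin n → ℝ) → ℂ} (hF : IsPeriodic F)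
    (h : Fin n → ℝ) (α : Fin n → ℤ) :
    cubeCoeff (fun x => F (h + x)) α = (char α : (Fin n → ℝ) → ℂ) h * cubeCoeff F α := by
  have hp : IsPeriodic fun x => (char (-α) : (Fin n → ℝ) → ℂ) x * F x := fun x k => by
    simp only [hF x k, isPeriodic_char (-α) x k]
  have h1 := setIntegral_cube_translate hp h
  simp only [char_apply_add, mul_assoc, integral_const_mul] at h1
  rw [cubeCoeff, cubeCoeff, ← h1, ← mul_assoc, ← char_add]
  simp [char_zero]

theorem mFourier_coe {n : ℕ} (α : Fin n → ℤ) (x : Fin n → ℝ) :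
    UnitAddTorus.mFourier α (fun i => (x i : UnitAddCircle)) = (char α : (Fin n → ℝ) → ℂ) x := by
  simp only [UnitAddTorus.mFourier, ContinuousMap.coe_mk, fourier_coe_apply, char_eq_mono, mono,
    torusPt, ← Complex.exp_int_mul]
  refine Finset.prod_congr rfl fun j _ => ?_
  congr 1
  simp; ring

theorem mFourierCoeff_eq_cubeCoeff {n : ℕ} {F : (Fin n → ℝ) → ℂ} {f : UnitAddTorus (Fin n) → ℂ}
    (hf : ∀ x : Fin n → ℝ, f (fun i => (x i : UnitAddCircle)) = F x) (α : Fin n → ℤ) :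
    UnitAddTorus.mFourierCoeff f α = cubeCoeff F α := by
  rw [UnitAddTorus.mFourierCoeff_eq_integral f α 0, cubeCoeff, setIntegral_cube_eq_Ioc]
  simp only [mFourier_coe, hf, smul_eq_mul]

/-- Fourier inversion for continuous periodic functions with summable coefficients. -/
theorem hasSum_cubeCoeff {n : ℕ} {F : (Fin n → ℝ) → ℂ} (hF : IsPeriodic F) (hc : Continuous F)
    (hs : Summable (cubeCoeff F)) (x : Fin n → ℝ) :
    HasSum (fun α => cubeCoeff F α * (char α : (Fin n → ℝ) → ℂ) x) (F x) := by
  obtain ⟨f, hf⟩ := exists_continuous_torus_lift hF hc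
  have hco : UnitAddTorus.mFourierCoeff f = cubeCoeff F :=
    funext (mFourierCoeff_eq_cubeCoeff hf)
  have := UnitAddTorus.hasSum_mFourier_series_apply_of_summable (f := f) (by rwa [hco])
    (fun i => (x i : UnitAddCircle))
  simpa only [hco, mFourier_coe, hf, smul_eq_mul] using this

theorem eq_zero_of_cubeCoeff_eq_zero {n : ℕ} {F : (Fin n → ℝ) → ℂ} (hF : IsPeriodic F)
    (hc : Continuous F) (h : ∀ α, cubeCoeff F α = 0) (x : Fin n → ℝ) : F x = 0 := by
  have h0 : cubeCoeff F = 0 := funext h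
  have := hasSum_cubeCoeff hF hc (h0 ▸ summable_zero) x
  simp only [h, zero_mul] at this
  exact this.unique hasSum_zero

theorem setIntegral_cube_char {n : ℕ} (α : Fin n → ℤ) :
    ∫ x in Icc (0 : Fin n → ℝ) 1, (char α : (Fin n → ℝ) → ℂ) x = if α = 0 then 1 else 0 := by
  split_ifs with h
  · subst h; simp [char_zero]
  · obtain ⟨j, hj⟩ := Function.ne_iff.1 h
    -- translating by `1 / (2 α j)` in the `j`-th direction changes the sign of the character
    set t : Fin n → ℝ := Pi.single j (1 / (2 * (α j : ℝ))) with ht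
    have h1 := setIntegral_cube_translate (isPeriodic_char α) t
    have h2 : (char α : (Fin n → ℝ) → ℂ) t = -1 := by
      have h3 : ∑ i, (α i : ℝ) * t i = 1 / 2 := by
        rw [Finset.sum_eq_single j]
        · have : (α j : ℝ) ≠ 0 := by exact_mod_cast hj
          rw [ht, Pi.single_eq_same]; field_simp
        · intro i _ hi; simp [ht, hi]
        · simp
      change Complex.exp _ = _
      rw [h3, ← Complex.exp_pi_mul_I]
      congr 1
      push_cast; ring
    simp only [char_apply_add, h2, integral_const_mul] at h1
    linear_combination (-1 / 2 : ℂ) * h1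

theorem cubeCoeff_char {n : ℕ} (α β : Fin n → ℤ) :
    cubeCoeff (char β : (Fin n → ℝ) → ℂ) α = if α = β then 1 else 0 := by
  simp only [cubeCoeff, ← char_add, setIntegral_cube_char]
  refine if_congr ?_ rfl rfl
  rw [neg_add_eq_zero]

/-- The Fourier coefficients of an absolutely convergent trigonometric series. -/
theorem cubeCoeff_of_hasSum {n : ℕ} {F : (Fin n → ℝ) → ℂ} {a : (Fin n → ℤ) → ℂ}
    (ha : Summable a)
    (h : ∀ x, HasSum (fun β => a β * (char β : (Fin n → ℝ) → ℂ) x) (F x)) (α : Fin n → ℤ) :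
    cubeCoeff F α = a α := by
  have h1 : HasSum (fun β => ∫ x in Icc (0 : Fin n → ℝ) 1,
      (char (-α) : (Fin n → ℝ) → ℂ) x * (a β * (char β : (Fin n → ℝ) → ℂ) x)) (cubeCoeff F α) := by
    refine hasSum_integral_of_dominated_convergence (fun β _ => ‖a β‖) (fun β => ?_) (fun β => ?_)
      (Filter.Eventually.of_forall fun _ => ha.norm) (integrable_const _)
      (Filter.Eventually.of_forall fun x => (h x).mul_left _)
    · exact ((continuous_char _).mul (continuous_const.mul (continuous_char _))).aestronglyMeasurable
    · exact Filter.Eventually.of_forall fun x => by simp [norm_char]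
  have h2 : ∀ β, ∫ x in Icc (0 : Fin n → ℝ) 1,
      (char (-α) : (Fin n → ℝ) → ℂ) x * (a β * (char β : (Fin n → ℝ) → ℂ) x)
        = if β = α then a α else 0 := by
    intro β
    have := cubeCoeff_char α β
    simp only [cubeCoeff] at this
    simp only [mul_left_comm _ (a β), integral_const_mul, this]
    rcases eq_or_ne α β with rfl | h3
    · simp
    · simp [h3, h3.symm]
  simp only [h2] at h1
  exact h1.unique (hasSum_ite_eq α (a α))

/-! ### Decay of Fourier coefficients -/

theorem exists_norm_apply_eq {n : ℕ} {α : Fin n → ℤ} (hα : α ≠ 0) :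
    ∃ j, α j ≠ 0 ∧ ‖α‖ = |(α j : ℝ)| := by
  have h0 : 0 < ‖α‖ := norm_pos_iff.2 hα
  have : ∃ j, ‖α‖ ≤ ‖α j‖ := by
    by_contra! h
    exact lt_irrefl _ ((pi_norm_lt_iff h0).2 h)
  obtain ⟨j, hj⟩ := this
  have h1 : ‖α‖ = ‖α j‖ := le_antisymm hj (norm_le_pi_norm α j)
  refine ⟨j, fun h => ?_, by rw [h1, Int.norm_eq_abs]⟩
  rw [h1, h, norm_zero] at h0
  exact lt_irrefl _ h0

/-- By the mean value inequality, passing to a difference `φ(h + ·) - φ` trades one derivative for a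
factor `‖h‖`. -/
theorem norm_iteratedFDeriv_translate_sub_le {n : ℕ} (φ : TestFunction n) (h : Fin n → ℝ) {k : ℕ}
    {B : ℝ} (hB : ∀ x, ‖iteratedFDeriv ℝ (k + 1) (φ : (Fin n → ℝ) → ℂ) x‖ ≤ B)
    (x : Fin n → ℝ) :
    ‖iteratedFDeriv ℝ k ((translate h φ - φ : TestFunction n) : (Fin n → ℝ) → ℂ) x‖ ≤ B * ‖h‖ := by
  have e : ((translate h φ - φ : TestFunction n) : (Fin n → ℝ) → ℂ)
      = (fun y => (φ : (Fin n → ℝ) → ℂ) (h + y)) - (φ : (Fin n → ℝ) → ℂ) := rfl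
  have hs : ContDiff ℝ k (φ : (Fin n → ℝ) → ℂ) := φ.2.1.of_le (by exact_mod_cast le_top)
  have hs' : ContDiff ℝ k fun y => (φ : (Fin n → ℝ) → ℂ) (h + y) :=
    hs.comp (contDiff_const.add contDiff_id)
  rw [e, iteratedFDeriv_sub_apply hs'.contDiffAt hs.contDiffAt, iteratedFDeriv_comp_add_left]
  have hd : Differentiable ℝ (iteratedFDeriv ℝ k (φ : (Fin n → ℝ) → ℂ)) :=
    φ.2.1.differentiable_iteratedFDeriv (by exact_mod_cast WithTop.coe_lt_top k)
  have := Convex.norm_image_sub_le_of_norm_fderiv_le (𝕜 := ℝ) (s := univ) (x := x) (y := h + x)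
    (C := B) (f := iteratedFDeriv ℝ k (φ : (Fin n → ℝ) → ℂ)) (fun y _ => hd y)
    (fun y _ => by rw [norm_fderiv_iteratedFDeriv]; exact hB y) convex_univ trivial trivial
  simpa using this

theorem cubeCoeff_sub {n : ℕ} {F G : (Fin n → ℝ) → ℂ} (hF : Continuous F) (hG : Continuous G)
    (α : Fin n → ℤ) : cubeCoeff (F - G) α = cubeCoeff F α - cubeCoeff G α := by
  simp only [cubeCoeff, Pi.sub_apply, mul_sub]
  exact integral_sub ((continuous_char _).mul hF).integrableOn_Icc
    ((continuous_char _).mul hG).integrableOn_Icc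

/-- Decay of the Fourier coefficients of a smooth function: translating by half a wave length in
the direction of the largest frequency changes the sign of the character, which trades one
derivative for a factor `1 / (4 ‖α‖)`. -/
theorem norm_cubeCoeff_le_of_iteratedFDeriv {n : ℕ} {α : Fin n → ℤ} (hα : α ≠ 0) (N : ℕ) :
    ∀ (φ : TestFunction n) (B : ℝ),
      (∀ x, ‖iteratedFDeriv ℝ N (φ : (Fin n → ℝ) → ℂ) x‖ ≤ B) →
      ‖cubeCoeff (φ : (Fin n → ℝ) → ℂ) α‖ ≤ B * (1 / (4 * ‖α‖)) ^ N := by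
  obtain ⟨j, hj0, hj⟩ := exists_norm_apply_eq hα
  have hj' : (α j : ℝ) ≠ 0 := by exact_mod_cast hj0
  induction N with
  | zero =>
    intro φ B hB
    simpa using norm_cubeCoeff_le (fun x => by simpa using hB x) α
  | succ N ih =>
    intro φ B hB
    set h : Fin n → ℝ := Pi.single j (1 / (2 * (α j : ℝ))) with hh
    have hn : ‖h‖ = 1 / (2 * ‖α‖) := by
      rw [hh, Pi.norm_single, hj, norm_div, norm_mul]; simp
    have hc : (char α : (Fin n → ℝ) → ℂ) h = -1 := by
      have h3 : ∑ i, (α i : ℝ) * h i = 1 / 2 := by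
        rw [Finset.sum_eq_single j]
        · rw [hh, Pi.single_eq_same]; field_simp
        · intro i _ hi; simp [hh, hi]
        · simp
      change Complex.exp _ = _
      rw [h3, ← Complex.exp_pi_mul_I]
      congr 1
      push_cast; ring
    have h1 := ih (translate h φ - φ) _ (norm_iteratedFDeriv_translate_sub_le φ h hB)
    have h2 : cubeCoeff ((translate h φ - φ : TestFunction n) : (Fin n → ℝ) → ℂ) α
        = -2 * cubeCoeff (φ : (Fin n → ℝ) → ℂ) α := by
      have := cubeCoeff_comp_add φ.2.2 h α
      change cubeCoeff ((fun y => (φ : (Fin n → ℝ) → ℂ) (h + y)) - (φ : (Fin n → ℝ) → ℂ)) α = _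
      have hcont : Continuous fun y => (φ : (Fin n → ℝ) → ℂ) (h + y) :=
        φ.2.1.continuous.comp (continuous_const.add continuous_id)
      rw [cubeCoeff_sub hcont φ.2.1.continuous, this, hc]
      ring
    rw [h2, norm_mul, hn] at h1
    have h4 : B * (1 / (4 * ‖α‖)) ^ (N + 1)
        = (B * (1 / (2 * ‖α‖)) * (1 / (4 * ‖α‖)) ^ N) / 2 := by
      rw [pow_succ]; ring
    rw [h4]
    norm_num at h1 ⊢
    linarith

theorem norm_cubeCoeff_le_pow {n : ℕ} (φ : TestFunction n) {N : ℕ} {B : ℝ}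
    (hB : ∀ k ≤ N, ∀ x, ‖iteratedFDeriv ℝ k (φ : (Fin n → ℝ) → ℂ) x‖ ≤ B) (α : Fin n → ℤ) :
    ‖cubeCoeff (φ : (Fin n → ℝ) → ℂ) α‖ ≤ B * ((1 + ‖α‖)⁻¹) ^ N := by
  have hB0 : 0 ≤ B := (norm_nonneg _).trans (hB 0 (Nat.zero_le _) 0)
  rcases eq_or_ne α 0 with rfl | hα
  · simpa using norm_cubeCoeff_le (fun x => by simpa using hB 0 (Nat.zero_le _) x) 0
  · refine (norm_cubeCoeff_le_of_iteratedFDeriv hα N φ B (hB N le_rfl)).trans ?_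
    have h1 : 1 ≤ ‖α‖ := by
      obtain ⟨j, hj0, hj⟩ := exists_norm_apply_eq hα
      rw [hj]; exact_mod_cast Int.one_le_abs hj0
    rw [one_div]
    gcongr
    linarith

/-- Derivatives of periodic functions are periodic, hence bounded by their maximum on the cube. -/
theorem exists_iteratedFDeriv_bound {n : ℕ} (φ : TestFunction n) (N : ℕ) :
    ∃ B, ∀ k ≤ N, ∀ x, ‖iteratedFDeriv ℝ k (φ : (Fin n → ℝ) → ℂ) x‖ ≤ B := by
  have h : ∀ k, ∃ B, ∀ x, ‖iteratedFDeriv ℝ k (φ : (Fin n → ℝ) → ℂ) x‖ ≤ B := by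
    intro k
    have hc : Continuous (iteratedFDeriv ℝ k (φ : (Fin n → ℝ) → ℂ)) :=
      φ.2.1.continuous_iteratedFDeriv (by exact_mod_cast le_top)
    obtain ⟨B, hB⟩ := (isCompact_Icc (a := (0 : Fin n → ℝ)) (b := 1)).exists_bound_of_continuousOn
      hc.continuousOn
    refine ⟨B, fun x => ?_⟩
    have hp : (fun y => (φ : (Fin n → ℝ) → ℂ) ((fun j => ((-⌊x j⌋ : ℤ) : ℝ)) + y)) = φ := by
      funext y
      rw [← φ.2.2 y fun j => -⌊x j⌋]
      exact congrArg _ (funext fun j => add_comm _ _)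
    have h1 := iteratedFDeriv_comp_add_left (𝕜 := ℝ) (f := (φ : (Fin n → ℝ) → ℂ)) k
      (fun j => ((-⌊x j⌋ : ℤ) : ℝ)) x
    rw [hp] at h1
    rw [h1]
    refine hB _ ⟨fun j => ?_, fun j => ?_⟩
    · have := Int.floor_le (x j); simp; linarith
    · have := Int.lt_floor_add_one (x j); simp; linarith
  choose B hB using h
  refine ⟨∑ k ∈ Finset.range (N + 1), |B k|, fun k hk x => (hB k x).trans ?_⟩
  exact (le_abs_self _).trans (Finset.single_le_sum (f := fun k => |B k|) (fun _ _ => abs_nonneg _)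
    (Finset.mem_range.2 (Nat.lt_succ_of_le hk)))

/-- Summability over `ℤⁿ`, from the corresponding fact for lattices in `ℝⁿ`. -/
theorem summable_one_add_norm_inv_pow {n N : ℕ} (hN : n < N) :
    Summable fun α : Fin n → ℤ => ((1 + ‖α‖)⁻¹) ^ N := by
  classical
  let L : Submodule ℤ (Fin n → ℝ) := Submodule.span ℤ (range (Pi.basisFun ℝ (Fin n)))
  have hr : Module.finrank ℤ L < N := by
    rw [ZLattice.rank ℝ L]; simpa using hN
  have hs := ZLattice.summable_norm_pow_inv L N hr
  have hm : ∀ α : Fin n → ℤ, (fun j => (α j : ℝ)) ∈ L := by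
    intro α
    have : (fun j => (α j : ℝ)) = ∑ j, α j • Pi.basisFun ℝ (Fin n) j := by
      funext i
      simp [Finset.sum_apply, Pi.single_apply]
    rw [this]
    exact Submodule.sum_mem _ fun j _ => Submodule.smul_mem _ _ (Submodule.subset_span ⟨j, rfl⟩)
  let i : (Fin n → ℤ) → L := fun α => ⟨_, hm α⟩
  have hi : Function.Injective i := fun α β h => by
    funext j
    have : (α j : ℝ) = β j := congrFun (congrArg Subtype.val h) j
    exact_mod_cast this
  have hni : ∀ α, ‖i α‖ = ‖α‖ := fun α => by
    change ‖(fun j => (α j : ℝ))‖ = ‖α‖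
    simp only [Pi.norm_def, Int.norm_eq_abs, Real.norm_eq_abs, nnnorm]
  have hs2 := (hs.comp_injective hi).add (hasSum_ite_eq (0 : Fin n → ℤ) (1 : ℝ)).summable
  refine Summable.of_nonneg_of_le (fun α => by positivity) (fun α => ?_) hs2
  simp only [Function.comp_apply, hni]
  rcases eq_or_ne α 0 with rfl | hα
  · simp
  · have : 0 < ‖α‖ := norm_pos_iff.2 hα
    simp only [hα, if_false, add_zero]
    gcongr
    linarith

/-! ### Periodic distributions and their convolution -/

/-- The linear functional `x ↦ 2πi α·x`, the logarithm of the character. -/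
def phase {n : ℕ} (α : Fin n → ℤ) : (Fin n → ℝ) →L[ℝ] ℂ :=
  ∑ j, ((2 * Real.pi * Complex.I) * (α j : ℂ)) • (Complex.ofRealCLM.comp (ContinuousLinearMap.proj j))

/-- A weight of the size of the frequency, whose powers dominate the derivatives of the
characters. -/
def freq {n : ℕ} (α : Fin n → ℤ) : ℝ := (1 + 2 * Real.pi * n) * (1 + ‖α‖)

theorem one_le_freq {n : ℕ} (α : Fin n → ℤ) : 1 ≤ freq α := by
  unfold freq
  have h1 : 0 ≤ 2 * Real.pi * n := by positivity
  nlinarith [norm_nonneg α]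

theorem norm_phase_le {n : ℕ} (α : Fin n → ℤ) : ‖phase α‖ ≤ freq α := by
  have h : ‖phase α‖ ≤ ∑ _j : Fin n, 2 * Real.pi * ‖α‖ := by
    refine (norm_sum_le _ _).trans (Finset.sum_le_sum fun j _ => ?_)
    refine ContinuousLinearMap.opNorm_le_bound _ (by positivity) fun x => ?_
    have h1 : ‖(α j : ℂ)‖ ≤ ‖α‖ := by
      rw [Complex.norm_intCast, ← Int.norm_eq_abs]; exact norm_le_pi_norm α j
    have h2 := norm_le_pi_norm x j
    simp only [_root_.smul_apply, ContinuousLinearMap.comp_apply,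
      ContinuousLinearMap.proj_apply, Complex.ofRealCLM_apply, smul_eq_mul, norm_mul,
      Complex.norm_I, Complex.norm_real, mul_one, Complex.norm_ofNat, Real.norm_eq_abs,
      abs_of_pos Real.pi_pos] at h2 ⊢
    gcongr
  refine h.trans ?_
  simp only [Finset.sum_const, Finset.card_univ, Fintype.card_fin, nsmul_eq_mul, freq]
  have h1 : 0 ≤ 2 * Real.pi * n := by positivity
  nlinarith [norm_nonneg α]

theorem char_eq_exp_phase {n : ℕ} (α : Fin n → ℤ) :
    (char α : (Fin n → ℝ) → ℂ) = fun x => Complex.exp (phase α x) := by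
  funext x
  change Complex.exp _ = _
  congr 1
  simp only [phase, _root_.sum_apply, _root_.smul_apply,
    ContinuousLinearMap.comp_apply, ContinuousLinearMap.proj_apply, Complex.ofRealCLM_apply,
    smul_eq_mul]
  push_cast
  rw [Finset.mul_sum]
  exact Finset.sum_congr rfl fun j _ => by ring

theorem norm_iteratedFDeriv_char_le {n : ℕ} (α : Fin n → ℤ) (k : ℕ) (x : Fin n → ℝ) :
    ‖iteratedFDeriv ℝ k (char α : (Fin n → ℝ) → ℂ) x‖ ≤ freq α ^ k := by
  induction k generalizing x with
  | zero => simp [norm_char]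
  | succ k ih =>
    let T : ℂ →L[ℝ] ((Fin n → ℝ) →L[ℝ] ℂ) :=
      (ContinuousLinearMap.toSpanSingleton ℂ (phase α)).restrictScalars ℝ
    have hT : ‖T‖ ≤ freq α := by
      simpa [T, ContinuousLinearMap.norm_restrictScalars,
        ContinuousLinearMap.norm_toSpanSingleton] using norm_phase_le α
    have hd : fderiv ℝ (char α : (Fin n → ℝ) → ℂ)
        = T ∘ (char α : (Fin n → ℝ) → ℂ) := by
      funext y
      refine HasFDerivAt.fderiv ?_
      rw [char_eq_exp_phase]
      exact (phase α).hasFDerivAt.cexp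
    rw [← norm_iteratedFDeriv_fderiv, hd]
    refine (T.norm_iteratedFDeriv_comp_left (n := k) (char α).2.1.contDiffAt
      (by exact_mod_cast le_top)).trans ?_
    rw [pow_succ']
    exact mul_le_mul hT (ih x) (norm_nonneg _) (zero_le_one.trans (one_le_freq α))

/-- Coefficients decaying faster than every power of the frequency. -/
def RapidDecay {n : ℕ} (a : (Fin n → ℤ) → ℂ) : Prop :=
  ∀ k : ℕ, Summable fun α => ‖a α‖ * freq α ^ k

theorem RapidDecay.summable {n : ℕ} {a : (Fin n → ℤ) → ℂ} (ha : RapidDecay a) : Summable a :=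
  Summable.of_norm (by simpa using ha 0)

/-- Coefficients of at most polynomial growth. -/
def PolynomialGrowth {n : ℕ} (a : (Fin n → ℤ) → ℂ) : Prop :=
  ∃ (C : ℝ) (m : ℕ), ∀ α, ‖a α‖ ≤ C * freq α ^ m

theorem norm_iteratedFDeriv_mul_char_le {n : ℕ} (c : ℂ) (α : Fin n → ℤ) (k : ℕ)
    (x : Fin n → ℝ) :
    ‖iteratedFDeriv ℝ k (fun y => c * (char α : (Fin n → ℝ) → ℂ) y) x‖ ≤ ‖c‖ * freq α ^ k := by
  have e : (fun y => c * (char α : (Fin n → ℝ) → ℂ) y) = c • (char α : (Fin n → ℝ) → ℂ) := rfl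
  have hs : ContDiff ℝ k (char α : (Fin n → ℝ) → ℂ) := (char α).2.1.of_le (by exact_mod_cast le_top)
  rw [e, iteratedFDeriv_const_smul_apply hs.contDiffAt, norm_smul]
  exact mul_le_mul_of_nonneg_left (norm_iteratedFDeriv_char_le α k x) (norm_nonneg _)

/-- The smooth function `∑ a_α e^{2πi α·x}` with rapidly decaying coefficients. -/
def synth {n : ℕ} {a : (Fin n → ℤ) → ℂ} (ha : RapidDecay a) : TestFunction n :=
  ⟨fun x => ∑' α, a α * (char α : (Fin n → ℝ) → ℂ) x,
    contDiff_tsum (N := (⊤ : ℕ∞)) (v := fun k α => ‖a α‖ * freq α ^ k)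
      (fun α => contDiff_const.mul (char α).2.1) (fun k _ => ha k)
      (fun k α x _ => norm_iteratedFDeriv_mul_char_le _ _ _ _),
    fun x k => by simp only [isPeriodic_char _ x k]⟩

theorem hasSum_synth {n : ℕ} {a : (Fin n → ℤ) → ℂ} (ha : RapidDecay a) (x : Fin n → ℝ) :
    HasSum (fun α => a α * (char α : (Fin n → ℝ) → ℂ) x) ((synth ha : (Fin n → ℝ) → ℂ) x) :=
  (Summable.of_norm (by simpa [norm_char] using ha.summable.norm)).hasSum

theorem norm_iteratedFDeriv_synth_le {n : ℕ} {a : (Fin n → ℤ) → ℂ} (ha : RapidDecay a) (k : ℕ)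
    (x : Fin n → ℝ) :
    ‖iteratedFDeriv ℝ k (synth ha : (Fin n → ℝ) → ℂ) x‖ ≤ ∑' α, ‖a α‖ * freq α ^ k := by
  have h := iteratedFDeriv_tsum_apply (𝕜 := ℝ) (N := (⊤ : ℕ∞))
    (f := fun α x => a α * (char α : (Fin n → ℝ) → ℂ) x) (v := fun k α => ‖a α‖ * freq α ^ k)
    (fun α => contDiff_const.mul (char α).2.1) (fun k _ => ha k)
    (fun k α x _ => norm_iteratedFDeriv_mul_char_le _ _ _ _) (k := k) le_top x
  change ‖iteratedFDeriv ℝ k (fun x => ∑' α, a α * (char α : (Fin n → ℝ) → ℂ) x) x‖ ≤ _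
  rw [h]
  exact tsum_of_norm_bounded (ha k).hasSum fun α => norm_iteratedFDeriv_mul_char_le _ _ _ _

theorem RapidDecay.mono_norm {n : ℕ} {a b : (Fin n → ℤ) → ℂ} (ha : RapidDecay a)
    (h : ∀ α, ‖b α‖ ≤ ‖a α‖) : RapidDecay b := fun k =>
  Summable.of_nonneg_of_le
    (fun α => mul_nonneg (norm_nonneg _) (pow_nonneg (zero_le_one.trans (one_le_freq α)) _))
    (fun α => mul_le_mul_of_nonneg_right (h α) (pow_nonneg (zero_le_one.trans (one_le_freq α)) _))
    (ha k)

/-- A periodic distribution may be applied term by term to a rapidly convergent trigonometric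
series. -/
theorem hasSum_distribution_synth {n : ℕ} (v : PeriodicDistribution n) {a : (Fin n → ℤ) → ℂ}
    (ha : RapidDecay a) : HasSum (fun α => a α * v.1 (char α)) (v.1 (synth ha)) := by
  classical
  obtain ⟨C, m, hv⟩ := v.2
  -- the remainder after removing the frequencies in `s` is again a rapidly convergent series
  let b : Finset (Fin n → ℤ) → (Fin n → ℤ) → ℂ := fun s α => if α ∈ s then 0 else a α
  have hb : ∀ s, RapidDecay (b s) := fun s => ha.mono_norm fun α => by
    simp only [b]; split_ifs <;> simp
  have hdec : ∀ s, synth ha = synth (hb s) + ∑ α ∈ s, a α • char α := by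
    intro s
    apply Subtype.ext
    funext x
    have h1 := hasSum_synth ha x
    have h2 := (hasSum_synth (hb s) x).add (hasSum_sum_of_ne_finset_zero
      (f := fun α => if α ∈ s then a α * (char α : (Fin n → ℝ) → ℂ) x else 0) (s := s)
      (fun α hα => by simp [hα]))
    have h3 : (fun α => b s α * (char α : (Fin n → ℝ) → ℂ) x
        + if α ∈ s then a α * (char α : (Fin n → ℝ) → ℂ) x else 0)
        = fun α => a α * (char α : (Fin n → ℝ) → ℂ) x := by
      funext α; simp only [b]; split_ifs <;> simp
    rw [h3] at h2
    rw [h1.unique h2]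
    have h4 : ((synth (hb s) + ∑ α ∈ s, a α • char α : TestFunction n) : (Fin n → ℝ) → ℂ) x
        = (synth (hb s) : (Fin n → ℝ) → ℂ) x
          + ∑ α ∈ s, a α * (char α : (Fin n → ℝ) → ℂ) x := by
      rw [Submodule.coe_add, Submodule.coe_sum]
      simp [Finset.sum_apply]
    rw [h4]
    congr 1
    exact Finset.sum_congr rfl fun α hα => by simp [hα]
  have hbound : ∀ s, ‖v.1 (synth (hb s))‖ ≤ C * ∑' α : { α // α ∉ s }, ‖a α‖ * freq α.1 ^ m := by
    intro s
    refine hv _ _ fun k hk x => (norm_iteratedFDeriv_synth_le (hb s) k x).trans ?_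
    have h5 : (fun α => ‖b s α‖ * freq α ^ m)
        = Set.indicator {α | α ∉ s} fun α => ‖a α‖ * freq α ^ m := by
      funext α
      simp only [b, Set.indicator, Set.mem_ofPred_eq]
      split_ifs <;> simp_all
    calc ∑' α, ‖b s α‖ * freq α ^ k ≤ ∑' α, ‖b s α‖ * freq α ^ m :=
          (hb s k).tsum_le_tsum (fun α => mul_le_mul_of_nonneg_left
            (pow_le_pow_right₀ (one_le_freq α) hk) (norm_nonneg _)) (hb s m)
      _ = _ := by rw [h5]; exact (tsum_subtype {α | α ∉ s} _).symm
  have hlim : Filter.Tendsto (fun s => v.1 (synth (hb s))) Filter.atTop (nhds 0) := by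
    refine squeeze_zero_norm hbound ?_
    have := (tendsto_tsum_compl_atTop_zero fun α => ‖a α‖ * freq α ^ m).const_mul C
    simpa using this
  have h6 : (fun s => ∑ α ∈ s, a α * v.1 (char α))
      = fun s => v.1 (synth ha) - v.1 (synth (hb s)) := by
    funext s
    conv_rhs => rw [hdec s]
    simp
  rw [HasSum, SummationFilter.unconditional_filter, h6]
  simpa using hlim.const_sub (v.1 (synth ha))

theorem rapidDecay_cubeCoeff {n : ℕ} (φ : TestFunction n) :
    RapidDecay (cubeCoeff (φ : (Fin n → ℝ) → ℂ)) := by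
  intro k
  obtain ⟨B, hB⟩ := exists_iteratedFDeriv_bound φ (k + (n + 1))
  have hs := (summable_one_add_norm_inv_pow (n := n) (Nat.lt_succ_self n)).mul_left
    (B * (1 + 2 * Real.pi * n) ^ k)
  refine Summable.of_nonneg_of_le
    (fun α => mul_nonneg (norm_nonneg _) (pow_nonneg (zero_le_one.trans (one_le_freq α)) _))
    (fun α => ?_) hs
  have h := mul_le_mul_of_nonneg_right (norm_cubeCoeff_le_pow φ hB α)
    (pow_nonneg (zero_le_one.trans (one_le_freq α)) k)
  refine h.trans (le_of_eq ?_)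
  have : (1 + ‖α‖) ≠ 0 := by positivity
  rw [freq, mul_pow, pow_add, inv_pow, inv_pow]
  field_simp

theorem PolynomialGrowth.rapidDecay_mul {n : ℕ} {a b : (Fin n → ℤ) → ℂ} (hb : PolynomialGrowth b)
    (ha : RapidDecay a) : RapidDecay fun α => a α * b α := by
  obtain ⟨C, m, hb⟩ := hb
  intro k
  refine Summable.of_nonneg_of_le
    (fun α => mul_nonneg (norm_nonneg _) (pow_nonneg (zero_le_one.trans (one_le_freq α)) _))
    (fun α => ?_) ((ha (k + m)).mul_left C)
  have h0 : 0 ≤ freq α := zero_le_one.trans (one_le_freq α)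
  calc ‖a α * b α‖ * freq α ^ k = ‖a α‖ * ‖b α‖ * freq α ^ k := by rw [norm_mul]
    _ ≤ ‖a α‖ * (C * freq α ^ m) * freq α ^ k := by gcongr; exact hb α
    _ = C * (‖a α‖ * freq α ^ (k + m)) := by ring

theorem synth_cubeCoeff {n : ℕ} (φ : TestFunction n) : synth (rapidDecay_cubeCoeff φ) = φ := by
  apply Subtype.ext
  funext x
  exact (hasSum_synth _ x).unique
    (hasSum_cubeCoeff φ.2.2 φ.2.1.continuous (rapidDecay_cubeCoeff φ).summable x)

/-- A periodic distribution is determined by its values at the characters, by Fourier inversion for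
test functions. -/
theorem hasSum_distribution {n : ℕ} (v : PeriodicDistribution n) (φ : TestFunction n) :
    HasSum (fun α => cubeCoeff (φ : (Fin n → ℝ) → ℂ) α * v.1 (char α)) (v.1 φ) := by
  have := hasSum_distribution_synth v (rapidDecay_cubeCoeff φ)
  rwa [synth_cubeCoeff] at this

theorem polynomialGrowth_distribution {n : ℕ} (v : PeriodicDistribution n) :
    PolynomialGrowth fun α => v.1 (char α) := by
  obtain ⟨C, m, hv⟩ := v.2
  exact ⟨C, m, fun α => hv _ _ fun k hk x => (norm_iteratedFDeriv_char_le α k x).trans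
    (pow_le_pow_right₀ (one_le_freq α) hk)⟩

theorem PolynomialGrowth.mul {n : ℕ} {a b : (Fin n → ℤ) → ℂ} (ha : PolynomialGrowth a)
    (hb : PolynomialGrowth b) : PolynomialGrowth fun α => a α * b α := by
  obtain ⟨C, m, ha⟩ := ha
  obtain ⟨D, l, hb⟩ := hb
  refine ⟨C * D, m + l, fun α => ?_⟩
  rw [norm_mul, pow_add, mul_mul_mul_comm]
  exact mul_le_mul (ha α) (hb α) (norm_nonneg _) ((norm_nonneg _).trans (ha α))

/-- Every sequence of polynomial growth is the sequence of values at the characters of a periodic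
distribution. -/
theorem exists_distribution {n : ℕ} {a : (Fin n → ℤ) → ℂ} (ha : PolynomialGrowth a) :
    ∃ w : PeriodicDistribution n, ∀ φ : TestFunction n,
      HasSum (fun α => cubeCoeff (φ : (Fin n → ℝ) → ℂ) α * a α) (w.1 φ) := by
  have hs : ∀ φ : TestFunction n, HasSum (fun α => cubeCoeff (φ : (Fin n → ℝ) → ℂ) α * a α)
      (∑' α, cubeCoeff (φ : (Fin n → ℝ) → ℂ) α * a α) := fun φ =>
    (ha.rapidDecay_mul (rapidDecay_cubeCoeff φ)).summable.hasSum
  let w : Module.Dual ℂ (TestFunction n) :=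
    { toFun := fun φ => ∑' α, cubeCoeff (φ : (Fin n → ℝ) → ℂ) α * a α
      map_add' := fun φ ψ => by
        refine (hs (φ + ψ)).unique ?_
        convert! (hs φ).add (hs ψ) using 2 with α
        have : cubeCoeff ((φ + ψ : TestFunction n) : (Fin n → ℝ) → ℂ) α
            = cubeCoeff (φ : (Fin n → ℝ) → ℂ) α + cubeCoeff (ψ : (Fin n → ℝ) → ℂ) α := by
          simp only [cubeCoeff, Submodule.coe_add, Pi.add_apply, mul_add]
          exact integral_add ((continuous_char _).mul φ.2.1.continuous).integrableOn_Icc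
            ((continuous_char _).mul ψ.2.1.continuous).integrableOn_Icc
        rw [this, add_mul]
      map_smul' := fun c φ => by
        refine (hs (c • φ)).unique ?_
        convert! (hs φ).mul_left c using 2 with α
        have : cubeCoeff ((c • φ : TestFunction n) : (Fin n → ℝ) → ℂ) α
            = c * cubeCoeff (φ : (Fin n → ℝ) → ℂ) α := by
          simp only [cubeCoeff, Submodule.coe_smul, Pi.smul_apply, smul_eq_mul,
            mul_left_comm _ c, integral_const_mul]
        rw [this, mul_assoc] }
  refine ⟨⟨w, ?_⟩, hs⟩
  obtain ⟨C, m, hC⟩ := ha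
  have hS := summable_one_add_norm_inv_pow (n := n) (Nat.lt_succ_self n)
  refine ⟨(|C| * (1 + 2 * Real.pi * n) ^ m) * ∑' α : Fin n → ℤ, ((1 + ‖α‖)⁻¹) ^ (n + 1),
    m + (n + 1), fun φ B hB => ?_⟩
  have hB0 : 0 ≤ B := (norm_nonneg _).trans (hB 0 (Nat.zero_le _) 0)
  rw [mul_right_comm]
  refine tsum_of_norm_bounded (hS.hasSum.mul_left (|C| * (1 + 2 * Real.pi * n) ^ m * B))
    fun α => ?_
  have h1 : (1 + ‖α‖) ≠ 0 := by positivity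
  have h2 : 0 ≤ freq α := zero_le_one.trans (one_le_freq α)
  calc ‖cubeCoeff (φ : (Fin n → ℝ) → ℂ) α * a α‖
      ≤ (B * ((1 + ‖α‖)⁻¹) ^ (m + (n + 1))) * (|C| * freq α ^ m) := by
        rw [norm_mul]
        refine mul_le_mul (norm_cubeCoeff_le_pow φ hB α) ((hC α).trans ?_) (norm_nonneg _)
          (by positivity)
        gcongr
        exact le_abs_self C
    _ = |C| * (1 + 2 * Real.pi * n) ^ m * B * ((1 + ‖α‖)⁻¹) ^ (n + 1) := by
        rw [freq, mul_pow, pow_add, inv_pow, inv_pow]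
        field_simp

theorem exists_distribution_char {n : ℕ} {a : (Fin n → ℤ) → ℂ} (ha : PolynomialGrowth a) :
    ∃ w : PeriodicDistribution n, ∀ α, w.1 (char α) = a α := by
  obtain ⟨w, hw⟩ := exists_distribution ha
  refine ⟨w, fun β => (hw (char β)).unique ?_⟩
  convert! hasSum_ite_eq β (a β) using 2 with α
  rw [cubeCoeff_char]
  split_ifs with h <;> simp [h]

/-- Convolutions exist: their values at the characters are the products of those of the factors. -/
theorem exists_isConvolution {n : ℕ} (u v : PeriodicDistribution n) :
    ∃ w : PeriodicDistribution n, IsConvolution u v w := by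
  have hv := polynomialGrowth_distribution v
  obtain ⟨w, hw⟩ := exists_distribution (hv.mul (polynomialGrowth_distribution u))
  refine ⟨w, fun φ => ?_⟩
  have hr := hv.rapidDecay_mul (rapidDecay_cubeCoeff φ)
  refine ⟨synth hr, fun x => (hasSum_synth hr x).unique ?_, (hw φ).unique ?_⟩
  · convert! hasSum_distribution v (translate x φ) using 2 with α
    have : cubeCoeff (translate x φ : (Fin n → ℝ) → ℂ) α
        = (char α : (Fin n → ℝ) → ℂ) x * cubeCoeff (φ : (Fin n → ℝ) → ℂ) α :=
      cubeCoeff_comp_add φ.2.2 x α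
    rw [this]; ring
  · simpa only [mul_assoc] using hasSum_distribution_synth u hr

theorem IsConvolution.apply_char {n : ℕ} {u v w : PeriodicDistribution n}
    (h : IsConvolution u v w) (α : Fin n → ℤ) :
    w.1 (char α) = u.1 (char α) * v.1 (char α) := by
  obtain ⟨ψ, hψ, hw⟩ := h (char α)
  have : ψ = v.1 (char α) • char α := by
    apply Subtype.ext
    funext x
    have ht : translate x (char α) = (char α : (Fin n → ℝ) → ℂ) x • char α := by
      apply Subtype.ext
      funext y
      exact char_apply_add α x y
    rw [hψ, ht, map_smul]
    simp [mul_comm]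
  rw [hw, this, map_smul, smul_eq_mul, mul_comm]

/-! ### Holomorphic functions of several variables -/

section Holomorphic

open Metric Filter Topology

variable {E : Type*} [NormedAddCommGroup E] [NormedSpace ℂ E]

/-- A Cauchy estimate. -/
theorem norm_fderiv_le_of_bounded {f : E → ℂ} {z : E} {r M : ℝ} (hr : 0 < r)
    (hd : DifferentiableOn ℂ f (ball z r)) (hM : ∀ w ∈ ball z r, ‖f w‖ ≤ M) :
    ‖fderiv ℂ f z‖ ≤ 2 * M / r := by
  refine Complex.norm_fderiv_le_div_of_mapsTo_ball hd (fun w hw => ?_) hr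
  rw [mem_closedBall, dist_eq_norm]
  calc ‖f w - f z‖ ≤ ‖f w‖ + ‖f z‖ := norm_sub_le _ _
    _ ≤ 2 * M := by linarith [hM w hw, hM z (mem_ball_self hr)]

/-- The derivative of a holomorphic function is bounded near every point. -/
theorem exists_norm_fderiv_le {f : E → ℂ} {U : Set E} (hU : IsOpen U)
    (hf : DifferentiableOn ℂ f U) {z : E} (hz : z ∈ U) :
    ∃ r > 0, ∃ M, ball z r ⊆ U ∧ ∀ w ∈ ball z r, ‖fderiv ℂ f w‖ ≤ M := by
  have hc : ContinuousAt f z := (hf.differentiableAt (hU.mem_nhds hz)).continuousAt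
  have h1 : ∀ᶠ w in 𝓝 z, ‖f w‖ ≤ ‖f z‖ + 1 :=
    (hc.norm.eventually (Iio_mem_nhds (lt_add_one _))).mono fun w hw => le_of_lt hw
  obtain ⟨r, hr, hb⟩ := Metric.mem_nhds_iff.1 (h1.and (hU.mem_nhds hz))
  refine ⟨r / 2, by positivity, 2 * (‖f z‖ + 1) / (r / 2),
    (ball_subset_ball (by linarith)).trans fun w hw => (hb hw).2, fun w hw => ?_⟩
  have hsub : ball w (r / 2) ⊆ ball z r := ball_subset_ball' (by
    have := mem_ball.1 hw; linarith)
  exact norm_fderiv_le_of_bounded (by positivity) (hf.mono fun v hv => (hb (hsub hv)).2)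
    fun v hv => (hb (hsub hv)).1

/-- The derivative of a holomorphic function is continuous: the Cauchy estimate for the difference of
`f` and its translate bounds the variation of the derivative. -/
theorem continuousOn_fderiv_of_differentiableOn {f : E → ℂ} {U : Set E} (hU : IsOpen U)
    (hf : DifferentiableOn ℂ f U) : ContinuousOn (fderiv ℂ f) U := by
  intro z hz
  refine ContinuousAt.continuousWithinAt ?_
  obtain ⟨r, hr, M, hrU, hM⟩ := exists_norm_fderiv_le hU hf hz
  have hM0 : 0 ≤ M := (norm_nonneg _).trans (hM z (mem_ball_self hr))
  have hlip : ∀ v ∈ ball z r, ∀ w ∈ ball z r, ‖f w - f v‖ ≤ M * ‖w - v‖ := fun v hv w hw =>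
    Convex.norm_image_sub_le_of_norm_fderiv_le
      (fun x hx => hf.differentiableAt (hU.mem_nhds (hrU hx))) hM (convex_ball z r) hv hw
  have key : ∀ w ∈ ball z (r / 2), ‖fderiv ℂ f w - fderiv ℂ f z‖
      ≤ 2 * (M * ‖w - z‖) / (r / 2) := by
    intro w hw
    -- apply the Cauchy estimate to the difference of `f` and its translate
    have hmem : ∀ x ∈ ball z (r / 2), x ∈ ball z r ∧ x + (w - z) ∈ ball z r := by
      intro x hx
      rw [mem_ball, dist_eq_norm] at hx hw
      refine ⟨?_, ?_⟩
      · rw [mem_ball, dist_eq_norm]; linarith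
      · rw [mem_ball, dist_eq_norm]
        calc ‖x + (w - z) - z‖ = ‖(x - z) + (w - z)‖ := by congr 1; abel
          _ ≤ ‖x - z‖ + ‖w - z‖ := norm_add_le _ _
          _ < r := by linarith
    have hda : ∀ x ∈ ball z r, DifferentiableAt ℂ f x := fun x hx =>
      hf.differentiableAt (hU.mem_nhds (hrU hx))
    have htr : ∀ x ∈ ball z (r / 2), HasFDerivAt (fun y => f (y + (w - z)) - f y)
        (fderiv ℂ f (x + (w - z)) - fderiv ℂ f x) x := by
      intro x hx
      have h1 : HasFDerivAt (fun y => f (y + (w - z))) (fderiv ℂ f (x + (w - z))) x :=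
        (hasFDerivAt_comp_add_right _).2 (hda _ (hmem x hx).2).hasFDerivAt
      exact h1.sub (hda _ (hmem x hx).1).hasFDerivAt
    have hz2 : z ∈ ball z (r / 2) := mem_ball_self (by positivity)
    have := norm_fderiv_le_of_bounded (f := fun y => f (y + (w - z)) - f y) (z := z) (r := r / 2)
      (M := M * ‖w - z‖) (by positivity)
      (fun x hx => (htr x hx).differentiableAt.differentiableWithinAt)
      (fun x hx => by simpa using hlip _ (hmem x hx).1 _ (hmem x hx).2)
    rwa [(htr z hz2).fderiv, add_sub_cancel] at this
  rw [ContinuousAt, tendsto_iff_norm_sub_tendsto_zero]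
  refine squeeze_zero' (Eventually.of_forall fun _ => norm_nonneg _)
    (Filter.eventually_of_mem (ball_mem_nhds z (by positivity)) key) ?_
  have : Tendsto (fun w => 2 * (M * ‖w - z‖) / (r / 2)) (𝓝 z)
      (𝓝 (2 * (M * ‖z - z‖) / (r / 2))) := by
    apply Continuous.tendsto; fun_prop
  simpa using this

/-- A locally dominated series of holomorphic functions is holomorphic. -/
theorem differentiableOn_tsum_of_locally_dominated {ι : Type*} {f : ι → E → ℂ} {U : Set E}
    (hf : ∀ i, DifferentiableOn ℂ (f i) U)
    (hdom : ∀ z ∈ U, ∃ r > 0, ball z r ⊆ U ∧ ∃ u : ι → ℝ, Summable u ∧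
      ∀ i, ∀ w ∈ ball z r, ‖f i w‖ ≤ u i) :
    DifferentiableOn ℂ (fun z => ∑' i, f i z) U := by
  intro z hz
  obtain ⟨r, hr, hrU, u, hu, hb⟩ := hdom z hz
  have hsub : ∀ w ∈ ball z (r / 2), ball w (r / 2) ⊆ ball z r := fun w hw =>
    ball_subset_ball' (by have := mem_ball.1 hw; linarith)
  have hz2 : z ∈ ball z (r / 2) := mem_ball_self (by positivity)
  refine (hasFDerivAt_tsum_of_isPreconnected (𝕜 := ℂ) (f' := fun i w => fderiv ℂ (f i) w)
    (u := fun i => 2 * u i / (r / 2)) ?_ isOpen_ball ((convex_ball z (r / 2)).isPreconnected)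
    (fun i w hw => ?_) (fun i w hw => ?_) hz2 ?_ hz2).differentiableAt.differentiableWithinAt
  · exact (hu.mul_left 2).div_const _
  · exact (((hf i).mono hrU).differentiableAt (isOpen_ball.mem_nhds
      (hsub w hw (mem_ball_self (by positivity))))).hasFDerivAt
  · exact norm_fderiv_le_of_bounded (by positivity)
      ((hf i).mono ((hsub w hw).trans hrU)) fun v hv => hb i v (hsub w hw hv)
  · exact Summable.of_norm_bounded hu fun i => hb i z (mem_ball_self hr)

/-- The identity theorem for holomorphic functions on a connected open subset of a complex normed
space. -/
theorem eqOn_zero_of_eventuallyEq_zero {f : E → ℂ} {U : Set E} (hU : IsOpen U)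
    (hconn : IsPreconnected U) (hf : DifferentiableOn ℂ f U) {z₀ : E} (hz₀ : z₀ ∈ U)
    (h : ∀ᶠ z in 𝓝 z₀, f z = 0) : ∀ z ∈ U, f z = 0 := by
  have hsub : U ⊆ {z | ∀ᶠ w in 𝓝 z, f w = 0} := by
    refine hconn.subset_of_closure_inter_subset isOpen_setOfPred_eventually_nhds ⟨z₀, hz₀, h⟩ ?_
    rintro z ⟨hzc, hzU⟩
    obtain ⟨r, hr, hrU⟩ := Metric.isOpen_iff.1 hU z hzU
    obtain ⟨w, hw, hwz⟩ := Metric.mem_closure_iff.1 hzc r hr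
    have hwr : w ∈ ball z r := by rwa [mem_ball, dist_comm]
    refine Filter.eventually_of_mem (ball_mem_nhds z hr) fun v hv => ?_
    -- restrict `f` to the complex line through `w` and `v`
    let p : ℂ → E := fun t => w + t • (v - w)
    have hp : Differentiable ℂ p := by fun_prop
    let T : Set ℂ := p ⁻¹' ball z r
    have hT : IsOpen T := isOpen_ball.preimage hp.continuous
    have hTc : IsPreconnected T := by
      refine Convex.isPreconnected (s := T) ?_
      intro a ha b hb s t hs ht hst
      have : p (s • a + t • b) = s • p a + t • p b := by
        have hw' : s • w + t • w = w := by rw [← add_smul, hst, one_smul]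
        calc p (s • a + t • b) = (s • w + t • w) + (s • a • (v - w) + t • b • (v - w)) := by
              rw [hw']; simp only [p, add_smul, smul_assoc]
          _ = s • p a + t • p b := by simp only [p, smul_add]; abel
      change p (s • a + t • b) ∈ ball z r
      rw [this]
      exact convex_ball z r ha hb hs ht hst
    have hg : DifferentiableOn ℂ (f ∘ p) T :=
      (hf.mono hrU).comp hp.differentiableOn fun t ht => ht
    have h0T : (0 : ℂ) ∈ T := by simpa [T, p] using hwr
    have h1T : (1 : ℂ) ∈ T := by simpa [T, p] using hv
    have hev : f ∘ p =ᶠ[𝓝 0] 0 := by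
      have : Tendsto p (𝓝 0) (𝓝 w) := by
        have := hp.continuous.tendsto 0; simpa [p] using this
      exact this.eventually hw
    have := (hg.analyticOnNhd hT).eqOn_zero_of_preconnected_of_eventuallyEq_zero hTc h0T hev h1T
    simpa [p] using this
  exact fun z hz => (hsub hz).self_of_nhds

end Holomorphic

/-! ### Laurent series on Reinhardt domains -/

theorem differentiableOn_mono {n : ℕ} {U : Set (Fin n → ℂ)} {α : Fin n → ℤ}
    (h : ∀ z ∈ U, ∀ j, z j = 0 → 0 ≤ α j) : DifferentiableOn ℂ (mono α) U := by
  intro z hz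
  refine DifferentiableAt.differentiableWithinAt ?_
  have h1 : ∀ j, DifferentiableAt ℂ (fun z : Fin n → ℂ => z j ^ α j) z := fun j => by
    have hj : z j ≠ 0 ∨ 0 ≤ α j := or_iff_not_imp_left.2 fun hj => h z hz j (not_not.1 hj)
    exact (differentiableAt_zpow.2 hj).comp z (differentiableAt_apply (𝕜 := ℂ) j z)
  exact (HasFDerivAt.finsetProd (u := Finset.univ) fun j _ => (h1 j).hasFDerivAt).differentiableAt

/-- A point of an open set can be moved inside the set so that the coordinates outside `J` do not
vanish and those in `J` stay the same. -/
theorem exists_mem_ne_zero {n : ℕ} {U : Set (Fin n → ℂ)} (hU : IsOpen U) {z₀ : Fin n → ℂ}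
    (hz₀ : z₀ ∈ U) (J : Set (Fin n)) :
    ∃ z ∈ U, (∀ j ∈ J, z j = z₀ j) ∧ ∀ j ∉ J, z j ≠ 0 := by
  classical
  obtain ⟨r, hr, hrU⟩ := Metric.isOpen_iff.1 hU z₀ hz₀
  refine ⟨fun j => if j ∈ J ∨ z₀ j ≠ 0 then z₀ j else (r / 2 : ℝ), hrU ?_, fun j hj => by simp [hj],
    fun j hj => ?_⟩
  · rw [mem_ball_iff_norm, pi_norm_lt_iff hr]
    intro j
    by_cases h : j ∈ J ∨ z₀ j ≠ 0
    · simp [h, hr]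
    · have h0 : z₀ j = 0 := by tauto
      rw [Pi.sub_apply, if_neg h, h0, sub_zero, Complex.norm_real, Real.norm_eq_abs,
        abs_of_pos (by positivity)]
      linarith
  · by_cases h : z₀ j ≠ 0
    · simp [h]
    · have : ¬ (j ∈ J ∨ z₀ j ≠ 0) := by tauto
      simp only [this, if_false]
      exact_mod_cast (by positivity : r / 2 ≠ 0)

theorem IsReinhardt.torusPt_mul_mem {n : ℕ} {U : Set (Fin n → ℂ)} (hR : IsReinhardt U)
    {z : Fin n → ℂ} (hz : z ∈ U) (x : Fin n → ℝ) : torusPt x * z ∈ U :=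
  hR z hz _ (norm_torusPt x)

theorem torusPt_zero {n : ℕ} : torusPt (0 : Fin n → ℝ) = 1 := by
  funext j; simp [torusPt]

theorem HasLaurentSeries.hasSum_char {n : ℕ} {U : Set (Fin n → ℂ)} (hR : IsReinhardt U)
    {f : (Fin n → ℂ) → ℂ} {c : (Fin n → ℤ) → ℂ} (h : HasLaurentSeries U f c) {z : Fin n → ℂ}
    (hz : z ∈ U) (x : Fin n → ℝ) :
    HasSum (fun α => c α * mono α z * (char α : (Fin n → ℝ) → ℂ) x) (f (torusPt x * z)) := by
  convert! h _ (hR.torusPt_mul_mem hz x) using 2 with α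
  rw [mono_mul, char_eq_mono]; ring

/-- The terms of a Laurent series are the Fourier coefficients along the rotations. -/
theorem HasLaurentSeries.cubeCoeff_eq {n : ℕ} {U : Set (Fin n → ℂ)} (hR : IsReinhardt U)
    {f : (Fin n → ℂ) → ℂ} {c : (Fin n → ℤ) → ℂ} (h : HasLaurentSeries U f c) {z : Fin n → ℂ}
    (hz : z ∈ U) (α : Fin n → ℤ) :
    cubeCoeff (fun x => f (torusPt x * z)) α = c α * mono α z :=
  cubeCoeff_of_hasSum (h z hz).summable (h.hasSum_char hR hz) α

theorem mono_ne_zero {n : ℕ} {α : Fin n → ℤ} {z : Fin n → ℂ} (hz : ∀ j, z j ≠ 0) :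
    mono α z ≠ 0 :=
  Finset.prod_ne_zero_iff.2 fun j _ => zpow_ne_zero _ (hz j)

theorem HasLaurentSeries.unique {n : ℕ} {U : Set (Fin n → ℂ)} (hU : IsOpen U) (hne : U.Nonempty)
    (hR : IsReinhardt U) {f : (Fin n → ℂ) → ℂ} {c d : (Fin n → ℤ) → ℂ}
    (hc : HasLaurentSeries U f c) (hd : HasLaurentSeries U f d) : c = d := by
  obtain ⟨z₀, hz₀⟩ := hne
  obtain ⟨z, hz, -, hz0⟩ := exists_mem_ne_zero hU hz₀ ∅
  funext α
  exact mul_right_cancel₀ (mono_ne_zero fun j => hz0 j (notMem_empty j))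
    ((hc.cubeCoeff_eq hR hz α).symm.trans (hd.cubeCoeff_eq hR hz α))

theorem zpow_le_add_of_mem_Icc {s t x : ℝ} (hs : 0 < s) (hx : s ≤ x) (hxt : x ≤ t) (k : ℤ) :
    x ^ k ≤ t ^ k + s ^ k := by
  have hx0 : 0 < x := hs.trans_le hx
  have ht0 : 0 < t := hx0.trans_le hxt
  rcases le_total 0 k with hk | hk
  · have := zpow_le_zpow_left₀ hk hx0.le hxt
    have := zpow_pos hs k
    linarith
  · have : x ^ k ≤ s ^ k := by
      obtain ⟨m, rfl⟩ := Int.exists_eq_neg_ofNat hk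
      rw [zpow_neg, zpow_neg, zpow_natCast, zpow_natCast]
      gcongr
    have := zpow_pos ht0 k
    linarith

/-- Near a point of an open set, all the monomials which are regular there are dominated by their
values at the corners of a polyannulus. -/
theorem exists_corners {n : ℕ} {U : Set (Fin n → ℂ)} (hU : IsOpen U) {z₀ : Fin n → ℂ}
    (hz₀ : z₀ ∈ U) :
    ∃ r > 0, Metric.ball z₀ r ⊆ U ∧ ∃ ζ : (Fin n → Bool) → Fin n → ℂ, (∀ σ, ζ σ ∈ U) ∧
      ∀ α : Fin n → ℤ, (∀ j, z₀ j = 0 → 0 ≤ α j) → ∀ z ∈ Metric.ball z₀ r,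
        ‖mono α z‖ ≤ ∑ σ, ‖mono α (ζ σ)‖ := by
  obtain ⟨R, hR0, hRU⟩ := Metric.isOpen_iff.1 hU z₀ hz₀
  obtain ⟨ε, hε, hεR, hεz⟩ : ∃ ε > 0, ε < R ∧ ∀ j, z₀ j ≠ 0 → ε < ‖z₀ j‖ := by
    have h1 : ∀ᶠ ε in nhdsWithin (0 : ℝ) (Ioi 0), ε < R :=
      nhdsWithin_le_nhds (Iio_mem_nhds hR0)
    have h2 : ∀ j, z₀ j ≠ 0 → ∀ᶠ ε in nhdsWithin (0 : ℝ) (Ioi 0), ε < ‖z₀ j‖ := fun j hj =>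
      nhdsWithin_le_nhds (Iio_mem_nhds (norm_pos_iff.2 hj))
    have h3 : ∀ᶠ ε in nhdsWithin (0 : ℝ) (Ioi 0), ∀ j, z₀ j ≠ 0 → ε < ‖z₀ j‖ := by
      rw [Filter.eventually_all]
      intro j
      by_cases hj : z₀ j = 0
      · simp [hj]
      · filter_upwards [h2 j hj] with ε h _ using h
    obtain ⟨ε, ⟨h, h'⟩, h0⟩ := ((h1.and h3).and self_mem_nhdsWithin).exists
    exact ⟨ε, h0, h, h'⟩
  -- the two radii in the `j`-th coordinate, both equal to `ε` if `z₀ j = 0`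
  let ρ : Fin n → Bool → ℝ := fun j b =>
    if z₀ j = 0 then ε else if b then ‖z₀ j‖ + ε else ‖z₀ j‖ - ε
  let ζ : (Fin n → Bool) → Fin n → ℂ := fun σ j =>
    (ρ j (σ j) : ℂ) * (if z₀ j = 0 then 1 else z₀ j / ‖z₀ j‖)
  have hρ : ∀ j b, 0 < ρ j b := by
    intro j b
    by_cases hj : z₀ j = 0
    · simp [ρ, hj, hε]
    · have := hεz j hj
      cases b <;> simp only [ρ, hj, if_false, if_true, Bool.false_eq_true] <;>
        linarith [norm_nonneg (z₀ j)]
  have hζn : ∀ σ j, ‖ζ σ j‖ = ρ j (σ j) := by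
    intro σ j
    have : ‖(if z₀ j = 0 then 1 else z₀ j / ‖z₀ j‖ : ℂ)‖ = 1 := by
      split_ifs with hj
      · simp
      · simp [norm_ne_zero_iff.2 hj]
    rw [norm_mul, this, mul_one, Complex.norm_real, Real.norm_eq_abs, abs_of_pos (hρ _ _)]
  refine ⟨ε, hε, (Metric.ball_subset_ball hεR.le).trans hRU, ζ, fun σ => hRU ?_, fun α hα z hz => ?_⟩
  · rw [mem_ball_iff_norm]
    refine lt_of_le_of_lt ((pi_norm_le_iff_of_nonneg hε.le).2 fun j => ?_) hεR
    by_cases hj : z₀ j = 0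
    · simp [ζ, ρ, hj, abs_of_pos hε]
    · have hn : (‖z₀ j‖ : ℂ) ≠ 0 := by exact_mod_cast norm_ne_zero_iff.2 hj
      have h1 : ∀ δ : ℝ, ‖((‖z₀ j‖ + δ : ℝ) : ℂ) * (z₀ j / ‖z₀ j‖) - z₀ j‖ = |δ| := by
        intro δ
        have : ((‖z₀ j‖ + δ : ℝ) : ℂ) * (z₀ j / ‖z₀ j‖) - z₀ j = δ * (z₀ j / ‖z₀ j‖) := by
          push_cast; field_simp; ring1
        rw [this, norm_mul, norm_div, Complex.norm_real, Complex.norm_real, norm_norm,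
          div_self (norm_ne_zero_iff.2 hj), mul_one, Real.norm_eq_abs]
      have h2 := h1 ε
      have h3 := h1 (-ε)
      rw [abs_neg, ← sub_eq_add_neg] at h3
      rw [abs_of_pos hε] at h2 h3
      cases hb : σ j
      · simpa [ζ, ρ, hj, hb] using h3.le
      · simpa [ζ, ρ, hj, hb] using h2.le
  · have hj1 : ∀ j, ‖z j ^ α j‖ ≤ ∑ b : Bool, ρ j b ^ α j := by
      intro j
      have hzj : ‖z j - z₀ j‖ < ε :=
        lt_of_le_of_lt (norm_le_pi_norm (z - z₀) j) (mem_ball_iff_norm.1 hz)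
      rw [Fintype.sum_bool, norm_zpow]
      by_cases hj : z₀ j = 0
      · rw [hj, sub_zero] at hzj
        have := zpow_le_zpow_left₀ (hα j hj) (norm_nonneg (z j)) hzj.le
        have := zpow_pos hε (α j)
        simp only [ρ, hj, if_true]; linarith
      · simp only [ρ, hj, if_false, if_true, Bool.false_eq_true]
        refine zpow_le_add_of_mem_Icc (by linarith [hεz j hj]) ?_ ?_ _
        · have := norm_sub_norm_le (z₀ j) (z j); rw [norm_sub_rev] at this; linarith
        · have := norm_sub_norm_le (z j) (z₀ j); linarith
    calc ‖mono α z‖ = ∏ j, ‖z j ^ α j‖ := norm_prod _ _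
      _ ≤ ∏ j, ∑ b : Bool, ρ j b ^ α j :=
          Finset.prod_le_prod (fun _ _ => norm_nonneg _) fun j _ => hj1 j
      _ = ∑ σ : Fin n → Bool, ∏ j, ρ j (σ j) ^ α j := Fintype.prod_sum fun j b => ρ j b ^ α j
      _ = ∑ σ, ‖mono α (ζ σ)‖ := by
          refine Finset.sum_congr rfl fun σ _ => ?_
          rw [mono, norm_prod]
          exact Finset.prod_congr rfl fun j _ => by rw [norm_zpow, hζn]

/-- A Laurent series with regular monomials that converges absolutely at every point of an open set
is holomorphic there. -/
theorem differentiableOn_laurent {n : ℕ} {U : Set (Fin n → ℂ)} (hU : IsOpen U) {ι : Type*}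
    {A : ι → Fin n → ℤ} {a : ι → ℂ} (hreg : ∀ i, ∀ z ∈ U, ∀ j, z j = 0 → 0 ≤ A i j)
    (hsum : ∀ z ∈ U, Summable fun i => a i * mono (A i) z) :
    DifferentiableOn ℂ (fun z => ∑' i, a i * mono (A i) z) U := by
  refine differentiableOn_tsum_of_locally_dominated
    (fun i => (differentiableOn_mono (hreg i)).const_mul _) fun z₀ hz₀ => ?_
  obtain ⟨r, hr, hrU, ζ, hζ, hb⟩ := exists_corners hU hz₀
  refine ⟨r, hr, hrU, fun i => ∑ σ, ‖a i * mono (A i) (ζ σ)‖,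
    summable_sum fun σ _ => (hsum _ (hζ σ)).norm, fun i z hz => ?_⟩
  simp only [norm_mul, ← Finset.mul_sum]
  exact mul_le_mul_of_nonneg_left (hb (A i) (hreg i z₀ hz₀) z hz) (norm_nonneg _)

/-- The map `(p, q) ↦ p q̄` on `ℂ × ℂ` is open. At `(0, 0)` this is seen by taking square roots. -/
theorem exists_mul_star_eq (p q : ℂ) {ε : ℝ} (hε : 0 < ε) :
    ∃ δ > 0, ∀ z, ‖z - p * star q‖ < δ → ∃ p' q', ‖p' - p‖ < ε ∧ ‖q' - q‖ < ε ∧ p' * star q' = z := by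
  by_cases hq : q = 0
  · by_cases hp : p = 0
    · refine ⟨ε ^ 2, by positivity, fun z hz => ?_⟩
      subst hq hp
      simp only [star_zero, mul_zero, sub_zero] at hz ⊢
      have h1 : √‖z‖ < ε := by
        rw [Real.sqrt_lt' hε]; exact hz
      refine ⟨z / (√‖z‖ : ℝ), (√‖z‖ : ℝ), ?_, ?_, ?_⟩
      · rw [norm_div, Complex.norm_real, Real.norm_of_nonneg (Real.sqrt_nonneg _), Real.div_sqrt]
        exact h1
      · rwa [Complex.norm_real, Real.norm_of_nonneg (Real.sqrt_nonneg _)]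
      · by_cases h : z = 0
        · simp [h]
        · have : ((√‖z‖ : ℝ) : ℂ) ≠ 0 := by
            exact_mod_cast (Real.sqrt_pos.2 (norm_pos_iff.2 h)).ne'
          rw [Complex.star_def, Complex.conj_ofReal, div_mul_cancel₀ _ this]
    · refine ⟨ε * ‖p‖, mul_pos hε (norm_pos_iff.2 hp), fun z hz => ⟨p, star (z / p), by simpa, ?_, ?_⟩⟩
      · subst hq
        simp only [star_zero, mul_zero, sub_zero] at hz ⊢
        rw [norm_star, norm_div, div_lt_iff₀ (norm_pos_iff.2 hp)]
        exact hz
      · rw [star_star, mul_div_cancel₀ _ hp]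
  · have hq' : star q ≠ 0 := by simpa using hq
    refine ⟨ε * ‖q‖, mul_pos hε (norm_pos_iff.2 hq), fun z hz => ⟨z / star q, q, ?_, by simpa, ?_⟩⟩
    · have : z / star q - p = (z - p * star q) / star q := by field_simp
      rw [this, norm_div, norm_star, div_lt_iff₀ (norm_pos_iff.2 hq)]
      exact hz
    · rw [div_mul_cancel₀ _ hq']

theorem isOpen_tildeSet {n : ℕ} {Ω : Set (Fin n → ℂ)} (hΩ : IsOpen Ω) : IsOpen (tildeSet Ω) := by
  rw [isOpen_iff_mem_nhds]
  rintro _ ⟨p, hp, q, hq, rfl⟩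
  obtain ⟨r, hr, hrp⟩ := Metric.isOpen_iff.1 hΩ p hp
  obtain ⟨s, hs, hsq⟩ := Metric.isOpen_iff.1 hΩ q hq
  have hε : 0 < min r s := lt_min hr hs
  choose δ hδ h using fun j => exists_mul_star_eq (p j) (q j) hε
  have hev : ∀ᶠ z : Fin n → ℂ in nhds (p * star q), ∀ j, ‖z j - p j * star (q j)‖ < δ j := by
    rw [Filter.eventually_all]
    intro j
    have : Filter.Tendsto (fun z : Fin n → ℂ => ‖z j - p j * star (q j)‖) (nhds (p * star q))
        (nhds 0) := by
      have hc : Continuous fun z : Fin n → ℂ => ‖z j - p j * star (q j)‖ := by fun_prop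
      simpa using hc.tendsto (p * star q)
    exact this.eventually (Iio_mem_nhds (hδ j))
  filter_upwards [hev] with z hz
  choose p' q' hp' hq' hz' using fun j => h j (z j) (hz j)
  refine ⟨p', hrp ?_, q', hsq ?_, funext hz'⟩
  · rw [mem_ball_iff_norm, pi_norm_lt_iff hr]
    exact fun j => (hp' j).trans_le (min_le_left _ _)
  · rw [mem_ball_iff_norm, pi_norm_lt_iff hs]
    exact fun j => (hq' j).trans_le (min_le_right _ _)

/-! ### The weighted measure and rotations -/

/-- Connected Reinhardt domains with an admissible multi-radial weight. -/
structure IsAdmissibleReinhardt {n : ℕ} (Ω : Set (Fin n → ℂ)) (ω : (Fin n → ℂ) → ℝ≥0∞) :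
    Prop where
  isOpen : IsOpen Ω
  isConnected : IsConnected Ω
  isReinhardt : IsReinhardt Ω
  weight : IsMultiRadialWeight Ω ω
  admissible : IsAdmissible Ω ω

variable {n : ℕ} {Ω : Set (Fin n → ℂ)} {ω : (Fin n → ℂ) → ℝ≥0∞}

theorem volume_preserving_unit_mul {l : Fin n → ℂ} (hl : ∀ j, ‖l j‖ = 1) :
    MeasurePreserving (fun z : Fin n → ℂ => l * z) volume volume :=
  volume_preserving_pi fun j =>
    (rotation (⟨l j, by simp [Submonoid.unitSphere, hl j]⟩ : Circle)).measurePreserving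

/-- Multiplication by a point of the torus, as a measurable equivalence. -/
def torusEquiv {l : Fin n → ℂ} (hl : ∀ j, ‖l j‖ = 1) : (Fin n → ℂ) ≃ᵐ (Fin n → ℂ) where
  toFun z := l * z
  invFun z := star l * z
  left_inv z := by
    funext j
    simp [← mul_assoc, Complex.conj_mul', hl j]
  right_inv z := by
    funext j
    simp [← mul_assoc, Complex.mul_conj', hl j]
  measurable_toFun := (continuous_const.mul continuous_id).measurable
  measurable_invFun := (continuous_const.mul continuous_id).measurable

theorem preimage_unit_mul (hR : IsReinhardt Ω) {l : Fin n → ℂ} (hl : ∀ j, ‖l j‖ = 1) :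
    (fun z : Fin n → ℂ => l * z) ⁻¹' Ω = Ω := by
  ext z
  refine ⟨fun hz => ?_, fun hz => hR z hz l hl⟩
  have := hR _ hz (star l) fun j => by simp [hl j]
  rwa [show star l * (l * z) = z from (torusEquiv hl).left_inv z] at this

theorem measurePreserving_unit_mul (hΩ : IsOpen Ω) (hR : IsReinhardt Ω)
    (hω : IsMultiRadialWeight Ω ω) {l : Fin n → ℂ} (hl : ∀ j, ‖l j‖ = 1) :
    MeasurePreserving (fun z : Fin n → ℂ => l * z) (wMeasure Ω ω) (wMeasure Ω ω) := by
  have h1 : MeasurePreserving (fun z : Fin n → ℂ => l * z) (volume.restrict Ω)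
      (volume.restrict Ω) := by
    have := (volume_preserving_unit_mul hl).restrict_preimage hΩ.measurableSet
    rwa [preimage_unit_mul hR hl] at this
  refine ⟨h1.measurable, Measure.ext fun s hs => ?_⟩
  rw [Measure.map_apply h1.measurable hs, wMeasure, withDensity_apply _ (h1.measurable hs),
    withDensity_apply _ hs,
    ← h1.setLIntegral_comp_preimage_emb (torusEquiv hl).measurableEmbedding ω s]
  refine lintegral_congr_ae (ae_restrict_of_ae ?_)
  obtain ⟨a, ha⟩ := hω.radial
  filter_upwards [ae_restrict_mem hΩ.measurableSet] with z hz
  rw [ha z hz, ha _ (hR z hz l hl)]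
  congr 1
  funext j
  simp [hl j]

instance sFinite_wMeasure : SFinite (wMeasure Ω ω) := by
  unfold wMeasure; infer_instance

theorem ae_mem_wMeasure (hΩ : IsOpen Ω) : ∀ᵐ z ∂(wMeasure Ω ω), z ∈ Ω :=
  (withDensity_absolutelyContinuous _ _).ae_le (ae_restrict_mem hΩ.measurableSet)

/-- Rotations depending on a parameter in the cube preserve the product measure; this is the input
for exchanging averages over rotations with integrals. -/
theorem measurePreserving_skew_torus (hΩ : IsOpen Ω) (hR : IsReinhardt Ω)
    (hω : IsMultiRadialWeight Ω ω) :
    MeasurePreserving (fun p : (Fin n → ℝ) × (Fin n → ℂ) => (p.1, torusPt p.1 * p.2))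
      ((volume.restrict (Icc (0 : Fin n → ℝ) 1)).prod (wMeasure Ω ω))
      ((volume.restrict (Icc (0 : Fin n → ℝ) 1)).prod (wMeasure Ω ω)) := by
  refine (MeasurePreserving.id _).skew_product (g := fun x w => torusPt x * w) ?_
    (Filter.Eventually.of_forall fun x =>
      (measurePreserving_unit_mul hΩ hR hω (norm_torusPt x)).map_eq)
  exact ((continuous_torusPt.comp continuous_fst).mul continuous_snd).measurable

section Average

variable {F : Type*} [NormedAddCommGroup F]

theorem integrable_comp_rotation (hΩ : IsOpen Ω) (hR : IsReinhardt Ω)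
    (hω : IsMultiRadialWeight Ω ω) {h : (Fin n → ℂ) → F} (hi : Integrable h (wMeasure Ω ω)) :
    Integrable (fun p : (Fin n → ℝ) × (Fin n → ℂ) => h (torusPt p.1 * p.2))
      ((volume.restrict (Icc (0 : Fin n → ℝ) 1)).prod (wMeasure Ω ω)) :=
  (measurePreserving_skew_torus hΩ hR hω).integrable_comp_of_integrable
    (g := fun p : (Fin n → ℝ) × (Fin n → ℂ) => h p.2)
    (hi.comp_snd (volume.restrict (Icc (0 : Fin n → ℝ) 1)))

theorem integrable_rotation_average [NormedSpace ℝ F] (hΩ : IsOpen Ω) (hR : IsReinhardt Ω)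
    (hω : IsMultiRadialWeight Ω ω) {h : (Fin n → ℂ) → F} (hi : Integrable h (wMeasure Ω ω)) :
    Integrable (fun w => ∫ x in Icc (0 : Fin n → ℝ) 1, h (torusPt x * w)) (wMeasure Ω ω) :=
  (integrable_comp_rotation hΩ hR hω hi).integral_prod_right

/-- An integral for `ω dV` does not change when the integrand is averaged over the rotations. -/
theorem integral_eq_integral_rotation_average [NormedSpace ℝ F] [CompleteSpace F]
    (hΩ : IsOpen Ω) (hR : IsReinhardt Ω)
    (hω : IsMultiRadialWeight Ω ω) {h : (Fin n → ℂ) → F} (hi : Integrable h (wMeasure Ω ω)) :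
    ∫ w, h w ∂(wMeasure Ω ω)
      = ∫ w, (∫ x in Icc (0 : Fin n → ℝ) 1, h (torusPt x * w)) ∂(wMeasure Ω ω) := by
  have h1 := integral_prod_symm _ (integrable_comp_rotation hΩ hR hω hi)
  have h2 : ∫ x in Icc (0 : Fin n → ℝ) 1, ∫ w, h (torusPt x * w) ∂(wMeasure Ω ω)
      = ∫ w, h w ∂(wMeasure Ω ω) := by
    have h3 : ∀ x : Fin n → ℝ, ∫ w, h (torusPt x * w) ∂(wMeasure Ω ω) = ∫ w, h w ∂(wMeasure Ω ω) :=
      fun x => (measurePreserving_unit_mul hΩ hR hω (norm_torusPt x)).integral_comp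
        (torusEquiv (norm_torusPt x)).measurableEmbedding h
    simp only [h3, integral_const, probReal_univ, one_smul]
  rw [← h1, integral_prod _ (integrable_comp_rotation hΩ hR hω hi), h2]

end Average

/-! ### The weighted Bergman space -/

/-- The weight is positive almost everywhere, so a class in `A²(Ω, ω)` has only one holomorphic
representative on `Ω`. -/
theorem Represents.eqOn (hΩ : IsOpen Ω) (hω : IsMultiRadialWeight Ω ω) {F : A2 Ω ω}
    {f g : (Fin n → ℂ) → ℂ} (hf : Represents Ω ω f F) (hg : Represents Ω ω g F) :
    EqOn f g Ω := by
  have h1 : f =ᵐ[wMeasure Ω ω] g := hf.2.symm.trans hg.2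
  have hac : (volume.restrict Ω) ≪ wMeasure Ω ω :=
    withDensity_absolutelyContinuous' hω.aemeasurable (hω.pos.mono fun z hz => hz.ne')
  exact Measure.eqOn_open_of_ae_eq (hac.ae_le h1) hΩ hf.1.continuousOn hg.1.continuousOn

theorem Represents.congr (hΩ : IsOpen Ω) {F : A2 Ω ω} {f g : (Fin n → ℂ) → ℂ}
    (hf : Represents Ω ω f F) (h : EqOn g f Ω) : Represents Ω ω g F :=
  ⟨hf.1.congr h, hf.2.trans ((ae_mem_wMeasure hΩ).mono fun _ hz => (h hz).symm)⟩

theorem Represents.add {F G : A2 Ω ω} {f g : (Fin n → ℂ) → ℂ} (hf : Represents Ω ω f F)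
    (hg : Represents Ω ω g G) : Represents Ω ω (f + g) (F + G) :=
  ⟨hf.1.add hg.1, (Lp.coeFn_add _ _).trans (hf.2.add hg.2)⟩

theorem Represents.smul {F : A2 Ω ω} {f : (Fin n → ℂ) → ℂ} (c : ℂ) (hf : Represents Ω ω f F) :
    Represents Ω ω (c • f) (c • F) :=
  ⟨hf.1.const_smul c, (Lp.coeFn_smul _ _).trans (hf.2.const_smul c)⟩

theorem represents_zero : Represents Ω ω (0 : (Fin n → ℂ) → ℂ) 0 :=
  ⟨differentiableOn_const 0, Lp.coeFn_zero _ _ _⟩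

theorem Represents.sum {ι : Type*} {s : Finset ι} {F : ι → A2 Ω ω} {f : ι → (Fin n → ℂ) → ℂ}
    (h : ∀ i, Represents Ω ω (f i) (F i)) :
    Represents Ω ω (∑ i ∈ s, f i) (∑ i ∈ s, F i) := by
  classical
  induction s using Finset.induction_on with
  | empty => simpa using represents_zero
  | insert i s hi ih => rw [Finset.sum_insert hi, Finset.sum_insert hi]; exact (h i).add ih

/-- A holomorphic representative of an element of the Bergman space. -/
def rep (F : A2 Ω ω) : (Fin n → ℂ) → ℂ := Classical.choose F.2

theorem rep_spec (F : A2 Ω ω) : Represents Ω ω (rep F) F := Classical.choose_spec F.2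

/-- The class in the Bergman space of a square integrable holomorphic function. -/
def ofMemLp {f : (Fin n → ℂ) → ℂ} (hd : DifferentiableOn ℂ f Ω)
    (hf : MemLp f 2 (wMeasure Ω ω)) : A2 Ω ω :=
  ⟨hf.toLp f, f, hd, hf.coeFn_toLp⟩

theorem represents_ofMemLp {f : (Fin n → ℂ) → ℂ} (hd : DifferentiableOn ℂ f Ω)
    (hf : MemLp f 2 (wMeasure Ω ω)) : Represents Ω ω f (ofMemLp hd hf) :=
  ⟨hd, hf.coeFn_toLp⟩

theorem Represents.memLp {F : A2 Ω ω} {f : (Fin n → ℂ) → ℂ} (hf : Represents Ω ω f F) :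
    MemLp f 2 (wMeasure Ω ω) :=
  (memLp_congr_ae hf.2).1 (Lp.memLp _)

theorem Represents.inner_eq {F G : A2 Ω ω} {f g : (Fin n → ℂ) → ℂ} (hf : Represents Ω ω f F)
    (hg : Represents Ω ω g G) :
    inner ℂ F G = ∫ w, star (f w) * g w ∂(wMeasure Ω ω) := by
  rw [Submodule.coe_inner, L2.inner_def]
  refine integral_congr_ae ?_
  filter_upwards [hf.2, hg.2] with w h1 h2
  rw [h1, h2, RCLike.inner_apply', Complex.star_def]

theorem Represents.integrable_star_mul {F G : A2 Ω ω} {f g : (Fin n → ℂ) → ℂ}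
    (hf : Represents Ω ω f F) (hg : Represents Ω ω g G) :
    Integrable (fun w => star (f w) * g w) (wMeasure Ω ω) :=
  hf.memLp.star.integrable_mul hg.memLp

namespace IsAdmissibleReinhardt

theorem represents_unique (hA : IsAdmissibleReinhardt Ω ω) {F : A2 Ω ω} {f g : (Fin n → ℂ) → ℂ}
    (hf : Represents Ω ω f F) (hg : Represents Ω ω g F) : EqOn f g Ω :=
  hf.eqOn hA.isOpen hA.weight hg

theorem eq_of_represents (hA : IsAdmissibleReinhardt Ω ω) {F G : A2 Ω ω}
    {f g : (Fin n → ℂ) → ℂ} (hf : Represents Ω ω f F) (hg : Represents Ω ω g G)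
    (h : EqOn f g Ω) : F = G := by
  refine Subtype.ext (Lp.ext (hf.2.trans (Filter.EventuallyEq.trans ?_ hg.2.symm)))
  exact (ae_mem_wMeasure hA.isOpen).mono fun _ hz => h hz

theorem exists_norm_rep_le (hA : IsAdmissibleReinhardt Ω ω) {z : Fin n → ℂ} (hz : z ∈ Ω) :
    ∃ C > 0, ∃ r > 0, Metric.ball z r ⊆ Ω ∧
      ∀ F : A2 Ω ω, ∀ w ∈ Metric.ball z r, ‖rep F w‖ ≤ C * ‖F‖ := by
  obtain ⟨r, hr, hrU⟩ := Metric.nhds_basis_closedBall.mem_iff.1 (hA.isOpen.mem_nhds hz)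
  obtain ⟨C, hC, h⟩ := hA.admissible _ hrU (isCompact_closedBall z r)
  exact ⟨C, hC, r, hr, Metric.ball_subset_closedBall.trans hrU, fun F w hw =>
    h F _ (rep_spec F) w (Metric.ball_subset_closedBall hw)⟩

/-- Point evaluation on the Bergman space. -/
def eval (hA : IsAdmissibleReinhardt Ω ω) {z : Fin n → ℂ} (hz : z ∈ Ω) : A2 Ω ω →L[ℂ] ℂ :=
  LinearMap.mkContinuousOfExistsBound
    { toFun := fun F => rep F z
      map_add' := fun F G =>
        hA.represents_unique (rep_spec (F + G)) ((rep_spec F).add (rep_spec G)) hz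
      map_smul' := fun c F =>
        hA.represents_unique (rep_spec (c • F)) ((rep_spec F).smul c) hz } <| by
    obtain ⟨C, -, r, hr, -, h⟩ := hA.exists_norm_rep_le hz
    exact ⟨C, fun F => h F z (Metric.mem_ball_self hr)⟩

theorem eval_eq (hA : IsAdmissibleReinhardt Ω ω) {z : Fin n → ℂ} (hz : z ∈ Ω) {F : A2 Ω ω}
    {f : (Fin n → ℂ) → ℂ} (hf : Represents Ω ω f F) : hA.eval hz F = f z :=
  hA.represents_unique (rep_spec F) hf hz

theorem eval_ext (hA : IsAdmissibleReinhardt Ω ω) {F G : A2 Ω ω}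
    (h : ∀ z (hz : z ∈ Ω), hA.eval hz F = hA.eval hz G) : F = G :=
  hA.eq_of_represents (rep_spec F) (rep_spec G) h

/-- Completeness: by admissibility, a series that converges absolutely in norm converges locally
uniformly on `Ω`, so its sum is holomorphic. -/
theorem completeSpace_A2 (hA : IsAdmissibleReinhardt Ω ω) : CompleteSpace (A2 Ω ω) := by
  refine NormedAddCommGroup.completeSpace_of_summable_imp_tendsto fun u hu => ?_
  -- the sum of the holomorphic representatives converges locally uniformly
  let g : (Fin n → ℂ) → ℂ := fun z => ∑' k, rep (u k) z
  have hg : DifferentiableOn ℂ g Ω := by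
    refine differentiableOn_tsum_of_locally_dominated (fun k => (rep_spec (u k)).1) fun z hz => ?_
    obtain ⟨C, -, r, hr, hrU, h⟩ := hA.exists_norm_rep_le hz
    exact ⟨r, hr, hrU, fun k => C * ‖u k‖, hu.mul_left C, fun k w hw => h _ w hw⟩
  have hsum : ∀ z ∈ Ω, Summable fun k => rep (u k) z := by
    intro z hz
    obtain ⟨C, -, r, hr, -, h⟩ := hA.exists_norm_rep_le hz
    exact Summable.of_norm_bounded (hu.mul_left C) fun k => h _ z (Metric.mem_ball_self hr)
  have hu' : Summable fun k => (u k : Lp ℂ 2 (wMeasure Ω ω)) := Summable.of_norm hu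
  obtain ⟨G, hG⟩ := hu'
  have hlim := hG.tendsto_sum_nat
  have hrepr : ∀ N, Represents Ω ω (∑ k ∈ Finset.range N, rep (u k)) (∑ k ∈ Finset.range N, u k) :=
    fun N => Represents.sum fun k => rep_spec (u k)
  have hGg : (G : (Fin n → ℂ) → ℂ) =ᵐ[wMeasure Ω ω] g := by
    obtain ⟨ns, hns, hae⟩ := (tendstoInMeasure_of_tendsto_Lp hlim).exists_seq_tendsto_ae
    have h1 : ∀ᵐ z ∂(wMeasure Ω ω), ∀ N,
        (∑ k ∈ Finset.range N, (u k : Lp ℂ 2 (wMeasure Ω ω)) : Lp ℂ 2 (wMeasure Ω ω)) z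
          = ∑ k ∈ Finset.range N, rep (u k) z := by
      rw [ae_all_iff]
      intro N
      have := (hrepr N).2
      rw [Submodule.coe_sum] at this
      filter_upwards [this] with z hz
      rw [hz, Finset.sum_apply]
    filter_upwards [hae, h1, ae_mem_wMeasure hA.isOpen] with z hz1 hz2 hz
    refine tendsto_nhds_unique hz1 ?_
    simp only [hz2]
    exact (hsum z hz).hasSum.tendsto_sum_nat.comp hns.tendsto_atTop
  refine ⟨⟨G, g, hg, hGg⟩, ?_⟩
  rw [tendsto_subtype_rng]
  simpa only [Submodule.coe_sum] using hlim

end IsAdmissibleReinhardt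

/-! ### Homogeneous components of holomorphic functions -/

/-- The homogeneous component of degree `α` of `f`, the Fourier coefficient of `f` along the
rotations. -/
def homPart (f : (Fin n → ℂ) → ℂ) (α : Fin n → ℤ) (w : Fin n → ℂ) : ℂ :=
  cubeCoeff (fun x => f (torusPt x * w)) α

theorem isPeriodic_rotation (f : (Fin n → ℂ) → ℂ) (w : Fin n → ℂ) :
    IsPeriodic fun x : Fin n → ℝ => f (torusPt x * w) := by
  intro x k
  have : torusPt (fun j => x j + k j) = torusPt x := by
    funext j
    have : 2 * (Real.pi : ℂ) * Complex.I * ((x j + k j : ℝ) : ℂ)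
        = 2 * Real.pi * Complex.I * (x j : ℂ) + k j * (2 * Real.pi * Complex.I) := by
      push_cast; ring
    rw [torusPt, this, Complex.exp_add, Complex.exp_int_mul_two_pi_mul_I, mul_one, torusPt]
  simp only [this]

theorem continuous_rotation (hR : IsReinhardt Ω) {f : (Fin n → ℂ) → ℂ} (hf : ContinuousOn f Ω)
    {w : Fin n → ℂ} (hw : w ∈ Ω) : Continuous fun x : Fin n → ℝ => f (torusPt x * w) :=
  hf.comp_continuous (continuous_torusPt.mul continuous_const) fun x => hR.torusPt_mul_mem hw x

theorem homPart_rotate (f : (Fin n → ℂ) → ℂ) (α : Fin n → ℤ) (w : Fin n → ℂ) (y : Fin n → ℝ) :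
    homPart f α (torusPt y * w) = (char α : (Fin n → ℝ) → ℂ) y * homPart f α w := by
  rw [homPart, homPart, ← cubeCoeff_comp_add (isPeriodic_rotation f w) y α]
  congr 1
  funext x
  rw [torusPt_add, mul_right_comm, mul_comm]

/-- Differentiation under the integral sign. -/
theorem differentiableOn_homPart (hΩ : IsOpen Ω) (hR : IsReinhardt Ω) {f : (Fin n → ℂ) → ℂ}
    (hf : DifferentiableOn ℂ f Ω) (α : Fin n → ℤ) : DifferentiableOn ℂ (homPart f α) Ω := by
  intro w₀ hw₀
  obtain ⟨r, hr, hrU⟩ := Metric.nhds_basis_closedBall.mem_iff.1 (hΩ.mem_nhds hw₀)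
  let F' : (Fin n → ℂ) → (Fin n → ℝ) → (Fin n → ℂ) →L[ℂ] ℂ := fun w x =>
    (char (-α) : (Fin n → ℝ) → ℂ) x •
      (fderiv ℂ f (torusPt x * w)).comp (ContinuousLinearMap.mul ℂ (Fin n → ℂ) (torusPt x))
  have hF' : ContinuousOn (fun p : (Fin n → ℝ) × (Fin n → ℂ) => F' p.2 p.1) (univ ×ˢ Ω) := by
    refine ContinuousOn.smul ((continuous_char _).comp continuous_fst).continuousOn
      (ContinuousOn.clm_comp ?_ ?_)
    · refine (continuousOn_fderiv_of_differentiableOn hΩ hf).comp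
        ((continuous_torusPt.comp continuous_fst).mul continuous_snd).continuousOn ?_
      exact fun p hp => hR.torusPt_mul_mem hp.2 p.1
    · exact ((ContinuousLinearMap.mul ℂ (Fin n → ℂ)).continuous.comp
        (continuous_torusPt.comp continuous_fst)).continuousOn
  obtain ⟨B, hB⟩ := ((isCompact_Icc (a := (0 : Fin n → ℝ)) (b := 1)).prod
    (isCompact_closedBall w₀ r)).exists_bound_of_continuousOn
    (hF'.mono (prod_mono (subset_univ _) hrU))
  have hcont : ∀ w ∈ Ω, Continuous fun x : Fin n → ℝ =>
      (char (-α) : (Fin n → ℝ) → ℂ) x * f (torusPt x * w) := fun w hw =>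
    (continuous_char _).mul (continuous_rotation hR hf.continuousOn hw)
  refine (hasFDerivAt_integral_of_dominated_of_fderiv_le (𝕜 := ℂ)
    (F := fun w x => (char (-α) : (Fin n → ℝ) → ℂ) x * f (torusPt x * w)) (F' := F')
    (bound := fun _ => B) (Metric.closedBall_mem_nhds w₀ hr) ?_ ?_ ?_ ?_ (integrable_const _)
    ?_).differentiableAt.differentiableWithinAt
  · filter_upwards [hΩ.mem_nhds hw₀] with w hw using (hcont w hw).aestronglyMeasurable
  · exact (hcont w₀ hw₀).integrableOn_Icc
  · have : Continuous (F' w₀) := by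
      have := hF'.comp_continuous (f := fun x : Fin n → ℝ => (x, w₀)) (by fun_prop)
        fun x => ⟨trivial, hw₀⟩
      exact this
    exact this.aestronglyMeasurable
  · filter_upwards [ae_restrict_mem measurableSet_Icc] with x hx w hw using hB (x, w) ⟨hx, hw⟩
  · refine Filter.Eventually.of_forall fun x w hw => ?_
    have h1 : HasFDerivAt f (fderiv ℂ f (torusPt x * w)) (torusPt x * w) :=
      (hf.differentiableAt (hΩ.mem_nhds (hR.torusPt_mul_mem (hrU hw) x))).hasFDerivAt
    have h2 := h1.comp w (ContinuousLinearMap.mul ℂ (Fin n → ℂ) (torusPt x)).hasFDerivAt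
    exact h2.const_smul ((char (-α) : (Fin n → ℝ) → ℂ) x)

/-- A holomorphic function that is invariant under rotations has zero derivative at the points
without vanishing coordinates. -/
theorem fderiv_eq_zero_of_rotation_invariant {q : (Fin n → ℂ) → ℂ} {w : Fin n → ℂ}
    (hw : ∀ j, w j ≠ 0) (hq : DifferentiableAt ℂ q w)
    (hinv : ∀ x : Fin n → ℝ, q (torusPt x * w) = q w) : fderiv ℂ q w = 0 := by
  classical
  have key : ∀ j, fderiv ℂ q w (Pi.single j 1) = 0 := by
    intro j
    let γ : ℝ → Fin n → ℂ := fun t => torusPt (Pi.single j t) * w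
    have hγ0 : γ 0 = w := by simp [γ, torusPt_zero]
    have hγ : HasDerivAt γ (Pi.single j (2 * Real.pi * Complex.I * w j)) 0 := by
      rw [hasDerivAt_pi]
      intro i
      by_cases hi : i = j
      · subst hi
        have h1 : HasDerivAt (fun t : ℝ => Complex.exp (2 * Real.pi * Complex.I * (t : ℂ)) * w i)
            (Complex.exp (2 * Real.pi * Complex.I * ((0 : ℝ) : ℂ))
              * (2 * Real.pi * Complex.I * 1) * w i) 0 :=
          (((Complex.ofRealCLM.hasDerivAt (x := (0 : ℝ))).const_mul _).cexp).mul_const _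
        simpa [γ, torusPt] using h1
      · have : (fun t => γ t i) = fun _ => w i := by
          funext t; simp [γ, torusPt, hi]
        rw [this, Pi.single_eq_of_ne hi]
        exact hasDerivAt_const _ _
    have h2 : HasFDerivAt q ((fderiv ℂ q w).restrictScalars ℝ) (γ 0) := by
      rw [hγ0]; exact hq.hasFDerivAt.restrictScalars ℝ
    have h3 := h2.comp_hasDerivAt (0 : ℝ) hγ
    have h4 : q ∘ γ = fun _ => q w := funext fun t => hinv _
    rw [h4] at h3
    have h5 := h3.unique (hasDerivAt_const _ _)
    have h6 : (Pi.single j (2 * Real.pi * Complex.I * w j) : Fin n → ℂ)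
        = (2 * Real.pi * Complex.I * w j) • (Pi.single j 1 : Fin n → ℂ) := by
      rw [← Pi.single_smul]; simp
    rw [h6, ContinuousLinearMap.coe_restrictScalars', map_smul, smul_eq_mul] at h5
    refine (mul_eq_zero.1 h5).resolve_left ?_
    exact mul_ne_zero (by simp [Real.pi_ne_zero]) (hw j)
  ext v
  rw [pi_eq_sum_univ' v, map_sum]
  refine Finset.sum_eq_zero fun j _ => ?_
  rw [map_smul]
  simp [key]

theorem mono_neg (α : Fin n → ℤ) (z : Fin n → ℂ) : mono (-α) z = (mono α z)⁻¹ := by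
  simp [mono]

theorem mono_negPart_mul {α : Fin n → ℤ} {w : Fin n → ℂ} (hw : ∀ j, w j = 0 → 0 ≤ α j) :
    mono α⁻ w * mono α w = mono α⁺ w := by
  simp only [mono, ← Finset.prod_mul_distrib]
  refine Finset.prod_congr rfl fun j _ => ?_
  by_cases hj : w j = 0
  · have h0 := hw j hj
    simp [Pi.negPart_apply, Pi.posPart_apply, negPart_eq_zero.2 h0, posPart_eq_self.2 h0]
  · rw [← zpow_add₀ hj]
    congr 1
    rw [Pi.negPart_apply, Pi.posPart_apply]
    have := posPart_sub_negPart (α j)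
    omega

theorem differentiable_mono_of_nonneg {α : Fin n → ℤ} (hα : 0 ≤ α) (U : Set (Fin n → ℂ)) :
    DifferentiableOn ℂ (mono α) U :=
  differentiableOn_mono fun _ _ j _ => hα j

/-- The homogeneous components of a holomorphic function on a connected Reinhardt domain are
multiples of the Laurent monomials; denominators are cleared, so that the identity makes sense on
the coordinate hyperplanes. -/
theorem exists_homPart_eq (hΩ : IsOpen Ω) (hconn : IsConnected Ω) (hR : IsReinhardt Ω)
    {f : (Fin n → ℂ) → ℂ} (hf : DifferentiableOn ℂ f Ω) (α : Fin n → ℤ) :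
    ∃ c : ℂ, ∀ w ∈ Ω, mono α⁻ w * homPart f α w = c * mono α⁺ w := by
  obtain ⟨z₀, hz₀⟩ := hconn.nonempty
  obtain ⟨p, hp, -, hp0⟩ := exists_mem_ne_zero hΩ hz₀ ∅
  have hp0 : ∀ j, p j ≠ 0 := fun j => hp0 j (notMem_empty j)
  have hopen : IsOpen {w : Fin n → ℂ | ∀ j, w j ≠ 0} := by
    rw [ofPred_forall]
    exact isOpen_iInter_of_finite fun j => (continuous_apply j).isOpen_preimage _ isOpen_ne
  obtain ⟨r, hr, hball⟩ := Metric.isOpen_iff.1 (hΩ.inter hopen) p ⟨hp, hp0⟩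
  have hh := differentiableOn_homPart hΩ hR hf α
  let q : (Fin n → ℂ) → ℂ := fun w => homPart f α w * mono (-α) w
  have hq : ∀ w ∈ Metric.ball p r, DifferentiableAt ℂ q w := by
    intro w hw
    refine (hh.differentiableAt (hΩ.mem_nhds (hball hw).1)).mul ?_
    have := differentiableOn_mono (U := Metric.ball p r) (α := -α)
      fun z hz j hj => absurd hj ((hball hz).2 j)
    exact this.differentiableAt (Metric.isOpen_ball.mem_nhds hw)
  have hconst : ∀ w ∈ Metric.ball p r, q w = q p := by
    intro w hw
    refine (convex_ball p r).is_const_of_fderivWithin_eq_zero (𝕜 := ℂ)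
      (fun v hv => (hq v hv).differentiableWithinAt) (fun v hv => ?_) hw (Metric.mem_ball_self hr)
    rw [fderivWithin_of_isOpen Metric.isOpen_ball hv]
    refine fderiv_eq_zero_of_rotation_invariant (hball hv).2 (hq v hv) fun x => ?_
    simp only [q]
    rw [homPart_rotate, mono_mul, ← char_eq_mono]
    have := char_add α (-α) x
    rw [add_neg_cancel, char_zero] at this
    linear_combination (- homPart f α v * mono (-α) v) * this
  refine ⟨q p, fun w hw => sub_eq_zero.1 ?_⟩
  refine eqOn_zero_of_eventuallyEq_zero (f := fun w => mono α⁻ w * homPart f α w - q p * mono α⁺ w)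
    hΩ hconn.isPreconnected ?_ hp ?_ w hw
  · exact ((differentiable_mono_of_nonneg (negPart_nonneg α) Ω).mul hh).sub
      ((differentiable_mono_of_nonneg (posPart_nonneg α) Ω).const_mul _)
  · filter_upwards [Metric.ball_mem_nhds p hr] with v hv
    have hv0 := (hball hv).2
    rw [← hconst v hv, ← mono_negPart_mul (α := α) fun j hj => absurd hj (hv0 j)]
    simp only [q]
    rw [mono_neg]
    field_simp [mono_ne_zero hv0]
    ring

/-- A nonzero component of degree `α` forces the exponents to be nonnegative where coordinates
vanish: otherwise the left-hand side of the identity vanishes at some point and the right-hand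
side does not. -/
theorem regular_of_homPart_eq (hΩ : IsOpen Ω) {f : (Fin n → ℂ) → ℂ} {α : Fin n → ℤ} {c : ℂ}
    (hc : c ≠ 0) (h : ∀ w ∈ Ω, mono α⁻ w * homPart f α w = c * mono α⁺ w) :
    ∀ z ∈ Ω, ∀ j, z j = 0 → 0 ≤ α j := by
  intro z hz j hj
  by_contra hneg
  push Not at hneg
  obtain ⟨p, hp, hpj, hp0⟩ := exists_mem_ne_zero hΩ hz {j}
  have hpj0 : p j = 0 := (hpj j rfl).trans hj
  have h1 : mono α⁻ p = 0 := by
    refine Finset.prod_eq_zero (Finset.mem_univ j) ?_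
    rw [hpj0, Pi.negPart_apply, zero_zpow]
    exact (negPart_pos_iff.2 hneg).ne'
  have h2 : mono α⁺ p ≠ 0 := by
    refine Finset.prod_ne_zero_iff.2 fun i _ => ?_
    by_cases hi : i = j
    · subst hi
      simp [Pi.posPart_apply, posPart_eq_zero.2 hneg.le]
    · exact zpow_ne_zero _ (hp0 i hi)
  have h3 := h p hp
  rw [h1, zero_mul] at h3
  exact mul_ne_zero hc h2 h3.symm

theorem homPart_eq_of_regular {f : (Fin n → ℂ) → ℂ} {α : Fin n → ℤ} {c : ℂ} {w : Fin n → ℂ}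
    (hreg : ∀ j, w j = 0 → 0 ≤ α j) (h : mono α⁻ w * homPart f α w = c * mono α⁺ w) :
    homPart f α w = c * mono α w := by
  have h0 : mono α⁻ w ≠ 0 := by
    refine Finset.prod_ne_zero_iff.2 fun j _ => ?_
    by_cases hj : w j = 0
    · simp [Pi.negPart_apply, negPart_eq_zero.2 (hreg j hj)]
    · exact zpow_ne_zero _ hj
  rw [← mono_negPart_mul hreg] at h
  exact mul_left_cancel₀ h0 (by rw [h]; ring)

/-- Holomorphy of a Laurent monomial forces the exponents to be nonnegative wherever the domain
meets a coordinate hyperplane, in spite of the convention `0⁻¹ = 0`. -/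
theorem regular_of_differentiableOn_mono (hΩ : IsOpen Ω) {α : Fin n → ℤ}
    (h : DifferentiableOn ℂ (mono α) Ω) : ∀ z ∈ Ω, ∀ j, z j = 0 → 0 ≤ α j := by
  classical
  intro z hz j hj
  obtain ⟨p, hp, hpj, hp0⟩ := exists_mem_ne_zero hΩ hz {j}
  have hpj0 : p j = 0 := (hpj j rfl).trans hj
  have h1 : DifferentiableAt ℂ (mono α) (Function.update p j (0 : ℂ)) := by
    rw [← hpj0, Function.update_eq_self]; exact h.differentiableAt (hΩ.mem_nhds hp)
  have h2 : DifferentiableAt ℂ (fun t => mono α (Function.update p j t)) (0 : ℂ) :=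
    h1.comp (0 : ℂ) (hasFDerivAt_update p (0 : ℂ)).differentiableAt
  let C : ℂ := ∏ i ∈ Finset.univ.erase j, p i ^ α i
  have hC : C ≠ 0 := Finset.prod_ne_zero_iff.2 fun i hi =>
    zpow_ne_zero _ (hp0 i (Finset.ne_of_mem_erase hi))
  have h3 : (fun t => mono α (Function.update p j t)) = fun t => t ^ α j * C := by
    funext t
    rw [mono, ← Finset.mul_prod_erase _ _ (Finset.mem_univ j), Function.update_self]
    congr 1
    exact Finset.prod_congr rfl fun i hi => by
      rw [Function.update_of_ne (Finset.ne_of_mem_erase hi)]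
  rw [h3] at h2
  have h4 : DifferentiableAt ℂ (fun t : ℂ => t ^ α j) 0 := by
    have := h2.mul_const C⁻¹
    simpa [mul_assoc, hC] using this
  exact (differentiableAt_zpow.1 h4).resolve_left (by simp)

/-! ### The orthonormal basis of monomials -/

/-- Jensen's inequality for the square of the modulus. -/
theorem sq_norm_integral_le {X : Type*} [MeasurableSpace X] {μ : Measure X}
    [IsProbabilityMeasure μ] {F : X → ℂ} (h1 : Integrable (fun x => ‖F x‖) μ)
    (h2 : Integrable (fun x => ‖F x‖ ^ 2) μ) : ‖∫ x, F x ∂μ‖ ^ 2 ≤ ∫ x, ‖F x‖ ^ 2 ∂μ := by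
  set m := ∫ x, ‖F x‖ ∂μ with hm
  have h3 : 0 ≤ ∫ x, (‖F x‖ - m) ^ 2 ∂μ := integral_nonneg fun x => sq_nonneg _
  have h4 : ∫ x, (‖F x‖ - m) ^ 2 ∂μ = ∫ x, ‖F x‖ ^ 2 ∂μ - m ^ 2 := by
    have : ∀ x, (‖F x‖ - m) ^ 2 = ‖F x‖ ^ 2 - (2 * m * ‖F x‖ - m ^ 2) := fun x => by ring
    simp only [this]
    have h6 : Integrable (fun x => 2 * m * ‖F x‖) μ := h1.const_mul _
    have h7 : Integrable (fun x => 2 * m * ‖F x‖ - m ^ 2) μ := h6.sub (integrable_const _)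
    rw [integral_sub h2 h7, integral_sub h6 (integrable_const _), integral_const_mul, ← hm]
    simp; ring
  have h5 : ‖∫ x, F x ∂μ‖ ≤ m := norm_integral_le_integral_norm _
  have : ‖∫ x, F x ∂μ‖ ^ 2 ≤ m ^ 2 := by gcongr
  linarith

namespace IsAdmissibleReinhardt

/-- By Jensen's inequality, the homogeneous components of a square integrable function are square
integrable. -/
theorem memLp_homPart (hA : IsAdmissibleReinhardt Ω ω) {F : A2 Ω ω} {f : (Fin n → ℂ) → ℂ}
    (hf : Represents Ω ω f F) (α : Fin n → ℤ) : MemLp (homPart f α) 2 (wMeasure Ω ω) := by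
  have hd := differentiableOn_homPart hA.isOpen hA.isReinhardt hf.1 α
  have hm : AEStronglyMeasurable (homPart f α) (wMeasure Ω ω) :=
    (hd.continuousOn.aestronglyMeasurable hA.isOpen.measurableSet).mono_ac
      (withDensity_absolutelyContinuous _ _)
  have hi : Integrable (fun w => ‖f w‖ ^ 2) (wMeasure Ω ω) :=
    (memLp_two_iff_integrable_sq_norm hf.memLp.1).1 hf.memLp
  rw [memLp_two_iff_integrable_sq_norm hm]
  refine (integrable_rotation_average hA.isOpen hA.isReinhardt hA.weight hi).mono' (hm.norm.pow 2) ?_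
  filter_upwards [ae_mem_wMeasure hA.isOpen] with w hw
  have hc := continuous_rotation hA.isReinhardt hf.1.continuousOn hw
  have hc2 : Continuous fun x : Fin n → ℝ => (char (-α) : (Fin n → ℝ) → ℂ) x * f (torusPt x * w) :=
    (continuous_char _).mul hc
  rw [Real.norm_of_nonneg (by positivity)]
  have := sq_norm_integral_le (μ := volume.restrict (Icc (0 : Fin n → ℝ) 1))
    hc2.norm.integrableOn_Icc (hc2.norm.pow 2).integrableOn_Icc
  simpa only [norm_mul, norm_char, one_mul, homPart, cubeCoeff] using this

theorem regular (hA : IsAdmissibleReinhardt Ω ω) (α : allowable Ω ω) :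
    ∀ z ∈ Ω, ∀ j, z j = 0 → 0 ≤ (α : Fin n → ℤ) j :=
  regular_of_differentiableOn_mono hA.isOpen α.2.1

/-- The Laurent coefficient of a function in the Bergman space vanishes unless the monomial is
allowable. -/
theorem exists_homPart_eq (hA : IsAdmissibleReinhardt Ω ω) {F : A2 Ω ω} {f : (Fin n → ℂ) → ℂ}
    (hf : Represents Ω ω f F) (α : Fin n → ℤ) :
    ∃ c : ℂ, (∀ w ∈ Ω, mono α⁻ w * homPart f α w = c * mono α⁺ w) ∧
      (c ≠ 0 → α ∈ allowable Ω ω) := by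
  obtain ⟨c, hc⟩ := RadialAlgebra.exists_homPart_eq hA.isOpen hA.isConnected hA.isReinhardt hf.1 α
  refine ⟨c, hc, fun hc0 => ?_⟩
  have hreg := regular_of_homPart_eq hA.isOpen hc0 hc
  refine ⟨differentiableOn_mono hreg, ?_⟩
  refine (memLp_congr_ae ?_).1 ((hA.memLp_homPart hf α).const_mul c⁻¹)
  filter_upwards [ae_mem_wMeasure hA.isOpen] with w hw
  rw [homPart_eq_of_regular (hreg w hw) (hc w hw), inv_mul_cancel_left₀ hc0]

end IsAdmissibleReinhardt

/-- The same as `inner_smul_right`, for the scalar action that `A²(Ω, ω)` inherits from `Lp`. -/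
theorem inner_smul_right_A2 (F G : A2 Ω ω) (c : ℂ) :
    inner ℂ F (c • G) = c * inner ℂ F G := inner_smul_right F G c

theorem inner_smul_left_A2 (F G : A2 Ω ω) (c : ℂ) :
    inner ℂ (c • F) G = star c * inner ℂ F G := inner_smul_left F G c

/-- The monomial `e_α` as an element of the Bergman space. -/
def monoA2 (α : allowable Ω ω) : A2 Ω ω := ofMemLp α.2.1 α.2.2

theorem represents_monoA2 (α : allowable Ω ω) : Represents Ω ω (mono α) (monoA2 α) :=
  represents_ofMemLp _ _

theorem hasLaurentSeries_mono (α : Fin n → ℤ) :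
    HasLaurentSeries Ω (mono α) (Pi.single α 1) := by
  intro z _
  convert! hasSum_ite_eq α (mono α z) using 2 with β
  by_cases h : β = α
  · subst h; simp
  · simp [h]

namespace IsAdmissibleReinhardt

theorem monoA2_ne_zero (hA : IsAdmissibleReinhardt Ω ω) (α : allowable Ω ω) : monoA2 α ≠ 0 := by
  intro h
  obtain ⟨z₀, hz₀⟩ := hA.isConnected.nonempty
  obtain ⟨p, hp, -, hp0⟩ := exists_mem_ne_zero hA.isOpen hz₀ ∅
  have h1 := hA.represents_unique (represents_monoA2 α) (h ▸ represents_zero) hp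
  exact mono_ne_zero (fun j => hp0 j (notMem_empty j)) h1

theorem norm_monoA2_pos (hA : IsAdmissibleReinhardt Ω ω) (α : allowable Ω ω) : 0 < ‖monoA2 α‖ :=
  norm_pos_iff.2 (hA.monoA2_ne_zero α)

/-- The integral of `f` against `ē_α` sees only the homogeneous component of degree `α`. -/
theorem integral_star_mono_mul (hA : IsAdmissibleReinhardt Ω ω) {α : Fin n → ℤ}
    {f : (Fin n → ℂ) → ℂ}
    (hi : Integrable (fun w => star (mono α w) * f w) (wMeasure Ω ω)) :
    ∫ w, star (mono α w) * f w ∂(wMeasure Ω ω)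
      = ∫ w, star (mono α w) * homPart f α w ∂(wMeasure Ω ω) := by
  rw [integral_eq_integral_rotation_average hA.isOpen hA.isReinhardt hA.weight hi]
  refine integral_congr_ae (Filter.Eventually.of_forall fun w => ?_)
  simp only [homPart, cubeCoeff]
  rw [← integral_const_mul]
  congr 1
  funext x
  rw [mono_mul, char_neg, char_eq_mono, star_mul']
  ring

theorem inner_monoA2 (hA : IsAdmissibleReinhardt Ω ω) (α : allowable Ω ω) {F : A2 Ω ω}
    {f : (Fin n → ℂ) → ℂ} (hf : Represents Ω ω f F) {c : ℂ}
    (hc : ∀ w ∈ Ω, homPart f α w = c * mono α w) :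
    inner ℂ (monoA2 α) F = c * (‖monoA2 α‖ : ℂ) ^ 2 := by
  rw [(represents_monoA2 α).inner_eq hf,
    hA.integral_star_mono_mul ((represents_monoA2 α).integrable_star_mul hf)]
  have h1 : inner ℂ (monoA2 α) (c • monoA2 α) = c * (‖monoA2 α‖ : ℂ) ^ 2 := by
    rw [inner_smul_right_A2]
    exact congrArg (c * ·) (inner_self_eq_norm_sq_to_K (monoA2 α))
  rw [← h1, (represents_monoA2 α).inner_eq ((represents_monoA2 α).smul c)]
  refine integral_congr_ae ((ae_mem_wMeasure hA.isOpen).mono fun w hw => ?_)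
  simp only [hc w hw, Pi.smul_apply, smul_eq_mul]

theorem inner_monoA2_of_laurent (hA : IsAdmissibleReinhardt Ω ω) (α : allowable Ω ω) {F : A2 Ω ω}
    {f : (Fin n → ℂ) → ℂ} {c : (Fin n → ℤ) → ℂ} (hf : Represents Ω ω f F)
    (hc : HasLaurentSeries Ω f c) : inner ℂ (monoA2 α) F = c α * (‖monoA2 α‖ : ℂ) ^ 2 :=
  hA.inner_monoA2 α hf fun _ hw => hc.cubeCoeff_eq hA.isReinhardt hw α

/-- The norm of the coefficient functional is the reciprocal of the norm of the monomial. -/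
theorem coordNorm_eq (hA : IsAdmissibleReinhardt Ω ω) (α : allowable Ω ω) :
    coordNorm Ω ω α = ‖monoA2 α‖⁻¹ := by
  have h0 := hA.norm_monoA2_pos α
  refine IsLeast.csInf_eq ⟨⟨by positivity, fun F f c hf hc => ?_⟩, ?_⟩
  · have h1 := hA.inner_monoA2_of_laurent α hf hc
    have h2 := norm_inner_le_norm (𝕜 := ℂ) (monoA2 α) F
    rw [h1, norm_mul, norm_pow, Complex.norm_real, norm_norm] at h2
    rw [inv_mul_eq_div, le_div_iff₀ h0]
    nlinarith
  · rintro C ⟨-, hC⟩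
    have := hC (monoA2 α) (mono α) _ (represents_monoA2 α) (hasLaurentSeries_mono (α : Fin n → ℤ))
    rw [Pi.single_eq_same, norm_one] at this
    rw [inv_le_iff_one_le_mul₀ h0]
    exact this

theorem inner_monoA2_ne (hA : IsAdmissibleReinhardt Ω ω) {α β : allowable Ω ω} (h : α ≠ β) :
    inner ℂ (monoA2 α) (monoA2 β) = 0 := by
  rw [hA.inner_monoA2_of_laurent α (represents_monoA2 β) (hasLaurentSeries_mono (β : Fin n → ℤ)),
    Pi.single_eq_of_ne fun h' => h (Subtype.ext h'), zero_mul]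

/-- The normalized monomial `e_α / ‖e_α‖`. -/
def unitMono (α : allowable Ω ω) : A2 Ω ω := ((‖monoA2 α‖⁻¹ : ℝ) : ℂ) • monoA2 α

theorem orthonormal_unitMono (hA : IsAdmissibleReinhardt Ω ω) :
    Orthonormal ℂ (unitMono : allowable Ω ω → A2 Ω ω) := by
  refine ⟨fun α => ?_, fun α β h => ?_⟩
  · have h0 := hA.norm_monoA2_pos α
    rw [unitMono, norm_smul, Complex.norm_real, norm_inv, norm_norm, inv_mul_cancel₀ h0.ne']
  · simp only [unitMono, inner_smul_left_A2, inner_smul_right_A2, hA.inner_monoA2_ne h, mul_zero]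

/-- A function in the Bergman space orthogonal to all the monomials has no homogeneous component,
hence vanishes. -/
theorem eq_zero_of_inner_monoA2 (hA : IsAdmissibleReinhardt Ω ω) {F : A2 Ω ω}
    (h : ∀ α : allowable Ω ω, inner ℂ (monoA2 α) F = 0) : F = 0 := by
  have hf := rep_spec F
  have hzero : ∀ (α : Fin n → ℤ), ∀ w ∈ Ω, mono α⁻ w * homPart (rep F) α w = 0 := by
    intro α w hw
    obtain ⟨c, hc, hcΛ⟩ := hA.exists_homPart_eq hf α
    rw [hc w hw]
    by_cases hc0 : c = 0
    · rw [hc0, zero_mul]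
    · have h1 := hA.inner_monoA2 ⟨α, hcΛ hc0⟩ hf (c := c) fun v hv =>
        homPart_eq_of_regular (regular_of_homPart_eq hA.isOpen hc0 hc v hv) (hc v hv)
      rw [h] at h1
      have h2 := hA.norm_monoA2_pos ⟨α, hcΛ hc0⟩
      have h3 : ((‖monoA2 (⟨α, hcΛ hc0⟩ : allowable Ω ω)‖ : ℂ)) ^ 2 ≠ 0 :=
        pow_ne_zero _ (by exact_mod_cast h2.ne')
      exact absurd h1.symm (mul_ne_zero hc0 h3)
  have hstar : ∀ w ∈ Ω, (∀ j, w j ≠ 0) → rep F w = 0 := by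
    intro w hw hw0
    have := eq_zero_of_cubeCoeff_eq_zero (isPeriodic_rotation (rep F) w)
      (continuous_rotation hA.isReinhardt hf.1.continuousOn hw)
      (fun α => (mul_eq_zero.1 (hzero α w hw)).resolve_left (mono_ne_zero hw0)) 0
    simpa [torusPt_zero] using this
  obtain ⟨z₀, hz₀⟩ := hA.isConnected.nonempty
  obtain ⟨p, hp, -, hp0⟩ := exists_mem_ne_zero hA.isOpen hz₀ ∅
  refine hA.eq_of_represents hf represents_zero fun z hz => ?_
  refine eqOn_zero_of_eventuallyEq_zero hA.isOpen hA.isConnected.isPreconnected hf.1 hp ?_ z hz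
  have hne : ∀ᶠ w : Fin n → ℂ in nhds p, ∀ j, w j ≠ 0 := by
    rw [Filter.eventually_all]
    exact fun j => (continuous_apply j).continuousAt.eventually_ne (hp0 j (notMem_empty j))
  filter_upwards [hne, hA.isOpen.mem_nhds hp] with w h1 h2 using hstar w h2 h1

/-- The Hilbert basis of normalized monomials. -/
def basis (hA : IsAdmissibleReinhardt Ω ω) : HilbertBasis (allowable Ω ω) ℂ (A2 Ω ω) :=
  haveI := hA.completeSpace_A2
  HilbertBasis.mkOfOrthogonalEqBot hA.orthonormal_unitMono <| by
    rw [Submodule.eq_bot_iff]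
    intro F hF
    refine hA.eq_zero_of_inner_monoA2 fun α => ?_
    have h1 := (Submodule.mem_orthogonal _ _).1 hF (unitMono α) (Submodule.subset_span ⟨α, rfl⟩)
    rw [unitMono, inner_smul_left_A2, mul_eq_zero] at h1
    refine h1.resolve_left ?_
    simpa using hA.monoA2_ne_zero α

theorem basis_apply (hA : IsAdmissibleReinhardt Ω ω) (α : allowable Ω ω) :
    hA.basis α = unitMono α := by
  have := hA.completeSpace_A2
  rw [basis, HilbertBasis.coe_mkOfOrthogonalEqBot]

end IsAdmissibleReinhardt

/-! ### Multipliers of the monomial basis -/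

theorem mono_mul_star (α : Fin n → ℤ) (z w : Fin n → ℂ) :
    mono α (z * star w) = mono α z * star (mono α w) := by
  rw [mono_mul]
  simp [mono]

theorem norm_mono_unit {l : Fin n → ℂ} (hl : ∀ j, ‖l j‖ = 1) (α : Fin n → ℤ) : ‖mono α l‖ = 1 := by
  simp [mono, hl]

theorem memlp_mono_unit {l : Fin n → ℂ} (hl : ∀ j, ‖l j‖ = 1) :
    Memℓp (fun α : allowable Ω ω => mono (α : Fin n → ℤ) l) ∞ :=
  memℓp_infty ⟨1, by rintro _ ⟨α, rfl⟩; exact (norm_mono_unit hl α).le⟩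

namespace IsAdmissibleReinhardt

theorem coordNorm_pos (hA : IsAdmissibleReinhardt Ω ω) (α : allowable Ω ω) :
    0 < coordNorm Ω ω α := by
  rw [hA.coordNorm_eq]; exact inv_pos.2 (hA.norm_monoA2_pos α)

theorem coordNorm_sq_ne_zero (hA : IsAdmissibleReinhardt Ω ω) (α : allowable Ω ω) :
    (coordNorm Ω ω α : ℂ) ^ 2 ≠ 0 :=
  pow_ne_zero _ (by exact_mod_cast (hA.coordNorm_pos α).ne')

theorem coordNorm_sq_mul_norm_sq (hA : IsAdmissibleReinhardt Ω ω) (α : allowable Ω ω) :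
    (coordNorm Ω ω α : ℂ) ^ 2 * (‖monoA2 α‖ : ℂ) ^ 2 = 1 := by
  have h0 := (hA.norm_monoA2_pos α).ne'
  rw [hA.coordNorm_eq, ← mul_pow, ← Complex.ofReal_mul, inv_mul_cancel₀ h0]
  simp

theorem basis_eq_smul (hA : IsAdmissibleReinhardt Ω ω) (α : allowable Ω ω) :
    hA.basis α = (coordNorm Ω ω α : ℂ) • monoA2 α := by
  rw [hA.basis_apply, unitMono, hA.coordNorm_eq]

theorem eval_basis (hA : IsAdmissibleReinhardt Ω ω) {z : Fin n → ℂ} (hz : z ∈ Ω)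
    (α : allowable Ω ω) : hA.eval hz (hA.basis α) = (coordNorm Ω ω α : ℂ) * mono α z := by
  rw [hA.basis_eq_smul, map_smul, hA.eval_eq hz (represents_monoA2 α), smul_eq_mul]

theorem hasSum_eval (hA : IsAdmissibleReinhardt Ω ω) {z : Fin n → ℂ} (hz : z ∈ Ω) (F : A2 Ω ω) :
    HasSum (fun α => hA.basis.repr F α * ((coordNorm Ω ω α : ℂ) * mono α z)) (hA.eval hz F) := by
  have h := (hA.basis.hasSum_repr F).mapL (hA.eval hz)
  simpa only [map_smul, hA.eval_basis, smul_eq_mul] using h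

/-- The reproducing kernel of the Bergman space at the point `z`. -/
def evalKernel (hA : IsAdmissibleReinhardt Ω ω) {z : Fin n → ℂ} (hz : z ∈ Ω) : A2 Ω ω :=
  haveI := hA.completeSpace_A2
  (InnerProductSpace.toDual ℂ (A2 Ω ω)).symm (hA.eval hz)

theorem inner_evalKernel (hA : IsAdmissibleReinhardt Ω ω) {z : Fin n → ℂ} (hz : z ∈ Ω)
    (F : A2 Ω ω) : inner ℂ (hA.evalKernel hz) F = hA.eval hz F := by
  have := hA.completeSpace_A2
  exact InnerProductSpace.toDual_symm_apply

theorem repr_evalKernel (hA : IsAdmissibleReinhardt Ω ω) {z : Fin n → ℂ} (hz : z ∈ Ω)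
    (α : allowable Ω ω) :
    hA.basis.repr (hA.evalKernel hz) α = (coordNorm Ω ω α : ℂ) * star (mono α z) := by
  rw [HilbertBasis.repr_apply_apply]
  refine (inner_conj_symm (hA.basis α) (hA.evalKernel hz)).symm.trans ?_
  rw [hA.inner_evalKernel, hA.eval_basis, map_mul, Complex.conj_ofReal]
  rfl

/-- The operator on the Bergman space with eigenvectors `e_α` and eigenvalues `m α`. -/
def multiplier (hA : IsAdmissibleReinhardt Ω ω) (m : lp (fun _ : allowable Ω ω => ℂ) ∞) :
    A2 Ω ω →L[ℂ] A2 Ω ω :=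
  (hA.basis.repr.symm.toContinuousLinearEquiv.toContinuousLinearMap).comp
    ((lp.mapCLM 2 (fun α => m α • ContinuousLinearMap.id ℂ ℂ) (norm_nonneg m) fun α =>
      (norm_smul_le _ _).trans <| by
        simpa using lp.norm_apply_le_norm ENNReal.top_ne_zero m α).comp
      hA.basis.repr.toContinuousLinearEquiv.toContinuousLinearMap)

theorem repr_multiplier (hA : IsAdmissibleReinhardt Ω ω) (m : lp (fun _ : allowable Ω ω => ℂ) ∞)
    (F : A2 Ω ω) (α : allowable Ω ω) :
    hA.basis.repr (hA.multiplier m F) α = m α * hA.basis.repr F α := by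
  simp [multiplier, lp.mapCLM]

theorem norm_multiplier_le (hA : IsAdmissibleReinhardt Ω ω)
    (m : lp (fun _ : allowable Ω ω => ℂ) ∞) : ‖hA.multiplier m‖ ≤ ‖m‖ := by
  refine ContinuousLinearMap.opNorm_le_bound _ (norm_nonneg m) fun F => ?_
  rw [multiplier]
  simp only [ContinuousLinearMap.comp_apply]
  refine (hA.basis.repr.symm.norm_map _).le.trans ?_
  refine (ContinuousLinearMap.le_of_opNorm_le _ (lp.norm_mapCLM_le _ _ _ _) _).trans_eq ?_
  congr 1
  exact hA.basis.repr.norm_map F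

theorem multiplier_monoA2 (hA : IsAdmissibleReinhardt Ω ω)
    (m : lp (fun _ : allowable Ω ω => ℂ) ∞) (α : allowable Ω ω) :
    hA.multiplier m (monoA2 α) = m α • monoA2 α := by
  classical
  have h0 : (coordNorm Ω ω α : ℂ) ≠ 0 := by exact_mod_cast (hA.coordNorm_pos α).ne'
  have h1 : hA.multiplier m (hA.basis α) = m α • hA.basis α := by
    apply hA.basis.repr.injective
    ext β
    rw [hA.repr_multiplier, map_smul, lp.coeFn_smul, Pi.smul_apply, smul_eq_mul,
      hA.basis.repr_self]
    by_cases h : β = α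
    · rw [h]
    · rw [lp.single_apply_ne _ _ _ h, mul_zero, mul_zero]
  rw [hA.basis_eq_smul, map_smul, smul_comm] at h1
  exact smul_right_injective _ h0 h1

/-- A bounded operator is determined by its values at the monomials. -/
theorem clm_ext (hA : IsAdmissibleReinhardt Ω ω) {R T : A2 Ω ω →L[ℂ] A2 Ω ω}
    (h : ∀ α : allowable Ω ω, R (monoA2 α) = T (monoA2 α)) : R = T := by
  ext1 F
  refine ((hA.basis.hasSum_repr F).mapL R).unique ?_
  convert! (hA.basis.hasSum_repr F).mapL T using 2 with α
  rw [map_smul, map_smul, hA.basis_eq_smul, map_smul, map_smul, h]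

/-- A bounded operator with the eigenvectors `e_α` is a multiplier, and its norm is the supremum
of its eigenvalues. -/
theorem exists_multiplier (hA : IsAdmissibleReinhardt Ω ω) {R : A2 Ω ω →L[ℂ] A2 Ω ω}
    {a : allowable Ω ω → ℂ} (h : ∀ α, R (monoA2 α) = a α • monoA2 α) :
    ∃ m : lp (fun _ : allowable Ω ω => ℂ) ∞, (∀ α, m α = a α) ∧ R = hA.multiplier m ∧
      ‖R‖ = ‖m‖ := by
  have hb : ∀ α, ‖a α‖ ≤ ‖R‖ := fun α => by
    have h1 := R.le_opNorm (monoA2 α)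
    rw [h, norm_smul] at h1
    exact le_of_mul_le_mul_right h1 (hA.norm_monoA2_pos α)
  let m : lp (fun _ : allowable Ω ω => ℂ) ∞ :=
    ⟨a, memℓp_infty ⟨‖R‖, by rintro _ ⟨α, rfl⟩; exact hb α⟩⟩
  have hR : R = hA.multiplier m := hA.clm_ext fun α => by rw [h, hA.multiplier_monoA2]
  refine ⟨m, fun _ => rfl, hR, le_antisymm ?_ (lp.norm_le_of_forall_le (norm_nonneg R) hb)⟩
  rw [hR]
  exact hA.norm_multiplier_le m

theorem eval_multiplier (hA : IsAdmissibleReinhardt Ω ω)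
    (m : lp (fun _ : allowable Ω ω => ℂ) ∞) {z : Fin n → ℂ} (hz : z ∈ Ω) (F : A2 Ω ω) :
    HasSum (fun α => m α * hA.basis.repr F α * ((coordNorm Ω ω α : ℂ) * mono α z))
      (hA.eval hz (hA.multiplier m F)) := by
  simpa only [hA.repr_multiplier] using hA.hasSum_eval hz (hA.multiplier m F)

/-- The rotation by `l` is the multiplier with eigenvalues `l^α`. -/
theorem isRadial_multiplier (hA : IsAdmissibleReinhardt Ω ω)
    (m : lp (fun _ : allowable Ω ω => ℂ) ∞) : IsRadial Ω ω (hA.multiplier m) := by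
  intro l hl
  let v : lp (fun _ : allowable Ω ω => ℂ) ∞ := ⟨_, memlp_mono_unit hl⟩
  refine ⟨hA.multiplier v, fun F f hf => ?_, hA.clm_ext fun α => ?_⟩
  · refine (rep_spec _).congr hA.isOpen fun z hz => ?_
    have hlz := hA.isReinhardt z hz l hl
    change f (l * z) = hA.eval hz (hA.multiplier v F)
    rw [← hA.eval_eq hlz hf]
    refine (hA.hasSum_eval hlz F).unique ?_
    convert! hA.eval_multiplier v hz F using 2 with α
    rw [mono_mul]
    change _ = mono α l * _ * _
    ring
  · simp only [ContinuousLinearMap.comp_apply, hA.multiplier_monoA2, map_smul]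
    exact smul_comm _ _ _

end IsAdmissibleReinhardt

/-! ### Symbols of multipliers -/

/-- The symbol `∑_{α ∈ Λ} ‖c_α‖² m_α z^α`. -/
def symbolSum (m : lp (fun _ : allowable Ω ω => ℂ) ∞) (z : Fin n → ℂ) : ℂ :=
  ∑' α : allowable Ω ω, (coordNorm Ω ω α : ℂ) ^ 2 * m α * mono α z

/-- A family on `Λ`, extended by zero to all multi-indices. -/
def extendZero (a : allowable Ω ω → ℂ) : (Fin n → ℤ) → ℂ := Function.extend Subtype.val a 0

theorem extendZero_coe (a : allowable Ω ω → ℂ) (α : allowable Ω ω) : extendZero a α = a α :=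
  Subtype.val_injective.extend_apply _ _ _

theorem extendZero_of_notMem (a : allowable Ω ω → ℂ) {α : Fin n → ℤ} (h : α ∉ allowable Ω ω) :
    extendZero a α = 0 :=
  Function.extend_apply' _ _ _ fun ⟨β, hβ⟩ => h (hβ ▸ β.2)

theorem hasSum_extendZero_iff {a : allowable Ω ω → ℂ} {b : (Fin n → ℤ) → ℂ} {s : ℂ} :
    HasSum (fun α => extendZero a α * b α) s ↔ HasSum (fun α : allowable Ω ω => a α * b α) s := by
  rw [← Subtype.val_injective.hasSum_iff (f := fun α => extendZero a α * b α)]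
  · exact Iff.of_eq (congrArg (HasSum · s) (funext fun α => congrArg (· * _) (extendZero_coe a α)))
  · intro α hα
    rw [extendZero_of_notMem a fun h => hα ⟨⟨α, h⟩, rfl⟩, zero_mul]

/-- The domain `Ω` need not lie in `Ω̃`, so convergence on `Ω` relies on feasibility. -/
theorem IsFeasible.summable_symbol (hfeas : IsFeasible Ω ω)
    (m : lp (fun _ : allowable Ω ω => ℂ) ∞) {z : Fin n → ℂ} (hz : z ∈ Ω) :
    Summable fun α : allowable Ω ω => (coordNorm Ω ω α : ℂ) ^ 2 * m α * mono α z := by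
  refine Summable.of_norm_bounded ((hfeas.summable z hz).norm.mul_left ‖m‖) fun α => ?_
  rw [mul_right_comm, norm_mul, mul_comm]
  exact mul_le_mul_of_nonneg_right (lp.norm_apply_le_norm ENNReal.top_ne_zero m α) (norm_nonneg _)

theorem IsFeasible.hasLaurentSeries_of_eqOn (hfeas : IsFeasible Ω ω) {g : (Fin n → ℂ) → ℂ}
    {m : lp (fun _ : allowable Ω ω => ℂ) ∞} (hg : EqOn g (symbolSum m) Ω) :
    HasLaurentSeries Ω g
      (extendZero fun α : allowable Ω ω => (coordNorm Ω ω α : ℂ) ^ 2 * m α) :=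
  fun z hz => hg hz ▸ hasSum_extendZero_iff.2 (hfeas.summable_symbol m hz).hasSum

namespace IsAdmissibleReinhardt

/-- At `p q̄` the series is Parseval's sum for the reproducing kernels at `p` and `q`, one of them
acted on by the multiplier. -/
theorem summable_symbol_tilde (hA : IsAdmissibleReinhardt Ω ω)
    (m : lp (fun _ : allowable Ω ω => ℂ) ∞) {z : Fin n → ℂ} (hz : z ∈ tildeSet Ω) :
    Summable fun α : allowable Ω ω => (coordNorm Ω ω α : ℂ) ^ 2 * m α * mono α z := by
  obtain ⟨p, hp, q, hq, rfl⟩ := hz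
  convert! (hA.eval_multiplier m hp (hA.evalKernel hq)).summable using 2 with α
  rw [hA.repr_evalKernel, mono_mul_star]
  ring

theorem regular_tilde (hA : IsAdmissibleReinhardt Ω ω) (α : allowable Ω ω) :
    ∀ z ∈ tildeSet Ω, ∀ j, z j = 0 → 0 ≤ (α : Fin n → ℤ) j := by
  rintro _ ⟨p, hp, q, hq, rfl⟩ j hj
  rcases mul_eq_zero.1 hj with h | h
  · exact hA.regular α p hp j h
  · exact hA.regular α q hq j (star_eq_zero.1 h)

theorem differentiableOn_symbolSum (hA : IsAdmissibleReinhardt Ω ω) (hfeas : IsFeasible Ω ω)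
    (m : lp (fun _ : allowable Ω ω => ℂ) ∞) : DifferentiableOn ℂ (symbolSum m) Ω :=
  differentiableOn_laurent hA.isOpen hA.regular fun _ => hfeas.summable_symbol m

theorem isExtension_symbolSum (hA : IsAdmissibleReinhardt Ω ω) (hfeas : IsFeasible Ω ω)
    (m : lp (fun _ : allowable Ω ω => ℂ) ∞) : IsExtension Ω (symbolSum m) (symbolSum m) := by
  refine ⟨differentiableOn_laurent (isOpen_tildeSet hA.isOpen) hA.regular_tilde fun _ =>
    hA.summable_symbol_tilde m, extendZero fun α => (coordNorm Ω ω α : ℂ) ^ 2 * m α, ?_, ?_⟩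
  · exact hfeas.hasLaurentSeries_of_eqOn fun _ _ => rfl
  · exact fun _ hz => hasSum_extendZero_iff.2 (hA.summable_symbol_tilde m hz).hasSum

/-- The kernel of a multiplier: `w ↦ conj (G (z w̄))` is the image of the reproducing kernel at `z`
under the multiplier with the conjugate eigenvalues. -/
theorem represents_star_symbolSum (hA : IsAdmissibleReinhardt Ω ω)
    (m : lp (fun _ : allowable Ω ω => ℂ) ∞) {z : Fin n → ℂ} (hz : z ∈ Ω) :
    Represents Ω ω (fun w => star (symbolSum m (z * star w)))
      (hA.multiplier (star m) (hA.evalKernel hz)) := by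
  refine (rep_spec _).congr hA.isOpen fun w hw => ?_
  change _ = hA.eval hw _
  refine HasSum.unique (HasSum.star (hA.summable_symbol_tilde m ⟨z, hz, w, hw, rfl⟩).hasSum) ?_
  convert! hA.eval_multiplier (star m) hw (hA.evalKernel hz) using 2 with α
  rw [hA.repr_evalKernel, mono_mul_star, lp.star_apply]
  simp only [star_mul', star_pow, star_star]
  simp only [Complex.star_def, Complex.conj_ofReal]
  ring

/-- The adjoint of a multiplier has the conjugate eigenvalues, tested against a reproducing kernel. -/
theorem inner_multiplier_star (hA : IsAdmissibleReinhardt Ω ω)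
    (m : lp (fun _ : allowable Ω ω => ℂ) ∞) {z : Fin n → ℂ} (hz : z ∈ Ω) (F : A2 Ω ω) :
    inner ℂ (hA.multiplier (star m) (hA.evalKernel hz)) F = hA.eval hz (hA.multiplier m F) := by
  refine (hA.basis.hasSum_inner_mul_inner _ F).unique ?_
  convert! hA.eval_multiplier m hz F using 2 with α
  rw [← hA.basis.repr_apply_apply]
  refine (congrArg (· * _) (inner_conj_symm (hA.multiplier (star m) (hA.evalKernel hz))
    (hA.basis α)).symm).trans ?_
  rw [← hA.basis.repr_apply_apply, hA.repr_multiplier, hA.repr_evalKernel, lp.star_apply]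
  simp only [← Complex.star_def, star_mul', star_star]
  simp only [Complex.star_def, Complex.conj_ofReal]
  ring

/-- Every multiplier is the integral operator of its symbol. -/
theorem isIntegralOperator_symbolSum (hA : IsAdmissibleReinhardt Ω ω)
    (m : lp (fun _ : allowable Ω ω => ℂ) ∞) :
    IsIntegralOperator Ω ω (symbolSum m) (hA.multiplier m) := by
  intro F f hf
  have e : ∀ z : Fin n → ℂ, (fun w => f w * symbolSum m (z * star w))
      = fun w => star (star (symbolSum m (z * star w))) * f w := fun z => by
    funext w; rw [star_star, mul_comm]
  refine ⟨fun z hz => ?_, (rep_spec _).congr hA.isOpen fun z hz => ?_⟩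
  · rw [e]
    exact (hA.represents_star_symbolSum m hz).integrable_star_mul hf
  · change _ = hA.eval hz _
    simp only [e]
    rw [← hA.inner_multiplier_star, (hA.represents_star_symbolSum m hz).inner_eq hf]

theorem isOperatorOf_multiplier (hA : IsAdmissibleReinhardt Ω ω) (hfeas : IsFeasible Ω ω)
    {g : (Fin n → ℂ) → ℂ} {m : lp (fun _ : allowable Ω ω => ℂ) ∞} (hg : EqOn g (symbolSum m) Ω) :
    IsOperatorOf Ω ω g (hA.multiplier m) := by
  obtain ⟨hd, c, hc, hc'⟩ := hA.isExtension_symbolSum hfeas m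
  exact ⟨symbolSum m, ⟨hd, c, fun z hz => hg hz ▸ hc z hz, hc'⟩, hA.isIntegralOperator_symbolSum m⟩

/-- The monomials are eigenvectors of the operators `R_g`. -/
theorem operator_monoA2 (hA : IsAdmissibleReinhardt Ω ω) {G : (Fin n → ℂ) → ℂ}
    {c : (Fin n → ℤ) → ℂ} {R : A2 Ω ω →L[ℂ] A2 Ω ω} (hc : HasLaurentSeries (tildeSet Ω) G c)
    (hR : IsIntegralOperator Ω ω G R) (α : allowable Ω ω) :
    R (monoA2 α) = (c α * (‖monoA2 α‖ : ℂ) ^ 2) • monoA2 α := by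
  refine hA.eval_ext fun z hz => ?_
  obtain ⟨hint, hrep⟩ := hR _ _ (represents_monoA2 α)
  rw [hA.eval_eq hz hrep, map_smul, hA.eval_eq hz (represents_monoA2 α)]
  -- the conjugate of the kernel has a Laurent series in `w`
  have hL : HasLaurentSeries Ω (fun w => star (G (z * star w)))
      fun β => star (c β * mono β z) := fun w hw => by
    convert! HasSum.star (hc _ ⟨z, hz, w, hw, rfl⟩) using 2 with β
    rw [mono_mul_star]
    simp only [star_mul', star_star]
    ring
  have e : (fun w => mono α w * G (z * star w))
      = fun w => star (star (mono (α : Fin n → ℤ) w) * star (G (z * star w))) := by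
    funext w; simp only [star_mul', star_star]
  have hi : Integrable (fun w => star (mono (α : Fin n → ℤ) w) * star (G (z * star w)))
      (wMeasure Ω ω) := by
    simpa only [Complex.conjCLE_apply, ContinuousLinearEquiv.coe_coe, map_mul,
      Complex.star_def] using
      Complex.conjCLE.toContinuousLinearMap.integrable_comp (hint z hz)
  have hs : ∫ w, star (star (mono (α : Fin n → ℤ) w) * star (G (z * star w))) ∂(wMeasure Ω ω)
      = star (∫ w, star (mono (α : Fin n → ℤ) w) * star (G (z * star w)) ∂(wMeasure Ω ω)) :=
    integral_conj
  have h1 : inner ℂ (monoA2 α) (monoA2 α) = (‖monoA2 α‖ : ℂ) ^ 2 :=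
    inner_self_eq_norm_sq_to_K (monoA2 α)
  have h2 : ∫ w, star (mono (α : Fin n → ℤ) w) * star (G (z * star w)) ∂(wMeasure Ω ω)
      = star (c α * mono α z) * (‖monoA2 α‖ : ℂ) ^ 2 := by
    rw [hA.integral_star_mono_mul hi, ← h1,
      (represents_monoA2 α).inner_eq (represents_monoA2 α), ← integral_const_mul]
    refine integral_congr_ae ((ae_mem_wMeasure hA.isOpen).mono fun w hw => ?_)
    have : homPart (fun w => star (G (z * star w))) α w = _ :=
      hL.cubeCoeff_eq hA.isReinhardt hw α
    simp only [this]
    ring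
  simp only [e]
  rw [hs, h2]
  simp only [star_mul', star_star, star_pow, smul_eq_mul]
  simp only [Complex.star_def, Complex.conj_ofReal]
  ring

end IsAdmissibleReinhardt

/-! ### Functions induced by distributions -/

/-- Polar coordinates. -/
theorem exists_torusPt_mul_eq (z : Fin n → ℂ) :
    ∃ x : Fin n → ℝ, torusPt x * (fun j => ((‖z j‖ : ℝ) : ℂ)) = z := by
  refine ⟨fun j => (z j).arg / (2 * Real.pi), funext fun j => ?_⟩
  have h := Complex.norm_mul_exp_arg_mul_I (z j)
  have e : 2 * (Real.pi : ℂ) * Complex.I * (((z j).arg / (2 * Real.pi) : ℝ) : ℂ)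
      = (z j).arg * Complex.I := by
    push_cast
    field_simp
  rw [Pi.mul_apply, torusPt, e, mul_comm, h]

theorem IsReinhardt.norm_mem (hR : IsReinhardt Ω) {z : Fin n → ℂ} (hz : z ∈ Ω) :
    (fun j => ((‖z j‖ : ℝ) : ℂ)) ∈ Ω := by
  obtain ⟨x, hx⟩ := exists_torusPt_mul_eq z
  have := hR.torusPt_mul_mem hz (-x)
  rwa [← hx, ← mul_assoc, ← torusPt_add, neg_add_cancel, torusPt_zero, one_mul] at this

theorem integral_char_mul_char (α β : Fin n → ℤ) :
    ∫ x in Icc (0 : Fin n → ℝ) 1, (char α : (Fin n → ℝ) → ℂ) x * (char (-β) : (Fin n → ℝ) → ℂ) x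
      = if α = β then 1 else 0 := by
  have := cubeCoeff_char (-α) (-β)
  rw [cubeCoeff, neg_neg] at this
  simpa only [neg_inj] using this

theorem IsKernelDistrib.distFourierCoeff_eq {r : Fin n → ℝ} {K : PeriodicDistribution n}
    (hK : IsKernelDistrib Ω ω r K) (β : Fin n → ℤ) :
    distFourierCoeff K β = extendZero (fun α : allowable Ω ω =>
      (coordNorm Ω ω α : ℂ) ^ 2 * mono α (fun j => (r j : ℂ))) β := by
  have h := hasSum_extendZero_iff (a := fun α : allowable Ω ω =>
    (coordNorm Ω ω α : ℂ) ^ 2 * mono α (fun j => (r j : ℂ))) (b := fun α => ∫ x in Icc (0 : Fin n → ℝ) 1,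
    (char α : (Fin n → ℝ) → ℂ) x * (char (-β) : (Fin n → ℝ) → ℂ) x) |>.2 (hK (char (-β)))
  refine h.unique ?_
  convert! hasSum_ite_eq β (extendZero (fun α : allowable Ω ω =>
      (coordNorm Ω ω α : ℂ) ^ 2 * mono α (fun j => (r j : ℂ))) β) using 2 with α
  rw [integral_char_mul_char]
  split_ifs with h <;> simp [h]

theorem exists_isKernelDistrib (hR : IsReinhardt Ω) (hfeas : IsFeasible Ω ω) {r : Fin n → ℝ}
    (hr : r ∈ shadow Ω) : ∃ K : PeriodicDistribution n, IsKernelDistrib Ω ω r K := by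
  obtain ⟨z, hz, rfl⟩ := hr
  have hs := hfeas.summable _ (hR.norm_mem hz)
  set a : allowable Ω ω → ℂ := fun α =>
    (coordNorm Ω ω α : ℂ) ^ 2 * mono α (fun j => ((‖z j‖ : ℝ) : ℂ)) with ha
  have hb : ∀ α, ‖extendZero a α‖ ≤ ∑' α, ‖a α‖ := by
    intro α
    by_cases h : α ∈ allowable Ω ω
    · rw [extendZero_coe a ⟨α, h⟩]
      exact hs.norm.le_tsum _ fun _ _ => norm_nonneg _
    · rw [extendZero_of_notMem a h, norm_zero]
      exact tsum_nonneg fun _ => norm_nonneg _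
  obtain ⟨K, hK⟩ := exists_distribution (a := fun α => extendZero a (-α))
    ⟨_, 0, fun α => by simpa using hb (-α)⟩
  refine ⟨K, fun φ => ?_⟩
  have h := (Equiv.neg (Fin n → ℤ)).hasSum_iff.2 (hK φ)
  refine hasSum_extendZero_iff (a := a) (b := fun α => ∫ x in Icc (0 : Fin n → ℝ) 1,
    (char α : (Fin n → ℝ) → ℂ) x * (φ : (Fin n → ℝ) → ℂ) x) |>.1 ?_
  convert! h using 2 with α
  simp only [Function.comp_apply, Equiv.neg_apply, neg_neg, cubeCoeff]
  rw [mul_comm]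

/-- A function on `Ω` is induced by `u` exactly if it is the sum of the Laurent series with the
coefficients `‖c_α‖² û(α)`. -/
theorem inducedBy_iff (hR : IsReinhardt Ω) (hfeas : IsFeasible Ω ω) {g : (Fin n → ℂ) → ℂ}
    {u : PeriodicDistribution n} :
    InducedBy Ω ω g u ↔ ∀ z ∈ Ω, HasSum
      (fun α : allowable Ω ω => (coordNorm Ω ω α : ℂ) ^ 2 * distFourierCoeff u α * mono α z)
      (g z) := by
  -- the Fourier series of `K_r * u`
  have key : ∀ {r : Fin n → ℝ} {K L : PeriodicDistribution n}, IsKernelDistrib Ω ω r K →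
      IsConvolution K u L → ∀ (x : Fin n → ℝ) (s : ℂ),
      HasSum (fun α => distFourierCoeff L α * (char α : (Fin n → ℝ) → ℂ) x) s ↔
        HasSum (fun α : allowable Ω ω => (coordNorm Ω ω α : ℂ) ^ 2 * distFourierCoeff u α *
          mono α (torusPt x * fun j => (r j : ℂ))) s := by
    intro r K L hK hL x s
    have e : (fun α => distFourierCoeff L α * (char α : (Fin n → ℝ) → ℂ) x)
        = fun α => extendZero (fun α : allowable Ω ω =>
          (coordNorm Ω ω α : ℂ) ^ 2 * mono α (fun j => (r j : ℂ))) α *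
            (distFourierCoeff u α * (char α : (Fin n → ℝ) → ℂ) x) := by
      funext α
      rw [← hK.distFourierCoeff_eq, ← mul_assoc]
      congr 1
      exact hL.apply_char _
    rw [e]
    refine (hasSum_extendZero_iff (b := fun α =>
      distFourierCoeff u α * (char α : (Fin n → ℝ) → ℂ) x)).trans (Iff.of_eq ?_)
    congr 1
    funext α
    rw [mono_mul, ← char_eq_mono]
    ring
  have hpt : ∀ (r x : Fin n → ℝ),
      (fun j => (r j : ℂ) * Complex.exp (2 * Real.pi * Complex.I * (x j : ℂ)))
        = torusPt x * fun j => (r j : ℂ) := by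
    intro r x
    funext j
    rw [Pi.mul_apply, torusPt, mul_comm]
  constructor
  · intro h z hz
    obtain ⟨x, hx⟩ := exists_torusPt_mul_eq z
    obtain ⟨K, L, hK, hL, hs⟩ := h _ ⟨z, hz, rfl⟩
    have h1 := hs x
    rw [hpt] at h1
    have h2 := (key hK hL x _).1 h1
    simp only [hx] at h2
    exact h2
  · intro h r hr
    obtain ⟨K, hK⟩ := exists_isKernelDistrib hR hfeas hr
    obtain ⟨L, hL⟩ := exists_isConvolution K u
    refine ⟨K, L, hK, hL, fun x => ?_⟩
    rw [hpt, key hK hL]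
    obtain ⟨z, hz, rfl⟩ := hr
    exact h _ (hR.torusPt_mul_mem (hR.norm_mem hz) x)

/-! ### Symbols and their Fourier coefficients -/

namespace IsAdmissibleReinhardt

theorem hasLaurentSeries_of_inducedBy (hA : IsAdmissibleReinhardt Ω ω) (hfeas : IsFeasible Ω ω)
    {g : (Fin n → ℂ) → ℂ} {u : PeriodicDistribution n} (hu : InducedBy Ω ω g u) :
    HasLaurentSeries Ω g (extendZero fun α : allowable Ω ω =>
      (coordNorm Ω ω α : ℂ) ^ 2 * distFourierCoeff u α) :=
  fun z hz => hasSum_extendZero_iff.2 ((inducedBy_iff hA.isReinhardt hfeas).1 hu z hz)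

theorem coeff_unique (hA : IsAdmissibleReinhardt Ω ω) {g : (Fin n → ℂ) → ℂ}
    {a b : allowable Ω ω → ℂ}
    (ha : HasLaurentSeries Ω g (extendZero fun α => (coordNorm Ω ω α : ℂ) ^ 2 * a α))
    (hb : HasLaurentSeries Ω g (extendZero fun α => (coordNorm Ω ω α : ℂ) ^ 2 * b α)) : a = b := by
  funext α
  have h := congrFun (ha.unique hA.isOpen hA.isConnected.nonempty hA.isReinhardt hb) α
  rw [extendZero_coe, extendZero_coe] at h
  exact mul_left_cancel₀ (hA.coordNorm_sq_ne_zero α) h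

theorem operator_eq_of_laurent (hA : IsAdmissibleReinhardt Ω ω) {g : (Fin n → ℂ) → ℂ}
    {a : allowable Ω ω → ℂ} {R : A2 Ω ω →L[ℂ] A2 Ω ω}
    (ha : HasLaurentSeries Ω g (extendZero fun α => (coordNorm Ω ω α : ℂ) ^ 2 * a α))
    (hR : IsOperatorOf Ω ω g R) (α : allowable Ω ω) : R (monoA2 α) = a α • monoA2 α := by
  obtain ⟨G, ⟨-, c, hc, hc'⟩, hI⟩ := hR
  rw [hA.operator_monoA2 hc' hI,
    hc.unique hA.isOpen hA.isConnected.nonempty hA.isReinhardt ha, extendZero_coe, mul_right_comm,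
    hA.coordNorm_sq_mul_norm_sq, one_mul]

theorem inducedBy_iff_coeff (hA : IsAdmissibleReinhardt Ω ω) (hfeas : IsFeasible Ω ω)
    {g : (Fin n → ℂ) → ℂ} {m : lp (fun _ : allowable Ω ω => ℂ) ∞} (hg : EqOn g (symbolSum m) Ω)
    {u : PeriodicDistribution n} :
    InducedBy Ω ω g u ↔ ∀ α : allowable Ω ω, distFourierCoeff u α = m α := by
  constructor
  · intro hu
    exact congrFun (hA.coeff_unique (hA.hasLaurentSeries_of_inducedBy hfeas hu)
      (hfeas.hasLaurentSeries_of_eqOn hg))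
  · intro h
    rw [inducedBy_iff hA.isReinhardt hfeas]
    intro z hz
    simp only [h]
    rw [hg hz]
    exact (hfeas.summable_symbol m hz).hasSum

theorem norm_operator_eq (hA : IsAdmissibleReinhardt Ω ω) (hfeas : IsFeasible Ω ω)
    {g : (Fin n → ℂ) → ℂ} {m : lp (fun _ : allowable Ω ω => ℂ) ∞} (hg : EqOn g (symbolSum m) Ω)
    {R : A2 Ω ω →L[ℂ] A2 Ω ω} (hR : IsOperatorOf Ω ω g R) : ‖R‖ = ‖m‖ := by
  obtain ⟨m', hm', -, h⟩ := hA.exists_multiplier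
    (hA.operator_eq_of_laurent (hfeas.hasLaurentSeries_of_eqOn hg) hR)
  rw [h, show m' = m from lp.ext (funext hm')]

/-- A bounded family, extended by zero to all multi-indices, is the family of Fourier coefficients of
a distribution. -/
theorem exists_inducedBy (hA : IsAdmissibleReinhardt Ω ω) (hfeas : IsFeasible Ω ω)
    {g : (Fin n → ℂ) → ℂ} {m : lp (fun _ : allowable Ω ω => ℂ) ∞} (hg : EqOn g (symbolSum m) Ω) :
    ∃ u, InducedBy Ω ω g u := by
  have hb : ∀ α, ‖extendZero (m : allowable Ω ω → ℂ) α‖ ≤ ‖m‖ := by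
    intro α
    by_cases h : α ∈ allowable Ω ω
    · rw [extendZero_coe _ ⟨α, h⟩]
      exact lp.norm_apply_le_norm ENNReal.top_ne_zero m _
    · rw [extendZero_of_notMem _ h, norm_zero]
      exact norm_nonneg m
  obtain ⟨u, hu⟩ := exists_distribution_char (a := fun α => extendZero (m : allowable Ω ω → ℂ) (-α))
    ⟨‖m‖, 0, fun α => by simpa using hb (-α)⟩
  refine ⟨u, (hA.inducedBy_iff_coeff hfeas hg).2 fun α => ?_⟩
  rw [distFourierCoeff, hu, neg_neg, extendZero_coe]

theorem exists_eqOn_symbolSum (hA : IsAdmissibleReinhardt Ω ω) (hfeas : IsFeasible Ω ω)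
    (g : SymbolAlgebra Ω ω) :
    ∃ m : lp (fun _ : allowable Ω ω => ℂ) ∞, EqOn g.toFun (symbolSum m) Ω := by
  obtain ⟨u, hu⟩ := g.induced
  obtain ⟨R, hR, -⟩ := g.bounded_radial
  obtain ⟨m, hm, -⟩ := hA.exists_multiplier
    (hA.operator_eq_of_laurent (hA.hasLaurentSeries_of_inducedBy hfeas hu) hR)
  refine ⟨m, fun z hz => ((inducedBy_iff hA.isReinhardt hfeas).1 hu z hz).unique ?_⟩
  simp only [← hm]
  exact (hfeas.summable_symbol m hz).hasSum

/-- The element of the symbol algebra with given bounded Fourier coefficients, that is, the symbol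
`∑ ‖c_α‖² m_α z^α` on `Ω`, set to zero outside. -/
def ofCoeff (hA : IsAdmissibleReinhardt Ω ω) (hfeas : IsFeasible Ω ω)
    (m : lp (fun _ : allowable Ω ω => ℂ) ∞) : SymbolAlgebra Ω ω where
  toFun := Ω.indicator (symbolSum m)
  eq_zero_outside _ hz := indicator_of_notMem hz _
  analytic := (hA.differentiableOn_symbolSum hfeas m).congr (eqOn_indicator)
  induced := hA.exists_inducedBy hfeas eqOn_indicator
  bounded_radial := ⟨hA.multiplier m, hA.isOperatorOf_multiplier hfeas eqOn_indicator,
    hA.isRadial_multiplier m⟩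

end IsAdmissibleReinhardt

theorem SymbolAlgebra.ext_of_eqOn {g h : SymbolAlgebra Ω ω} (e : EqOn g.toFun h.toFun Ω) :
    g = h := by
  have : g.toFun = h.toFun := by
    funext z
    by_cases hz : z ∈ Ω
    · exact e hz
    · rw [g.eq_zero_outside z hz, h.eq_zero_outside z hz]
  cases g; cases h; congr

namespace IsAdmissibleReinhardt

/-- The bijection `g ↦ (û(α))_α` between symbols and bounded families. -/
def symbolEquiv (hA : IsAdmissibleReinhardt Ω ω) (hfeas : IsFeasible Ω ω) :
    SymbolAlgebra Ω ω ≃ lp (fun _ : allowable Ω ω => ℂ) ∞ where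
  toFun g := Classical.choose (hA.exists_eqOn_symbolSum hfeas g)
  invFun := hA.ofCoeff hfeas
  left_inv g := SymbolAlgebra.ext_of_eqOn
    (eqOn_indicator.trans (Classical.choose_spec (hA.exists_eqOn_symbolSum hfeas g)).symm)
  right_inv m := by
    have h := Classical.choose_spec (hA.exists_eqOn_symbolSum hfeas (hA.ofCoeff hfeas m))
    exact lp.ext (hA.coeff_unique (hfeas.hasLaurentSeries_of_eqOn h)
      (hfeas.hasLaurentSeries_of_eqOn eqOn_indicator))

theorem eqOn_symbolEquiv (hA : IsAdmissibleReinhardt Ω ω) (hfeas : IsFeasible Ω ω)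
    (g : SymbolAlgebra Ω ω) : EqOn g.toFun (symbolSum (hA.symbolEquiv hfeas g)) Ω :=
  Classical.choose_spec (hA.exists_eqOn_symbolSum hfeas g)

end IsAdmissibleReinhardt

/-! ### Transport of the `C⋆`-structure and the predual of `ℓ^∞` -/

/-- The `C⋆`-algebra structure transported along a bijection. -/
@[reducible] def cstarAlgebraOfEquiv {S A : Type*} [CStarAlgebra A] (e : S ≃ A) :
    CStarAlgebra S :=
  letI : Ring S := e.ring
  letI : NormedRing S := NormedRing.induced S A e.ringEquiv e.injective
  letI : Algebra ℂ S := e.algebra ℂ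
  letI : NormedAlgebra ℂ S := NormedAlgebra.induced ℂ S A (e.algEquiv ℂ)
  letI : StarRing S :=
    { star := fun s => e.symm (star (e s))
      star_involutive := fun s => by
        change e.symm (star (e (e.symm (star (e s))))) = s
        simp
      star_mul := fun s t => by
        change e.symm (star (e (s * t)))
          = e.symm (e (e.symm (star (e t))) * e (e.symm (star (e s))))
        rw [Equiv.mul_def]
        simp
      star_add := fun s t => by
        change e.symm (star (e (s + t)))
          = e.symm (e (e.symm (star (e s))) + e (e.symm (star (e t))))
        rw [Equiv.add_def]
        simp }
  have hstar : ∀ s : S, e (star s) = star (e s) := fun s => e.apply_symm_apply _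
  have hmul : ∀ s t : S, e (s * t) = e s * e t := fun s t => e.apply_symm_apply _
  have hsmul : ∀ (c : ℂ) (s : S), e (c • s) = c • e s := fun c s => e.apply_symm_apply _
  have hiso : Isometry e := Isometry.of_dist_eq fun s t => rfl
  haveI : CompleteSpace S :=
    ((IsometryEquiv.mk e hiso).completeSpace_iff).2 inferInstance
  haveI : CStarRing S := ⟨fun s => by
    change ‖e s‖ * ‖e s‖ ≤ ‖e (star s * s)‖
    rw [hmul, hstar, CStarRing.norm_star_mul_self]⟩
  haveI : StarModule ℂ S := ⟨fun c s => e.injective <| by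
    rw [hstar, hsmul, hsmul, hstar, star_smul]⟩
  { }

theorem exists_cstarAlgebra_of_equiv {S A : Type*} [CStarAlgebra A] (e : S ≃ A) :
    ∃ (_ : CStarAlgebra S) (Φ : S ≃⋆ₐ[ℂ] A), (∀ s, Φ s = e s) ∧ ∀ s, ‖Φ s‖ = ‖s‖ := by
  let _ := cstarAlgebraOfEquiv e
  exact ⟨inferInstance,
    { e with
      map_mul' := fun s t => e.apply_symm_apply _
      map_add' := fun s t => e.apply_symm_apply _
      map_star' := fun s => e.apply_symm_apply _
      map_smul' := fun c s => e.apply_symm_apply _ }, fun _ => rfl, fun _ => rfl⟩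

/-- The bilinear pairing `(m, f) ↦ ∑ m_i f_i` of `ℓ^∞` and `ℓ¹`. -/
def lpPairing (ι : Type*) : lp (fun _ : ι => ℂ) ∞ →L[ℂ] StrongDual ℂ (lp (fun _ : ι => ℂ) 1) :=
  lp.dualPairing ∞ 1 (fun _ : ι => ContinuousLinearMap.mul ℂ ℂ) (K := 1) fun _ =>
    (ContinuousLinearMap.opNorm_mul ℂ ℂ).le

theorem lpPairing_apply {ι : Type*} (m : lp (fun _ : ι => ℂ) ∞) (f : lp (fun _ : ι => ℂ) 1) :
    lpPairing ι m f = ∑' i, m i * f i := rfl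

theorem norm_lpPairing_le {ι : Type*} (m : lp (fun _ : ι => ℂ) ∞) : ‖lpPairing ι m‖ ≤ ‖m‖ :=
  ((lpPairing ι).le_of_opNorm_le (lp.norm_dualPairing _ _) m).trans_eq (one_mul _)

theorem lpPairing_single {ι : Type*} [DecidableEq ι] (m : lp (fun _ : ι => ℂ) ∞) (i : ι) :
    lpPairing ι m (lp.single 1 i (1 : ℂ)) = m i := by
  rw [lpPairing_apply, tsum_eq_single i fun j hj => by
    rw [lp.single_apply_ne _ _ _ hj, mul_zero], lp.single_apply_self, mul_one]

theorem dual_lp_one_apply {ι : Type*} [DecidableEq ι] (T : StrongDual ℂ (lp (fun _ : ι => ℂ) 1))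
    (f : lp (fun _ : ι => ℂ) 1) : T f = ∑' i, T (lp.single 1 i (1 : ℂ)) * f i := by
  refine ((lp.hasSum_single ENNReal.one_ne_top f).mapL T).tsum_eq.symm.trans ?_
  congr 1
  funext i
  have e : lp.single 1 i (f i) = f i • lp.single (E := fun _ : ι => ℂ) 1 i (1 : ℂ) := by
    rw [← lp.single_smul, smul_eq_mul, mul_one]
  rw [e, map_smul, smul_eq_mul, mul_comm]

/-- `ℓ^∞` is the dual of `ℓ¹`: a functional corresponds to its values at the unit vectors. -/
def dualLpOneEquiv (ι : Type*) :
    StrongDual ℂ (lp (fun _ : ι => ℂ) 1) ≃ₗᵢ[ℂ] lp (fun _ : ι => ℂ) ∞ := by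
  classical
  have hb : ∀ (T : StrongDual ℂ (lp (fun _ : ι => ℂ) 1)) i,
      ‖T (lp.single 1 i (1 : ℂ))‖ ≤ ‖T‖ := fun T i => by
    have := T.le_opNorm (lp.single 1 i (1 : ℂ))
    rwa [lp.norm_single one_pos, norm_one, mul_one] at this
  let coeffs : StrongDual ℂ (lp (fun _ : ι => ℂ) 1) → lp (fun _ : ι => ℂ) ∞ := fun T =>
    ⟨fun i => T (lp.single 1 i (1 : ℂ)), memℓp_infty ⟨‖T‖, by rintro _ ⟨i, rfl⟩; exact hb T i⟩⟩
  have hinv : ∀ T, lpPairing ι (coeffs T) = T := fun T =>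
    ContinuousLinearMap.ext fun f => (dual_lp_one_apply T f).symm
  exact
  { toFun := coeffs
    map_add' := fun _ _ => rfl
    map_smul' := fun _ _ => rfl
    invFun := lpPairing ι
    left_inv := hinv
    right_inv := fun m => lp.ext (funext (lpPairing_single m))
    norm_map' := fun T => by
      refine le_antisymm (lp.norm_le_of_forall_le (norm_nonneg T) (hb T)) ?_
      calc ‖T‖ = ‖lpPairing ι (coeffs T)‖ := by rw [hinv]
        _ ≤ ‖coeffs T‖ := norm_lpPairing_le _ }

/-- The definition of `WStarAlgebra` asks for a conjugate-linear isometry from the dual, which is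
obtained by composing the linear one with the involution. -/
theorem wstarAlgebra_of_equiv {S : Type} [CStarAlgebra S] {ι : Type}
    (Φ : S ≃⋆ₐ[ℂ] lp (fun _ : ι => ℂ) ∞) (hΦ : ∀ s, ‖Φ s‖ = ‖s‖) : WStarAlgebra S := by
  let Φ' : S ≃ₗᵢ[ℂ] lp (fun _ : ι => ℂ) ∞ :=
    { toLinearEquiv := { Φ with map_smul' := map_smul Φ }, norm_map' := hΦ }
  exact ⟨⟨lp (fun _ : ι => ℂ) 1, inferInstance, inferInstance, inferInstance,
    ⟨((dualLpOneEquiv ι).trans Φ'.symm).trans (starₗᵢ ℂ)⟩⟩⟩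

/-! ### The algebra of symbols -/

theorem star_mono (α : Fin n → ℤ) (z : Fin n → ℂ) : star (mono α z) = mono α (star z) := by
  simp [mono]

theorem IsReinhardt.star_mem (hR : IsReinhardt Ω) {z : Fin n → ℂ} (hz : z ∈ Ω) : star z ∈ Ω := by
  obtain ⟨x, hx⟩ := exists_torusPt_mul_eq (star z)
  rw [← hx]
  simpa only [Pi.star_apply, norm_star] using hR.torusPt_mul_mem (hR.norm_mem hz) x

end RadialAlgebra

end

open RadialAlgebra
theorem theorem4p5 {n : ℕ} (Ω : Set (Fin n → ℂ)) (ω : (Fin n → ℂ) → ENNReal)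
    (hopen : IsOpen Ω) (hconn : IsConnected Ω) (hbdd : Bornology.IsBounded Ω)
    (hR : IsReinhardt Ω) (hω : IsMultiRadialWeight Ω ω) (hadm : IsAdmissible Ω ω)
    (hfeas : IsFeasible Ω ω) :
    ∃ _inst : CStarAlgebra (SymbolAlgebra Ω ω),
      -- addition and scalar multiplication: pointwise, and compatible with the distributions
      (∀ (g h : SymbolAlgebra Ω ω) (z : Fin n → ℂ), (g + h).toFun z = g.toFun z + h.toFun z) ∧
      (∀ (c : ℂ) (g : SymbolAlgebra Ω ω) (z : Fin n → ℂ), (c • g).toFun z = c * g.toFun z) ∧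
      (∀ (g h : SymbolAlgebra Ω ω) (u v : PeriodicDistribution n),
        InducedBy Ω ω g.toFun u → InducedBy Ω ω h.toFun v →
          InducedBy Ω ω (g + h).toFun (u + v)) ∧
      (∀ (c : ℂ) (g : SymbolAlgebra Ω ω) (u : PeriodicDistribution n),
        InducedBy Ω ω g.toFun u → InducedBy Ω ω (c • g).toFun (c • u)) ∧
      -- product: induced by the convolution
      (∀ (g h : SymbolAlgebra Ω ω) (u v : PeriodicDistribution n),
        InducedBy Ω ω g.toFun u → InducedBy Ω ω h.toFun v →
          ∃ w : PeriodicDistribution n, IsConvolution u v w ∧ InducedBy Ω ω (g * h).toFun w) ∧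
      -- involution: `g*(z) = conj (g (conj z))`
      (∀ (g : SymbolAlgebra Ω ω), ∀ z ∈ Ω, (star g).toFun z = star (g.toFun (star z))) ∧
      -- norm: `‖g‖ = ‖R_g‖`
      (∀ (g : SymbolAlgebra Ω ω) (R : A2 Ω ω →L[ℂ] A2 Ω ω),
        IsOperatorOf Ω ω g.toFun R → ‖g‖ = ‖R‖) ∧
      -- von Neumann algebra
      WStarAlgebra (SymbolAlgebra Ω ω) ∧
      -- the `*`-isometric isomorphism `g ↦ û` onto `ℓ^∞(Λ)`
      ∃ Φ : SymbolAlgebra Ω ω ≃⋆ₐ[ℂ] lp (fun _ : allowable Ω ω => ℂ) ⊤,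
        (∀ g, ‖Φ g‖ = ‖g‖) ∧
        ∀ (g : SymbolAlgebra Ω ω) (u : PeriodicDistribution n), InducedBy Ω ω g.toFun u →
          ∀ α : allowable Ω ω, Φ g α = distFourierCoeff u α := by
  have hA : IsAdmissibleReinhardt Ω ω := ⟨hopen, hconn, hR, hω, hadm⟩
  obtain ⟨inst, Φ, hΦe, hΦ⟩ := exists_cstarAlgebra_of_equiv (hA.symbolEquiv hfeas)
  have hEq : ∀ g : SymbolAlgebra Ω ω, EqOn g.toFun (symbolSum (Φ g)) Ω := fun g =>
    hΦe g ▸ hA.eqOn_symbolEquiv hfeas g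
  have hInd : ∀ {g : SymbolAlgebra Ω ω} {u : PeriodicDistribution n}, InducedBy Ω ω g.toFun u ↔
      ∀ α : allowable Ω ω, distFourierCoeff u α = Φ g α := hA.inducedBy_iff_coeff hfeas (hEq _)
  have hsum : ∀ (g : SymbolAlgebra Ω ω) {z : Fin n → ℂ}, z ∈ Ω → HasSum
      (fun α : allowable Ω ω => (coordNorm Ω ω α : ℂ) ^ 2 * Φ g α * mono α z) (g.toFun z) :=
    fun g z hz => by
      rw [hEq g hz]
      exact (hfeas.summable_symbol _ hz).hasSum
  -- all the identities are checked on Laurent coefficients or on Fourier coefficients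
  refine ⟨inst, fun g h z => ?_, fun c g z => ?_, fun g h u v hu hv => ?_, fun c g u hu => ?_,
    fun g h u v hu hv => ?_, fun g z hz => ?_, fun g T hT => ?_, wstarAlgebra_of_equiv Φ hΦ, Φ, hΦ,
    fun g u hu α => (hInd.1 hu α).symm⟩
  · by_cases hz : z ∈ Ω
    · refine (hsum (g + h) hz).unique ?_
      convert! (hsum g hz).add (hsum h hz) using 2 with α
      rw [map_add, lp.coeFn_add, Pi.add_apply]
      ring
    · simp only [SymbolAlgebra.eq_zero_outside _ z hz, add_zero]
  · by_cases hz : z ∈ Ω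
    · refine (hsum (c • g) hz).unique ?_
      convert! (hsum g hz).mul_left c using 2 with α
      rw [map_smul, lp.coeFn_smul, Pi.smul_apply, smul_eq_mul]
      ring
    · simp only [SymbolAlgebra.eq_zero_outside _ z hz, mul_zero]
  · refine hInd.2 fun α => ?_
    rw [map_add, lp.coeFn_add, Pi.add_apply, ← hInd.1 hu, ← hInd.1 hv]
    rfl
  · refine hInd.2 fun α => ?_
    rw [map_smul, lp.coeFn_smul, Pi.smul_apply, ← hInd.1 hu]
    rfl
  · obtain ⟨w, hw⟩ := exists_isConvolution u v
    refine ⟨w, hw, hInd.2 fun α => ?_⟩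
    rw [map_mul, lp.infty_coeFn_mul, Pi.mul_apply, ← hInd.1 hu, ← hInd.1 hv]
    exact hw.apply_char _
  · refine (hsum (star g) hz).unique ?_
    convert! HasSum.star (hsum g (hR.star_mem hz)) using 2 with α
    rw [map_star, lp.star_apply, star_mul', star_mul', star_mono, star_star]
    simp only [Complex.star_def, map_pow, Complex.conj_ofReal]
  · rw [← hΦ, hA.norm_operator_eq hfeas (hEq g) hT]
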